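/- Let $p\ge 1$ and let $B$ be a standard $\mathbb{N}^p$-graded algebra over a Noetherian local ring $R=[B]_{(0,\ldots,0)}$ with maximal ideal $\mathfrak m$ (that is, $B$ is generated as an $R$-algebra by finitely many elements of degrees among the unit vectors $\mathbf e_1,\ldots,\mathbf e_p$). For $1\le i\le p$ let $H_i\subseteq [B]_{\mathbf e_i}$ be a nonzero $R$-submodule, $I_i=H_iB$ and $I=I_1+\cdots+I_p$. Let $B_+=\bigoplus_{\mathbf v\ne \mathbf 0}[B]_{\mathbf v}$ be the ideal of elements of positive total degree, $B_{++}=\bigoplus_{\mathbf v\ge (1,\ldots,1)}[B]_{\mathbf v}$, and let $X=\mathrm{MultiProj}(B)$ be the space of graded primes of $B$ not containing $B_{++}$. For a finitely generated $\mathbb{Z}^p$-graded $B$-module $M$ put $\mathscr R_M=\bigoplus_{\mathbf n\in\mathbb N^p} I_1^{n_1}\cdots I_p^{n_p}M\,T_1^{n_1}\cdots T_p^{n_p}\subseteq M[T_1,\ldots,T_p]$ and $\mathfrak G_M=\bigoplus_{k\ge 0} I^k\mathscr R_M/I^{k+1}\mathscr R_M$, graded over $\mathbb Z^p\oplus\mathbb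 N^p$ by $$[\mathfrak G_M]_{\mathbf v,\mathbf n}=\bigoplus_{k\ge0}\left[\frac{I^kI_1^{n_1}\cdots I_p^{n_p}M}{I^{k+1}I_1^{n_1}\cdots I_p^{n_p}M}\right]_{\mathbf v+\mathbf n}.$$ For $\alpha,\beta\in\mathbb N^p$ with $|\alpha|+|\beta|\ge\dim(\mathrm{Supp}(\widetilde M))$, where $\widetilde M$ is the coherent sheaf on $X$ determined by $M$, let $j^{\#}_{\alpha,\beta}(H_1,\ldots,H_p;M)$ be the mixed multiplicity of type $(\alpha,\beta)$ of $\mathrm H^0_{\mathfrak m}(B_+\mathfrak G_M)$, that is, the coefficient of $\frac{v_1^{\alpha_1}\cdots v_p^{\alpha_p}n_1^{\beta_1}\cdots n_p^{\beta_p}}{\alpha_1!\cdots\alpha_p!\,\beta_1!\cdots\beta_p!}$ in the Hilbert polynomial that agrees with $\mathrm{length}_R\big([\mathrm H^0_{\mathfrak m}(B_+\mathfrak G_M)]_{\mathbf v,\mathbf n}\big)$ for all $\mathbf v\gg\mathbf 0$ and $\mathbf n\gg\mathbf 0$. For $\mathbf t\in\mathbb N^p$ let $\mathscr H_{\mathbf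 t}\subseteq B$ be the ideal generated by $[B]_{\mathbf t}$. Let $\mathbf t,\mathbf t'\in\mathbb N^p$ with $\mathbf t'\ge\mathbf t$ (componentwise). Then, for all $\alpha,\beta\in\mathbb N^p$ with $|\alpha|+|\beta|\ge\dim(X)$, the invariants below are well defined (for every $\mathbf s\in\mathbb N^p$, the Hilbert polynomial of $\mathrm H^0_{\mathfrak m}(B_+\mathfrak G_{\mathscr H_{\mathbf s}})$ exists and has total degree at most $|\alpha|+|\beta|$), and $$j^{\#}_{\alpha,\beta}(H_1,\ldots,H_p;\mathscr H_{\mathbf t'})\;\le\; j^{\#}_{\alpha,\beta}(H_1,\ldots,H_p;\mathscr H_{\mathbf t}).$$ -/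

import Mathlib

namespace JointBlowup

noncomputable section

/-! ### Standard multigraded algebras and their multiprojective schemes -/

section Graded

variable {p : ℕ} {R B : Type*} [CommRing R] [CommRing B] [Algebra R B]

/-- The `ℕ^p`-graded `R`-algebra `B = ⨁ᵥ 𝒜 v` is standard over `R = [B]_0`: the structure map
identifies `R` with the degree zero part, and `B` is generated as an `R`-algebra by finitely many
elements, each of them of degree `e_i` for some `i`. -/
structure IsStandardGraded (𝒜 : (Fin p → ℕ) → Submodule R B) : Prop where
  injective : Function.Injective (algebraMap R B)
  surjective : ∀ b ∈ 𝒜 0, ∃ r : R, algebraMap R B r = b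
  generated : ∃ s : Finset B, (∀ b ∈ s, ∃ i : Fin p, b ∈ 𝒜 (Pi.single i 1)) ∧
    Algebra.adjoin R (s : Set B) = ⊤

/-- `B_{++} = ⨁_{v ≥ (1,…,1)} [B]_v`, the multigraded irrelevant ideal. -/
def multiIrrelevant (𝒜 : (Fin p → ℕ) → Submodule R B) : Ideal B :=
  Ideal.span {b | ∃ v : Fin p → ℕ, (∀ i, 1 ≤ v i) ∧ b ∈ 𝒜 v}

/-- `B_+`, the ideal of elements of positive total degree, generated by the homogeneous elements
of nonzero multidegree. -/
def positiveIdeal (𝒜 : (Fin p → ℕ) → Submodule R B) : Ideal B :=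
  Ideal.span {b | ∃ v : Fin p → ℕ, v ≠ 0 ∧ b ∈ 𝒜 v}

/-- `MultiProj(B)`: the graded primes of `B` that do not contain `B_{++}`. As a subset of `Spec B`
it carries the induced Zariski topology, and its dimension is that of this topological space. -/
def MultiProj (𝒜 : (Fin p → ℕ) → Submodule R B) [GradedAlgebra 𝒜] : Set (PrimeSpectrum B) :=
  {P | P.asIdeal.IsHomogeneous 𝒜 ∧ ¬ multiIrrelevant 𝒜 ≤ P.asIdeal}

/-- The ideal `ℋ_t ⊆ B` generated by the graded part `[B]_t`. -/
def degreeIdeal (𝒜 : (Fin p → ℕ) → Submodule R B) (t : Fin p → ℕ) : Ideal B :=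
  Ideal.span (𝒜 t : Set B)

/-- `B` as a `ℤ^p`-graded module: `[B]_v` for `v ≥ 0`, and zero otherwise. -/
def intGrading (𝒜 : (Fin p → ℕ) → Submodule R B) (v : Fin p → ℤ) : Submodule R B :=
  if ∀ i, 0 ≤ v i then 𝒜 (fun i => (v i).toNat) else ⊥

/-- The `ℤ^p`-grading `[J]_v = J ∩ [B]_v` of a (homogeneous) ideal `J` of `B`. -/
def idealGrading (𝒜 : (Fin p → ℕ) → Submodule R B) (J : Ideal B) (v : Fin p → ℤ) :
    Submodule R J :=
  (intGrading 𝒜 v).comap (J.subtype.restrictScalars R)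

end Graded

/-! ### Mixed `j`-multiplicities -/

section JMultiplicity

variable {p : ℕ} {R G : Type*} [CommRing R] [AddCommGroup G] [Module R G]

/-- `H⁰_𝔪(G)`: the elements of `G` that are annihilated by a power of the ideal `𝔪`. -/
def powerTorsion (𝔪 : Ideal R) (G : Type*) [AddCommGroup G] [Module R G] : Submodule R G where
  carrier := {x | ∃ k : ℕ, ∀ a ∈ 𝔪 ^ k, a • x = 0}
  zero_mem' := ⟨0, fun a _ => smul_zero a⟩
  add_mem' := by
    rintro x y ⟨k, hk⟩ ⟨l, hl⟩
    refine ⟨k + l, fun a ha => ?_⟩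
    rw [smul_add, hk a (Ideal.pow_le_pow_right (Nat.le_add_right k l) ha),
      hl a (Ideal.pow_le_pow_right (Nat.le_add_left l k) ha), add_zero]
  smul_mem' := by
    rintro c x ⟨k, hk⟩
    exact ⟨k, fun a ha => by rw [smul_comm, hk a ha, smul_zero]⟩

/-- For a `(ℤ^p ⊕ ℕ^p)`-graded module with graded pieces `𝒢 v n` and a graded submodule `N`, the
function `(v, n) ↦ length_R [H⁰_𝔪(N)]_{v,n}`, where `𝔪` is the maximal ideal of `R`. -/
def jHilbertFunction [IsLocalRing R] (𝒢 : (Fin p → ℤ) → (Fin p → ℕ) → Submodule R G)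
    (N : Submodule R G) (v : Fin p → ℤ) (n : Fin p → ℕ) : ℕ∞ :=
  Module.length R
    ↥(N ⊓ powerTorsion (IsLocalRing.maximalIdeal R) G ⊓ 𝒢 v n : Submodule R G)

/-- `P` is the Hilbert polynomial of `h`: for all `v ≫ 0` and `n ≫ 0` the value `h v n` is finite
and equal to `P(v, n)`. Such a polynomial is unique if it exists. -/
def IsHilbertPolynomial (h : (Fin p → ℤ) → (Fin p → ℕ) → ℕ∞)
    (P : MvPolynomial (Fin p ⊕ Fin p) ℚ) : Prop :=
  ∃ v₀ n₀ : Fin p → ℕ, ∀ v n : Fin p → ℕ, v₀ ≤ v → n₀ ≤ n →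
    ∃ c : ℕ, h (fun i => (v i : ℤ)) n = (c : ℕ∞) ∧
      MvPolynomial.eval (Sum.elim (fun i => (v i : ℚ)) (fun i => (n i : ℚ))) P = (c : ℚ)

/-- The coefficient of `v^α n^β / (α! β!)` in the polynomial `P(v, n)`. -/
def normalizedCoeff (P : MvPolynomial (Fin p ⊕ Fin p) ℚ) (α β : Fin p → ℕ) : ℚ :=
  (∏ i, ((α i).factorial : ℚ)) * (∏ i, ((β i).factorial : ℚ)) *
    MvPolynomial.coeff (Finsupp.equivFunOnFinite.symm (Sum.elim α β)) P

open Classical in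
/-- The mixed `j`-multiplicity `j_{α,β}(N) = e(α, β; H⁰_𝔪(N))`: the normalized coefficient of type
`(α, β)` of the Hilbert polynomial of `H⁰_𝔪(N)`. It is used for `|α| + |β|` at least the degree of
that polynomial, so it is a normalized leading coefficient if `|α| + |β|` is equal to the degree,
and zero if `|α| + |β|` is larger. -/
def mixedJMultiplicity [IsLocalRing R] (𝒢 : (Fin p → ℤ) → (Fin p → ℕ) → Submodule R G)
    (N : Submodule R G) (α β : Fin p → ℕ) : ℚ :=
  if hP : ∃ P, IsHilbertPolynomial (jHilbertFunction 𝒢 N) P then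
    normalizedCoeff hP.choose α β
  else 0

end JMultiplicity

/-! ### The joint blow-up construction -/

section Blowup

variable {p : ℕ} {R B : Type*} [CommRing R] [CommRing B] [Algebra R B]

/-- The ideal `I_1^{n_1} ⋯ I_p^{n_p}`, where `I_i ⊆ B` is the ideal generated by `H_i`. -/
def powerIdeal (H : Fin p → Submodule R B) (n : Fin p → ℕ) : Ideal B :=
  ∏ i, Ideal.span (H i : Set B) ^ n i

/-- The ideal `I = I_1 + ⋯ + I_p`. -/
def sumIdeal (H : Fin p → Submodule R B) : Ideal B :=
  ⨆ i, Ideal.span (H i : Set B)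

variable (H : Fin p → Submodule R B) (M : Type*) [AddCommGroup M] [Module B M]

/-- The Rees module `ℭ_M = ⨁_k I^k ℛ_M T^k` of the multi-Rees module
`ℛ_M = ⨁_n I_1^{n_1} ⋯ I_p^{n_p} M T_1^{n_1} ⋯ T_p^{n_p} ⊆ M[T_1, …, T_p]`, that is,
`ℭ_M = ⨁_{k, n} I^k I_1^{n_1} ⋯ I_p^{n_p} M T_1^{n_1} ⋯ T_p^{n_p} T^k ⊆ M[T_1, …, T_p, T]`.
An element of `M[T_1, …, T_p, T]` is the finitely supported family of its coefficients, the one at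
`(k, n)` being the coefficient of `T_1^{n_1} ⋯ T_p^{n_p} T^k`. -/
def reesModule : Submodule B (ℕ × (Fin p → ℕ) →₀ M) :=
  Finsupp.submodule fun x => (sumIdeal H ^ x.1 * powerIdeal H x.2) • (⊤ : Submodule B M)

/-- The module `𝔊_M = ℭ_M / I ℭ_M = ⨁_k I^k ℛ_M / I^{k+1} ℛ_M`, here as a module over `B` (the
multiplications by `B_+` and by the maximal ideal of `R` are all that the invariants involve). -/
abbrev AssocGraded : Type _ :=
  ↥(reesModule H M) ⧸ (sumIdeal H • (⊤ : Submodule B ↥(reesModule H M)))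

variable {M} [Module R M] [IsScalarTower R B M]

/-- The part of degree `(v, n)` of `M[T_1, …, T_p, T]`: the polynomials in which only the monomials
`T_1^{n_1} ⋯ T_p^{n_p} T^k` occur, with coefficients in `[M]_{v+n}`. Thus `m T^n T^k` with
`m` homogeneous has degree `(deg m - n, n)`. -/
def ambientPiece (ℳ : (Fin p → ℤ) → Submodule R M) (v : Fin p → ℤ) (n : Fin p → ℕ) :
    Submodule R (ℕ × (Fin p → ℕ) →₀ M) :=
  Finsupp.submodule fun x =>
    if x.2 = n then ℳ (fun i => v i + (n i : ℤ)) else ⊥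

/-- The graded part `[𝔊_M]_{v,n}`: the image of `[ℭ_M]_{v,n}`. -/
def gradedPiece (ℳ : (Fin p → ℤ) → Submodule R M) (v : Fin p → ℤ) (n : Fin p → ℕ) :
    Submodule R (AssocGraded H M) :=
  ((ambientPiece ℳ v n).comap ((reesModule H M).subtype.restrictScalars R)).map
    ((sumIdeal H • (⊤ : Submodule B ↥(reesModule H M))).mkQ.restrictScalars R)

/-- The graded submodule `B_+ 𝔊_M` of `𝔊_M`. -/
def positivePart (𝒜 : (Fin p → ℕ) → Submodule R B) (M : Type*) [AddCommGroup M] [Module B M]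
    [Module R M] [IsScalarTower R B M] : Submodule R (AssocGraded H M) :=
  (positiveIdeal 𝒜 • (⊤ : Submodule B (AssocGraded H M))).restrictScalars R

/-- The function `(v, n) ↦ length_R [H⁰_𝔪(B_+ 𝔊_M)]_{v,n}`. -/
def jSharpHilbertFunction [IsLocalRing R] (𝒜 : (Fin p → ℕ) → Submodule R B)
    (ℳ : (Fin p → ℤ) → Submodule R M) : (Fin p → ℤ) → (Fin p → ℕ) → ℕ∞ :=
  jHilbertFunction (gradedPiece H ℳ) (positivePart H 𝒜 M)

/-- The invariant `j^#_{α,β}(H_1, …, H_p; M) = j_{α,β}(B_+ 𝔊_M)`. -/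
def jSharp [IsLocalRing R] (𝒜 : (Fin p → ℕ) → Submodule R B)
    (ℳ : (Fin p → ℤ) → Submodule R M) (α β : Fin p → ℕ) : ℚ :=
  mixedJMultiplicity (gradedPiece H ℳ) (positivePart H 𝒜 M) α β

end Blowup

end

end JointBlowup

set_option linter.unusedSectionVars false

namespace JointBlowup

/-! ### Numerical polynomials in several variables -/

section NumericalPolynomial

open MvPolynomial

variable {τ : Type*}

/-! Choose finitely many generators of `B` and of the ideals `I_i`, and let `S` be the polynomial
ring over `R` with a variable for each generator of `B` and variables for `y T` and `y T_i` for each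
ideal generator `y` of direction `i`. It is graded in `2p` directions and acts on `B[T, T_1, …,
T_p]`. There `B_+ 𝔊` for `ℋ_t` is the quotient `Pos t / One t`, where at `T^k T^n` the module `Pos
t` has coefficients in `I^k I^n B_+ ℋ_t` and `One t` has coefficients in `I^{k+1} I^n ℋ_t`, with
`I^n = I_1^{n_1} ⋯ I_p^{n_p}`. Write also `Zero t` for the module with coefficients in `I^k I^n
ℋ_t`.

Polynomiality. A finitely generated graded `S`-module killed by a power of `𝔪` has an eventually
polynomial Hilbert function. Its degree is smaller than the number of members of any chain of
relevant primes (homogeneous, avoiding a variable in each direction) over the annihilator, and its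
coefficients in the highest admissible degree are nonnegative (`evPoly_hilb`, `evPoly_torsionHilb`).
Taking `𝔪`-torsion is not exact, but on short exact sequences it is additive up to lower degree: the
cokernel that measures the failure has no relevant prime minimal over the annihilator in its support
(`torsionHilb_add`).

Comparison. It suffices to treat `t' = t + e_i`. Filter `Pos t` by `One t ⊆ A₁ ⊆ A₂ ⊆ Pos t` with
`A₁ = Pos t' + One t` and `A₂ = Pos t ∩ (Zero t' + One t)`. The first factor is `Pos t' / (Pos t' ∩
One t)`. Division by `T` identifies the last one, in degrees whose component in direction `i`
exceeds `t_i`, with `(Pos t' ∩ One t) / One t'`. These two are the factors of `Pos t' / One t'`, so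
up to lower degree the Hilbert function for `t` is the one for `t'` plus that of the torsion of `A₂
/ A₁`, whose top coefficients are nonnegative (`sharpHilb_single`, `sharpHilb_le`).

Degree bound. A chain of relevant primes over the annihilator must have at most `dim X + 1` members
(`relevantBound_annIdeal`). A longer one is prolonged to the origin of `S` by killing the `2p`
directions one after the other, and downwards by the kernel of the map to `(B/𝔮)[T, T_1, …, T_p]`
for a homogeneous prime `𝔮` of `B`. The dimension inequality for the `p + 1` generators `y T, y T_1,
…, y T_p` turns this into a long chain of primes above `𝔮`, and `hasChain_of_chainTo` makes it a
chain in `X`, at the cost of `p` steps. That chain is too long. -/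

theorem exists_univariate_antidifference (n : ℕ) :
    ∃ q : Polynomial ℚ, ∀ x : ℚ, q.eval (x + 1) - q.eval x = x ^ n := by
  -- Bernoulli polynomials satisfy `B_{n+1}(x + 1) - B_{n+1}(x) = (n + 1) x^n`.
  refine ⟨Polynomial.C ((n + 1 : ℚ)⁻¹) * Polynomial.bernoulli (n + 1), fun x => ?_⟩
  have h := Polynomial.bernoulli_eval_one_add (n + 1) x
  have hn : (n + 1 : ℚ) ≠ 0 := by positivity
  rw [add_comm x 1]
  simp only [Polynomial.eval_mul, Polynomial.eval_C, h]
  push_cast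
  field_simp
  simp

section

variable [DecidableEq τ]

/-- The substitution `X_j ↦ X_j + 1`. -/
noncomputable def shiftVar (j : τ) : MvPolynomial τ ℚ →ₐ[ℚ] MvPolynomial τ ℚ :=
  aeval fun i => X i + C (if i = j then 1 else 0)

theorem eval_shiftVar (j : τ) (P : MvPolynomial τ ℚ) (x : τ → ℚ) :
    eval x (shiftVar j P) = eval (x + Pi.single j 1) P := by
  have : (eval x).comp (shiftVar j : MvPolynomial τ ℚ →ₐ[ℚ] MvPolynomial τ ℚ).toRingHom
      = eval (x + Pi.single j 1) := by
    ext i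
    · simp
    · simp [shiftVar, Pi.single_apply]
  exact congrArg (fun f => f P) this

theorem exists_antidifference (j : τ) (Q : MvPolynomial τ ℚ) :
    ∃ P : MvPolynomial τ ℚ, ∀ x : τ → ℚ,
      eval (x + Pi.single j 1) P - eval x P = eval x Q := by
  induction Q using MvPolynomial.induction_on' with
  | monomial u a =>
    obtain ⟨q, hq⟩ := exists_univariate_antidifference (u j)
    refine ⟨C a * (u.erase j).prod (fun i k => X i ^ k) * Polynomial.aeval (X j) q, fun x => ?_⟩
    have h1 : ∀ y : τ → ℚ, eval y (Polynomial.aeval (X j : MvPolynomial τ ℚ) q) = q.eval (y j) := by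
      intro y
      rw [← Polynomial.coe_aeval_eq_eval, ← MvPolynomial.coe_aeval_eq_eval]
      have := Polynomial.aeval_algHom_apply (MvPolynomial.aeval (R := ℚ) y) (X j) q
      simpa using this.symm
    have h2 : eval (x + Pi.single j 1) ((u.erase j).prod (fun i k => (X i : MvPolynomial τ ℚ) ^ k))
        = eval x ((u.erase j).prod (fun i k => X i ^ k)) := by
      simp only [Finsupp.prod, map_prod, map_pow, eval_X]
      refine Finset.prod_congr rfl fun i hi => ?_
      have : i ≠ j := by
        rintro rfl
        simp at hi
      simp [this]
    have h3 : eval x (monomial u a) = a * eval x ((u.erase j).prod (fun i k => X i ^ k)) * x j ^ u j := by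
      rw [eval_monomial, ← Finsupp.mul_prod_erase' u j (fun i k => x i ^ k) (by simp)]
      simp only [Finsupp.prod, map_prod, map_pow, eval_X]
      ring
    rw [map_mul, map_mul, map_mul, map_mul, h1, h1, h2, h3, ← hq]
    simp only [eval_C, Pi.add_apply, Pi.single_eq_same]
    ring
  | add p q hp hq =>
    obtain ⟨P, hP⟩ := hp
    obtain ⟨Q, hQ⟩ := hq
    refine ⟨P + Q, fun x => ?_⟩
    rw [map_add, map_add, map_add, ← hP, ← hQ]
    ring

end

/-- All monomials of `P` have total degree less than `D`. -/
def DegLT (D : ℕ) (P : MvPolynomial τ ℚ) : Prop :=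
  ∀ m : τ →₀ ℕ, D ≤ m.degree → coeff m P = 0

theorem DegLT.mono {D E : ℕ} (h : D ≤ E) {P : MvPolynomial τ ℚ} (hP : DegLT D P) : DegLT E P :=
  fun m hm => hP m (h.trans hm)

theorem DegLT.add {D : ℕ} {P Q : MvPolynomial τ ℚ} (hP : DegLT D P) (hQ : DegLT D Q) :
    DegLT D (P + Q) := fun m hm => by rw [coeff_add, hP m hm, hQ m hm, add_zero]

theorem DegLT.C_mul {D : ℕ} {P : MvPolynomial τ ℚ} (hP : DegLT D P) (a : ℚ) :
    DegLT D (C a * P) := fun m hm => by rw [coeff_C_mul, hP m hm, mul_zero]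

theorem DegLT.mul_X {D : ℕ} {P : MvPolynomial τ ℚ} (hP : DegLT D P) (i : τ) :
    DegLT (D + 1) (P * X i) := by
  classical
  intro m hm
  rw [coeff_mul_X']
  split_ifs with hi
  · apply hP
    have h1 : m = (m - Finsupp.single i 1) + Finsupp.single i 1 := by
      rw [tsub_add_cancel_of_le]
      simp only [Finsupp.single_le_iff]
      exact Nat.one_le_iff_ne_zero.2 (by simpa using hi)
    have h2 := congrArg Finsupp.degree h1
    simp only [map_add, Finsupp.degree_single] at h2
    omega
  · rfl

theorem degLT_monomial (m : τ →₀ ℕ) (a : ℚ) : DegLT (m.degree + 1) (monomial m a) := by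
  classical
  intro m' hm'
  rw [coeff_monomial, if_neg]
  rintro rfl
  omega

theorem exists_degLT (P : MvPolynomial τ ℚ) : ∃ D, DegLT D P := by
  refine ⟨P.totalDegree + 1, fun m hm => ?_⟩
  by_contra h
  have := le_totalDegree (mem_support_iff.2 h)
  have h2 : (m.sum fun _ e => e) = m.degree := rfl
  omega

section

variable [DecidableEq τ]

/-- Taylor expansion to first order: the remainder loses two degrees, the derivative one. Both
bounds are proved together because peeling off a variable from the remainder produces the derivative
of the rest. The truncated subtraction is harmless, since the remainder vanishes in degree at most
one. -/
theorem degLT_shiftVar_monomial (j : τ) (m : τ →₀ ℕ) (a : ℚ) :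
    DegLT (m.degree - 1) (shiftVar j (monomial m a) - monomial m a - pderiv j (monomial m a)) ∧
      DegLT m.degree (pderiv j (monomial m a)) := by
  have key : ∀ n (m : τ →₀ ℕ), m.degree = n →
      DegLT (m.degree - 1) (shiftVar j (monomial m a) - monomial m a - pderiv j (monomial m a)) ∧
      DegLT m.degree (pderiv j (monomial m a)) := by
    intro n
    induction n with
    | zero =>
      intro m hm
      have : m = 0 := (Finsupp.degree_eq_zero_iff m).1 hm
      subst this
      have e1 : shiftVar j (monomial (0 : τ →₀ ℕ) a) = monomial 0 a := by
        rw [← C_apply]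
        exact (shiftVar j).commutes a
      have e2 : pderiv j (monomial (0 : τ →₀ ℕ) a) = 0 := by
        simp
      rw [e1, e2]
      refine ⟨fun m _ => by simp, fun m _ => by simp⟩
    | succ n ih =>
      intro m hm
      have hne : m ≠ 0 := by
        rintro rfl
        simp at hm
      obtain ⟨i, hi⟩ : ∃ i, m i ≠ 0 := by
        by_contra h
        push Not at h
        exact hne (Finsupp.ext h)
      obtain ⟨m', rfl⟩ : ∃ m', m = m' + Finsupp.single i 1 :=
        ⟨m - Finsupp.single i 1, by
          rw [tsub_add_cancel_of_le]
          simpa using Nat.one_le_iff_ne_zero.2 hi⟩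
      have hd : m'.degree = n := by
        simpa using hm
      obtain ⟨h1, h2⟩ := ih m' hd
      have hmon : monomial (m' + Finsupp.single i 1) a = monomial m' a * X i := by
        rw [X, monomial_mul, mul_one]
      set p := monomial m' a with hp
      have hpd : pderiv j (p * X i) = pderiv j p * X i + C (if i = j then 1 else 0) * p := by
        rw [pderiv_mul, pderiv_X]
        rcases eq_or_ne i j with rfl | h
        · simp
        · simp [h]
      have hsh : shiftVar j (p * X i) = shiftVar j p * (X i + C (if i = j then 1 else 0)) := by
        rw [map_mul]
        simp [shiftVar]
      have hsum : shiftVar j (p * X i) - p * X i - pderiv j (p * X i) =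
          (shiftVar j p - p - pderiv j p) * X i +
          C (if i = j then 1 else 0) * ((shiftVar j p - p - pderiv j p) + pderiv j p) := by
        rw [hsh, hpd]
        ring
      rw [hmon, hm, hsum, hpd]
      rw [hd] at h1 h2
      refine ⟨DegLT.add ?_ ?_, DegLT.add (h2.mul_X i) ?_⟩
      · rcases Nat.eq_zero_or_pos n with rfl | hn
        · have : shiftVar j p - p - pderiv j p = 0 := by
            ext m
            exact h1 m (by omega)
          rw [this, zero_mul]
          exact fun m _ => by simp
        · have := h1.mul_X i
          exact this.mono (by omega)
      · exact ((h1.mono (by omega)).add h2).C_mul _ |>.mono (by omega)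
      · have := degLT_monomial m' a
        rw [hd] at this
        exact this.C_mul _
  exact key _ m rfl

/-- The monomials of `P` have degree at most `D - 1`, so the Taylor remainder lives in degree at
most `D - 3`; from degree `D - 2` on the difference is the derivative. -/
theorem coeff_shiftVar_sub (j : τ) {D : ℕ} {P : MvPolynomial τ ℚ} (hP : DegLT D P)
    (m : τ →₀ ℕ) (hm : D ≤ m.degree + 2) :
    coeff m (shiftVar j P - P) = (m j + 1) * coeff (m + Finsupp.single j 1) P := by
  have h : coeff m (shiftVar j P - P - pderiv j P) = 0 := by
    have hs : shiftVar j P - P - pderiv j P =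
        ∑ v ∈ P.support, (shiftVar j (monomial v (coeff v P)) - monomial v (coeff v P)
          - pderiv j (monomial v (coeff v P))) := by
      conv_lhs => rw [P.as_sum]
      simp only [map_sum, Finset.sum_sub_distrib]
    rw [hs, coeff_sum]
    refine Finset.sum_eq_zero fun v hv => ?_
    refine (degLT_shiftVar_monomial j v _).1 m ?_
    by_contra hc
    exact (mem_support_iff.1 hv) (hP v (by omega))
  rw [coeff_sub, sub_eq_zero] at h
  rw [h, coeff_pderiv]
  ring

/-- A crude degree bound is lowered one step at a time: a top monomial contains some `X_i`, and its
coefficient is, up to a positive factor, a coefficient of the difference in direction `i`. -/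
theorem DegLT.of_shiftVar_sub {r : ℕ} {P : MvPolynomial τ ℚ}
    (h : ∀ j, DegLT r (shiftVar j P - P)) : DegLT (r + 1) P := by
  obtain ⟨D, hD⟩ := exists_degLT P
  induction D with
  | zero => exact hD.mono (Nat.zero_le _)
  | succ D ih =>
    rcases Nat.lt_or_ge r D with hr | hr
    · apply ih
      intro m hm
      rcases Nat.eq_or_lt_of_le hm with hm | hm
      · have hne : m ≠ 0 := by
          rintro rfl
          simp at hm
          omega
        obtain ⟨i, hi⟩ : ∃ i, m i ≠ 0 := by
          by_contra h
          push Not at h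
          exact hne (Finsupp.ext h)
        obtain ⟨m', rfl⟩ : ∃ m', m = m' + Finsupp.single i 1 :=
          ⟨m - Finsupp.single i 1, by
            rw [tsub_add_cancel_of_le]
            simpa using Nat.one_le_iff_ne_zero.2 hi⟩
        simp only [map_add, Finsupp.degree_single] at hm
        have h1 := coeff_shiftVar_sub i hD m' (by omega)
        rw [h i m' (by omega)] at h1
        rcases mul_eq_zero.1 h1.symm with h2 | h2
        · exact absurd h2 (by positivity)
        · exact h2
      · exact hD m hm
    · exact hD.mono (by omega)

/-- A function whose partial differences agree with polynomials on `{d | N ≤ d}` agrees with a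
polynomial there. -/
theorem exists_polynomial_of_differences [Fintype τ] (N : ℤ) (f : (τ → ℤ) → ℚ)
    (Q : τ → MvPolynomial τ ℚ)
    (h : ∀ j, ∀ d : τ → ℤ, (∀ i, N ≤ d i) →
      f (d + Pi.single j 1) - f d = eval (fun i => (d i : ℚ)) (Q j)) :
    ∃ P : MvPolynomial τ ℚ, ∀ d : τ → ℤ, (∀ i, N ≤ d i) →
      f d = eval (fun i => (d i : ℚ)) P := by
  have hcast : ∀ (d : τ → ℤ) (j : τ), (fun i => ((d + Pi.single j 1 : τ → ℤ) i : ℚ)) =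
      (fun i => (d i : ℚ)) + Pi.single j 1 := by
    intro d j
    funext i
    rcases eq_or_ne i j with rfl | hij <;> simp [*]
  -- A function unchanged by unit steps in the directions of `s` may be evaluated with those
  -- coordinates reset to `N`.
  have collapse : ∀ (g : (τ → ℤ) → ℚ) (s : Finset τ),
      (∀ j ∈ s, ∀ d : τ → ℤ, (∀ i, N ≤ d i) → g (d + Pi.single j 1) = g d) →
      ∀ d : τ → ℤ, (∀ i, N ≤ d i) → g d = g (s.piecewise (fun _ => N) d) := by
    intro g s
    induction s using Finset.induction_on with
    | empty => intro _ d _; simp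
    | insert a s ha ih =>
      intro hg d hd
      have h1 := ih (fun j hj => hg j (Finset.mem_insert_of_mem hj)) d hd
      rw [Finset.piecewise_insert, h1]
      set e := s.piecewise (fun _ => N) d with he
      have hee : ∀ i, N ≤ e i := by
        intro i
        by_cases hi : i ∈ s <;> simp [he, hi, hd]
      have h2 : ∀ c : ℕ, g (Function.update e a (N + c)) = g (Function.update e a N) := by
        intro c
        induction c with
        | zero => simp
        | succ c ihc =>
          rw [← ihc, ← hg a (Finset.mem_insert_self _ _) (Function.update e a (N + c))]
          · congr 1
            funext i
            rcases eq_or_ne i a with rfl | hia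
            · simp [add_assoc]
            · simp [hia]
          · intro i
            rcases eq_or_ne i a with rfl | hia
            · simp
            · simpa [hia] using hee i
      have h3 : e = Function.update e a (N + ((e a - N).toNat : ℤ)) := by
        rw [Int.toNat_of_nonneg (by linarith [hee a])]
        simp
      conv_lhs => rw [h3]
      rw [h2]
  -- The polynomial is built one direction at a time, so that `f - P` is invariant under steps in
  -- the directions of `s`.
  have main : ∀ s : Finset τ, ∃ P : MvPolynomial τ ℚ, ∀ j ∈ s, ∀ d : τ → ℤ, (∀ i, N ≤ d i) →
      f (d + Pi.single j 1) - eval (fun i => ((d + Pi.single j 1 : τ → ℤ) i : ℚ)) P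
        = f d - eval (fun i => (d i : ℚ)) P := by
    intro s
    induction s using Finset.induction_on with
    | empty => exact ⟨0, by simp⟩
    | insert a s ha ih =>
      obtain ⟨P, hP⟩ := ih
      obtain ⟨P₂, hP₂⟩ := exists_antidifference a (Q a - (shiftVar a P - P))
      -- The correction `P₂` is evaluated with the coordinates in `s` frozen at `N`. This keeps it
      -- constant in the directions already treated, and loses nothing because `g` does not depend
      -- on those coordinates.
      set sub : MvPolynomial τ ℚ →ₐ[ℚ] MvPolynomial τ ℚ :=
        aeval (s.piecewise (fun _ => C (N : ℚ)) X) with hsub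
      have hevsub : ∀ (x : τ → ℚ) (A : MvPolynomial τ ℚ),
          eval x (sub A) = eval (s.piecewise (fun _ => (N : ℚ)) x) A := by
        intro x A
        have : (eval x).comp (sub : MvPolynomial τ ℚ →ₐ[ℚ] MvPolynomial τ ℚ).toRingHom
            = eval (s.piecewise (fun _ => (N : ℚ)) x) := by
          ext i
          · simp
          · by_cases hi : i ∈ s <;> simp [hsub, hi]
        exact congrArg (fun f => f A) this
      set g : (τ → ℤ) → ℚ := fun d => f d - eval (fun i => (d i : ℚ)) P with hg
      have hga : ∀ d : τ → ℤ, (∀ i, N ≤ d i) → g (d + Pi.single a 1) - g d =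
          eval (fun i => (d i : ℚ)) (Q a - (shiftVar a P - P)) := by
        intro d hd
        simp only [hg, map_sub, ← h a d hd, eval_shiftVar, hcast]
        ring
      have hpw : ∀ d : τ → ℤ, (fun i => ((s.piecewise (fun _ => N) d : τ → ℤ) i : ℚ)) =
          s.piecewise (fun _ => (N : ℚ)) (fun i => (d i : ℚ)) := by
        intro d
        funext i
        by_cases hi : i ∈ s <;> simp [hi]
      have hN : ∀ d : τ → ℤ, (∀ i, N ≤ d i) → ∀ i, N ≤ (s.piecewise (fun _ => N) d : τ → ℤ) i := by
        intro d hd i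
        by_cases hi : i ∈ s <;> simp [hi, hd]
      refine ⟨P + sub P₂, ?_⟩
      intro j hj d hd
      suffices g (d + Pi.single j 1) - eval (fun i => ((d + Pi.single j 1 : τ → ℤ) i : ℚ)) (sub P₂)
          = g d - eval (fun i => (d i : ℚ)) (sub P₂) by
        simp only [hg] at this
        rw [map_add, map_add, ← sub_sub, ← sub_sub]
        exact this
      rw [hevsub, hevsub]
      rcases Finset.mem_insert.1 hj with rfl | hj
      · have e1 := collapse g s hP d hd
        have hd' : ∀ i, N ≤ (d + Pi.single j 1 : τ → ℤ) i := by
          intro i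
          rcases eq_or_ne i j with rfl | hij
          · simp only [Pi.add_apply, Pi.single_eq_same]
            linarith [hd i]
          · simpa [hij] using hd i
        have e2 := collapse g s hP _ hd'
        have e3 : (s.piecewise (fun _ => N) (d + Pi.single j 1) : τ → ℤ) =
            s.piecewise (fun _ => N) d + Pi.single j 1 := by
          funext i
          by_cases hi : i ∈ s
          · have : i ≠ j := by rintro rfl; exact ha hi
            simp [hi, this]
          · simp [hi]
        rw [e1, e2, e3]
        have e4 := hga _ (hN d hd)
        rw [← hP₂, hpw] at e4
        have e5 : s.piecewise (fun _ => (N : ℚ)) (fun i => ((d + Pi.single j 1 : τ → ℤ) i : ℚ)) =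
            s.piecewise (fun _ => (N : ℚ)) (fun i => (d i : ℚ)) + Pi.single j 1 := by
          rw [← hpw, ← hpw, e3, hcast]
        rw [e5]
        linarith
      · have e1 : g (d + Pi.single j 1) = g d := hP j hj d hd
        have e2 : s.piecewise (fun _ => (N : ℚ)) (fun i => ((d + Pi.single j 1 : τ → ℤ) i : ℚ)) =
            s.piecewise (fun _ => (N : ℚ)) (fun i => (d i : ℚ)) := by
          funext i
          by_cases hi : i ∈ s
          · simp [hi]
          · have : i ≠ j := by rintro rfl; exact hi hj
            simp [hi, this]
        rw [e1, e2]
  obtain ⟨P, hP⟩ := main Finset.univ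
  set g : (τ → ℤ) → ℚ := fun d => f d - eval (fun i => (d i : ℚ)) P with hg
  refine ⟨P + C (g fun _ => N), fun d hd => ?_⟩
  have := collapse g Finset.univ hP d hd
  simp only [Finset.piecewise_univ] at this
  rw [map_add, eval_C, ← this]
  simp only [hg]
  ring

omit [DecidableEq τ] in
theorem eq_of_eval_eq_of_le [Finite τ] (N : ℤ) {P Q : MvPolynomial τ ℚ}
    (h : ∀ d : τ → ℤ, (∀ i, N ≤ d i) →
      eval (fun i => (d i : ℚ)) P = eval (fun i => (d i : ℚ)) Q) : P = Q := by
  refine MvPolynomial.funext_set (fun _ : τ => (fun n : ℤ => (n : ℚ)) '' Set.Ici N)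
    (fun _ => (Set.Ici_infinite N).image (Int.cast_injective.injOn)) fun x hx => ?_
  choose d hd using fun i => hx i (Set.mem_univ i)
  have := h d fun i => (hd i).1
  have e : (fun i => (d i : ℚ)) = x := funext fun i => (hd i).2
  rwa [e] at this

end

end NumericalPolynomial

end JointBlowup

namespace JointBlowup

/-! ### Functions that are eventually polynomial with nonnegative top coefficients -/

section EventuallyPolynomial

open MvPolynomial

variable {τ : Type*}

/-- The substitution `X_i ↦ X_i + c_i`. -/
noncomputable def translate (c : τ → ℚ) : MvPolynomial τ ℚ →ₐ[ℚ] MvPolynomial τ ℚ :=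
  aeval fun i => X i + C (c i)

theorem eval_translate (c : τ → ℚ) (P : MvPolynomial τ ℚ) (x : τ → ℚ) :
    eval x (translate c P) = eval (x + c) P := by
  have : (eval x).comp (translate c : MvPolynomial τ ℚ →ₐ[ℚ] MvPolynomial τ ℚ).toRingHom
      = eval (x + c) := by
    ext i
    · simp
    · simp [translate]
  exact congrArg (fun f => f P) this

theorem degLT_translate_monomial (c : τ → ℚ) (m : τ →₀ ℕ) (a : ℚ) :
    DegLT m.degree (translate c (monomial m a) - monomial m a) := by
  have key : ∀ n (m : τ →₀ ℕ), m.degree = n →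
      DegLT m.degree (translate c (monomial m a) - monomial m a) := by
    intro n
    induction n with
    | zero =>
      intro m hm
      obtain rfl : m = 0 := (Finsupp.degree_eq_zero_iff m).1 hm
      have e1 : translate c (monomial (0 : τ →₀ ℕ) a) = monomial 0 a := by
        rw [← C_apply]
        exact (translate c).commutes a
      rw [e1, sub_self]
      exact fun m _ => by simp
    | succ n ih =>
      intro m hm
      have hne : m ≠ 0 := by
        rintro rfl
        simp at hm
      obtain ⟨i, hi⟩ : ∃ i, m i ≠ 0 := by
        by_contra h
        push Not at h
        exact hne (Finsupp.ext h)
      obtain ⟨m', rfl⟩ : ∃ m', m = m' + Finsupp.single i 1 :=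
        ⟨m - Finsupp.single i 1, by
          rw [tsub_add_cancel_of_le]
          simpa using Nat.one_le_iff_ne_zero.2 hi⟩
      have hd : m'.degree = n := by
        simpa using hm
      have h1 := ih m' hd
      have hmon : monomial (m' + Finsupp.single i 1) a = monomial m' a * X i := by
        rw [X, monomial_mul, mul_one]
      set p := monomial m' a with hp
      have hsum : translate c (p * X i) - p * X i =
          (translate c p - p) * X i + C (c i) * ((translate c p - p) + p) := by
        have : translate c (p * X i) = translate c p * (X i + C (c i)) := by
          rw [map_mul]
          simp [translate]
        rw [this]
        ring
      rw [hmon, hm, hsum]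
      rw [hd] at h1
      have h2 := degLT_monomial m' a
      rw [hd] at h2
      exact (h1.mul_X i).add (((h1.mono (by omega)).add h2).C_mul _)
  exact key _ m rfl

theorem DegLT.translate_sub {D : ℕ} {P : MvPolynomial τ ℚ} (hP : DegLT D P) (c : τ → ℚ) :
    DegLT (D - 1) (translate c P - P) := by
  intro m hm
  have hs : translate c P - P =
      ∑ v ∈ P.support, (translate c (monomial v (coeff v P)) - monomial v (coeff v P)) := by
    conv_lhs => rw [P.as_sum]
    simp only [map_sum, Finset.sum_sub_distrib]
  rw [hs, coeff_sum]
  refine Finset.sum_eq_zero fun v hv => degLT_translate_monomial c v _ m ?_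
  by_contra hc
  exact (mem_support_iff.1 hv) (hP v (by omega))

/-- For `d ≫ 0` the value `h d` is finite and given by a polynomial of degree less than `r` whose
coefficients in degree `r - 1` are nonnegative. -/
def EvPoly (r : ℕ) (h : (τ → ℤ) → ℕ∞) : Prop :=
  ∃ (P : MvPolynomial τ ℚ) (N : ℤ), (∀ d : τ → ℤ, (∀ i, N ≤ d i) →
      ∃ c : ℕ, h d = c ∧ eval (fun i => (d i : ℚ)) P = c) ∧
    DegLT r P ∧ ∀ m : τ →₀ ℕ, r ≤ m.degree + 1 → 0 ≤ coeff m P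

theorem evPoly_zero {h : (τ → ℤ) → ℕ∞} (N : ℤ) (hN : ∀ d : τ → ℤ, (∀ i, N ≤ d i) → h d = 0) :
    EvPoly 0 h :=
  ⟨0, N, fun d hd => ⟨0, by simpa using hN d hd, by simp⟩, fun m _ => by simp, fun m _ => by simp⟩

theorem EvPoly.mono {r r' : ℕ} (hr : r ≤ r') {h : (τ → ℤ) → ℕ∞} (hh : EvPoly r h) :
    EvPoly r' h := by
  obtain ⟨P, N, h1, h2, h3⟩ := hh
  exact ⟨P, N, h1, h2.mono hr, fun m hm => h3 m (hr.trans hm)⟩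

theorem EvPoly.congr {r : ℕ} {h h' : (τ → ℤ) → ℕ∞} (hh : EvPoly r h) (N : ℤ)
    (hN : ∀ d : τ → ℤ, (∀ i, N ≤ d i) → h' d = h d) : EvPoly r h' := by
  obtain ⟨P, N', h1, h2⟩ := hh
  refine ⟨P, max N N', fun d hd => ?_, h2⟩
  rw [hN d fun i => (le_max_left _ _).trans (hd i)]
  exact h1 d fun i => (le_max_right _ _).trans (hd i)

theorem EvPoly.add {r : ℕ} {h h' : (τ → ℤ) → ℕ∞} (hh : EvPoly r h) (hh' : EvPoly r h') :
    EvPoly r (fun d => h d + h' d) := by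
  obtain ⟨P, N, h1, h2, h3⟩ := hh
  obtain ⟨P', N', h1', h2', h3'⟩ := hh'
  refine ⟨P + P', max N N', fun d hd => ?_, h2.add h2', fun m hm => ?_⟩
  · obtain ⟨c, hc, hc2⟩ := h1 d fun i => (le_max_left _ _).trans (hd i)
    obtain ⟨c', hc', hc2'⟩ := h1' d fun i => (le_max_right _ _).trans (hd i)
    exact ⟨c + c', by simp only [hc, hc']; push_cast; rfl, by rw [map_add, hc2, hc2']; push_cast; rfl⟩
  · rw [coeff_add]
    exact add_nonneg (h3 m hm) (h3' m hm)

/-- A translation changes a polynomial only below its top degree, so the sign condition survives. -/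
theorem EvPoly.shift [Finite τ] {r : ℕ} {h : (τ → ℤ) → ℕ∞} (hh : EvPoly r h) (e : τ → ℤ) :
    EvPoly r (fun d => h (d - e)) := by
  obtain ⟨P, N, h1, h2, h3⟩ := hh
  obtain ⟨E, hE⟩ : ∃ E : ℤ, ∀ i, e i ≤ E := by
    obtain ⟨E, hE⟩ := (Set.finite_range e).bddAbove
    exact ⟨E, fun i => hE ⟨i, rfl⟩⟩
  have h4 := h2.translate_sub (fun i => -(e i : ℚ))
  refine ⟨translate (fun i => -(e i : ℚ)) P, N + E, fun d hd => ?_, fun m hm => ?_, fun m hm => ?_⟩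
  · obtain ⟨c, hc, hc2⟩ := h1 (d - e) fun i => by
      have := hd i
      have := hE i
      simp only [Pi.sub_apply]
      linarith
    refine ⟨c, hc, ?_⟩
    rw [eval_translate, ← hc2]
    congr 2
    funext i
    simp [sub_eq_add_neg]
  · have := h4 m (by omega)
    rw [coeff_sub, h2 m hm, sub_zero] at this
    exact this
  · have := h4 m (by omega)
    rw [coeff_sub, sub_eq_zero] at this
    rw [this]
    exact h3 m hm

/-- Summation raises the degree by one. The sign condition passes from the differences to `h`
because a top coefficient of the polynomial of `h`, at a monomial divisible by `X_i`, is a positive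
multiple of one of the `i`-th difference. -/
theorem EvPoly.of_differences [Fintype τ] [DecidableEq τ] {r : ℕ} {h : (τ → ℤ) → ℕ∞}
    (hfin : ∀ d, h d ≠ ⊤) (N₀ : ℤ)
    (k : τ → (τ → ℤ) → ℕ∞) (hk : ∀ j, EvPoly r (k j))
    (hd : ∀ j, ∀ d : τ → ℤ, (∀ i, N₀ ≤ d i) → h (d + Pi.single j 1) = h d + k j d) :
    EvPoly (r + 1) h := by
  choose Q N hQ hQ2 hQ3 using hk
  obtain ⟨M, hM⟩ : ∃ M : ℤ, (∀ j, N j ≤ M) ∧ N₀ ≤ M := by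
    obtain ⟨M, hM⟩ := (Set.finite_range N).bddAbove
    exact ⟨max M N₀, fun i => (hM ⟨i, rfl⟩).trans (le_max_left _ _), le_max_right _ _⟩
  set f : (τ → ℤ) → ℚ := fun d => ((h d).toNat : ℚ) with hf
  have hfc : ∀ d, h d = ((h d).toNat : ℕ∞) := fun d => (ENat.natCast_toNat (hfin d)).symm
  obtain ⟨P, hP⟩ := exists_polynomial_of_differences M f Q (by
    intro j d hdM
    obtain ⟨c, hc, hc2⟩ := hQ j d fun i => (hM.1 j).trans (hdM i)
    have h1 := hd j d fun i => hM.2.trans (hdM i)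
    rw [hc, hfc d, hfc (d + _)] at h1
    have h2 : (h (d + Pi.single j 1)).toNat = (h d).toNat + c := by exact_mod_cast h1
    rw [hc2]
    simp only [hf, h2]
    push_cast
    ring)
  have hPQ : ∀ j, shiftVar j P - P = Q j := by
    intro j
    refine eq_of_eval_eq_of_le M fun d hdM => ?_
    obtain ⟨c, hc, hc2⟩ := hQ j d fun i => (hM.1 j).trans (hdM i)
    have h1 := hd j d fun i => hM.2.trans (hdM i)
    rw [hc, hfc d, hfc (d + _)] at h1
    have h2 : (h (d + Pi.single j 1)).toNat = (h d).toNat + c := by exact_mod_cast h1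
    have hdM' : ∀ i, M ≤ (d + Pi.single j 1 : τ → ℤ) i := by
      intro i
      rcases eq_or_ne i j with rfl | hij
      · simp only [Pi.add_apply, Pi.single_eq_same]
        linarith [hdM i]
      · simpa [hij] using hdM i
    have e := hP _ hdM'
    have hcast : (fun i => ((d + Pi.single j 1 : τ → ℤ) i : ℚ)) =
        (fun i => (d i : ℚ)) + Pi.single j 1 := by
      funext i
      rcases eq_or_ne i j with rfl | hij <;> simp [*]
    rw [hcast] at e
    rw [map_sub, eval_shiftVar, ← e, ← hP d hdM, hc2]
    simp only [hf, h2]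
    push_cast
    ring
  have hdeg : DegLT (r + 1) P := DegLT.of_shiftVar_sub fun j => by rw [hPQ]; exact hQ2 j
  refine ⟨P, M, fun d hdM => ⟨(h d).toNat, hfc d, (hP d hdM).symm⟩, hdeg, fun m hm => ?_⟩
  -- The constant monomial is not reached by differences; it is of top degree only for `r = 0`, and
  -- then the polynomial is a constant equal to a length.
  by_cases hm0 : m = 0
  · subst hm0
    have hr : r = 0 := by simpa using hm
    subst hr
    have hPC : P = C (coeff 0 P) := by
      ext m
      by_cases hm : m = 0
      · subst hm; simp
      · rw [coeff_C, if_neg (Ne.symm hm)]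
        apply hdeg
        have : m.degree ≠ 0 := fun h => hm ((Finsupp.degree_eq_zero_iff m).1 h)
        omega
    have := hP (fun _ => M) fun _ => le_rfl
    rw [hPC, eval_C] at this
    rw [← this]
    simp [hf]
  · obtain ⟨i, hi⟩ : ∃ i, m i ≠ 0 := by
      by_contra h
      push Not at h
      exact hm0 (Finsupp.ext h)
    obtain ⟨m', rfl⟩ : ∃ m', m = m' + Finsupp.single i 1 :=
      ⟨m - Finsupp.single i 1, by
        rw [tsub_add_cancel_of_le]
        simpa using Nat.one_le_iff_ne_zero.2 hi⟩
    simp only [map_add, Finsupp.degree_single] at hm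
    have h1 := coeff_shiftVar_sub i hdeg m' (by omega)
    rw [hPQ] at h1
    have h2 := hQ3 i m' (by omega)
    rw [h1] at h2
    exact nonneg_of_mul_nonneg_right h2 (by positivity)

end EventuallyPolynomial

/-! ### Lengths of subquotients -/

section RelLength

variable {R W W' : Type*} [CommRing R] [AddCommGroup W] [Module R W] [AddCommGroup W']
  [Module R W']

/-- The length of the subquotient `Y / (X ∩ Y)`. -/
noncomputable def relLength (X Y : Submodule R W) : ℕ∞ :=
  Module.length R (Y ⧸ X.submoduleOf Y)

theorem mkQ_submoduleOf_eq_zero {X Y : Submodule R W} (y : Y) :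
    (X.submoduleOf Y).mkQ y = 0 ↔ (y : W) ∈ X := by
  rw [Submodule.mkQ_apply, Submodule.Quotient.mk_eq_zero]
  exact Iff.rfl

theorem relLength_eq_length_of_surjective {V : Type*} [AddCommGroup V] [Module R V]
    (X Y : Submodule R W) (f : Y →ₗ[R] V) (hf : Function.Surjective f)
    (h : ∀ y : Y, f y = 0 ↔ (y : W) ∈ X) : relLength X Y = Module.length R V := by
  have hk : LinearMap.ker f = X.submoduleOf Y := by
    ext y
    rw [LinearMap.mem_ker, h]
    exact Iff.rfl
  unfold relLength
  rw [← hk]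
  exact LinearEquiv.length_eq (f.quotKerEquivOfSurjective hf)

theorem relLength_eq_of_map {X Y : Submodule R W} {X' Y' : Submodule R W'} (f : W →ₗ[R] W')
    (h1 : ∀ y ∈ Y, f y ∈ Y') (h2 : ∀ y ∈ Y, f y ∈ X' ↔ y ∈ X)
    (h3 : ∀ y' ∈ Y', ∃ y ∈ Y, f y - y' ∈ X') : relLength X Y = relLength X' Y' := by
  refine relLength_eq_length_of_surjective X Y
    ((X'.submoduleOf Y').mkQ.comp (f.restrict h1)) ?_ ?_
  · intro z
    obtain ⟨y', rfl⟩ := Submodule.mkQ_surjective _ z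
    obtain ⟨y, hy, hyX⟩ := h3 y' y'.2
    refine ⟨⟨y, hy⟩, ?_⟩
    rw [LinearMap.comp_apply, ← sub_eq_zero, ← map_sub]
    exact (mkQ_submoduleOf_eq_zero _).2 hyX
  · intro y
    exact (mkQ_submoduleOf_eq_zero _).trans (h2 y y.2)

theorem relLength_self_of_le {X Y : Submodule R W} (h : Y ≤ X) : relLength X Y = 0 := by
  rw [relLength, Module.length_eq_zero_iff]
  refine ⟨fun a b => ?_⟩
  obtain ⟨a, rfl⟩ := Submodule.mkQ_surjective _ a
  obtain ⟨b, rfl⟩ := Submodule.mkQ_surjective _ b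
  rw [(mkQ_submoduleOf_eq_zero _).2 (h a.2), (mkQ_submoduleOf_eq_zero _).2 (h b.2)]

theorem relLength_add {X Y Z : Submodule R W} (hXY : X ≤ Y) (hYZ : Y ≤ Z) :
    relLength X Z = relLength X Y + relLength Y Z := by
  let f : (Y ⧸ X.submoduleOf Y) →ₗ[R] (Z ⧸ X.submoduleOf Z) :=
    (X.submoduleOf Y).liftQ ((X.submoduleOf Z).mkQ.comp (Submodule.inclusion hYZ))
      (fun y hy => (mkQ_submoduleOf_eq_zero _).2 hy)
  let g : (Z ⧸ X.submoduleOf Z) →ₗ[R] (Z ⧸ Y.submoduleOf Z) :=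
    (X.submoduleOf Z).liftQ (Y.submoduleOf Z).mkQ
      (fun y hy => (mkQ_submoduleOf_eq_zero _).2 (hXY hy))
  have hf : ∀ y, f ((X.submoduleOf Y).mkQ y) = (X.submoduleOf Z).mkQ (Submodule.inclusion hYZ y) :=
    fun _ => rfl
  have hg : ∀ z, g ((X.submoduleOf Z).mkQ z) = (Y.submoduleOf Z).mkQ z := fun _ => rfl
  refine Module.length_eq_add_of_exact f g ?_ ?_ ?_
  · refine (injective_iff_map_eq_zero f).2 fun y hy => ?_
    obtain ⟨y, rfl⟩ := Submodule.mkQ_surjective _ y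
    rw [hf, mkQ_submoduleOf_eq_zero] at hy
    exact (mkQ_submoduleOf_eq_zero _).2 hy
  · intro z
    obtain ⟨z, rfl⟩ := Submodule.mkQ_surjective _ z
    exact ⟨_, hg z⟩
  · intro z
    obtain ⟨z, rfl⟩ := Submodule.mkQ_surjective _ z
    rw [hg, mkQ_submoduleOf_eq_zero]
    constructor
    · intro hz
      exact ⟨(X.submoduleOf Y).mkQ ⟨z, hz⟩, hf _⟩
    · rintro ⟨y, hy⟩
      obtain ⟨y, rfl⟩ := Submodule.mkQ_surjective _ y
      rw [hf, ← sub_eq_zero, ← map_sub, mkQ_submoduleOf_eq_zero] at hy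
      have := Y.sub_mem y.2 (hXY hy)
      simpa using this

end RelLength

end JointBlowup

namespace JointBlowup

/-! ### Multigraded polynomial rings -/

section PolyGrading

open MvPolynomial

/-- The test for primality on homogeneous elements needs a linear order compatible with addition on
the degrees; the lexicographic order, pulled back along `e`, is one. The embedding `e` allows both
`ℤ`- and `ℕ`-valued multidegrees. -/
theorem isPrime_of_homogeneous {n : Type*} [Finite n] {ι : Type*} [AddCommMonoid ι] [DecidableEq ι]
    (e : ι → (n → ℤ)) (he : Function.Injective e) (hadd : ∀ a b, e (a + b) = e a + e b)
    {A K : Type*} [CommRing A] [SetLike K A] [AddSubmonoidClass K A] (𝒮 : ι → K) [GradedRing 𝒮]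
    {I : Ideal A} (hI : I.IsHomogeneous 𝒮) (hne : I ≠ ⊤)
    (h : ∀ x y : A, SetLike.IsHomogeneousElem 𝒮 x → SetLike.IsHomogeneousElem 𝒮 y →
      x * y ∈ I → x ∈ I ∨ y ∈ I) : I.IsPrime := by
  obtain ⟨k, ⟨f⟩⟩ := Finite.exists_equiv_fin n
  let F : ι → Lex (Fin k → ℤ) := fun v => toLex fun i => e v (f.symm i)
  have hF : Function.Injective F := by
    intro v w hvw
    apply he
    funext i
    have := congrFun (toLex.injective hvw) (f i)
    simpa using this
  have hFadd : ∀ v w, F (v + w) = F v + F w := by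
    intro v w
    simp only [F, hadd]
    rfl
  let L : LinearOrder ι := LinearOrder.lift' F hF
  obtain rfl : ‹DecidableEq ι› = L.toDecidableEq := Subsingleton.elim _ _
  have hle : ∀ v w : ι, v ≤ w ↔ F v ≤ F w := fun v w => Iff.rfl
  have : IsOrderedCancelAddMonoid ι :=
    { add_le_add_left := fun a b hab c => by
        rw [hle] at hab ⊢
        rw [hFadd, hFadd]
        exact add_le_add_left hab _
      le_of_add_le_add_left := fun a b c habc => by
        rw [hle] at habc ⊢
        rw [hFadd, hFadd] at habc
        exact le_of_add_le_add_left habc }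
  exact hI.isPrime_of_homogeneous_mem_or_mem hne (fun {x y} hx hy hxy => h x y hx hy hxy)

theorem isPrime_homogeneousCore {n : Type*} [Finite n] {ι : Type*} [AddCommMonoid ι] [DecidableEq ι]
    (e : ι → (n → ℤ)) (he : Function.Injective e) (hadd : ∀ a b, e (a + b) = e a + e b)
    {A K : Type*} [CommRing A] [SetLike K A] [AddSubmonoidClass K A] (𝒮 : ι → K) [GradedRing 𝒮]
    {I : Ideal A} (hI : I.IsPrime) : (I.homogeneousCore 𝒮).toIdeal.IsPrime := by
  refine isPrime_of_homogeneous e he hadd 𝒮 (I.homogeneousCore 𝒮).isHomogeneous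
    (ne_top_of_le_ne_top hI.ne_top (Ideal.toIdeal_homogeneousCore_le 𝒮 I)) fun x y hx hy hxy => ?_
  rcases hI.mem_or_mem (Ideal.toIdeal_homogeneousCore_le 𝒮 I hxy) with h | h
  · exact Or.inl (Ideal.mem_homogeneousCore_of_homogeneous_of_mem hx h)
  · exact Or.inr (Ideal.mem_homogeneousCore_of_homogeneous_of_mem hy h)

variable {τ σ R : Type*} [DecidableEq τ] [CommRing R] (dir : σ → τ)

/-- The homogeneous polynomials of multidegree `d`, where the variable `X_s` has as degree the unit
vector in direction `dir s`. -/
def polyPiece (d : τ → ℤ) : Submodule R (MvPolynomial σ R) :=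
  weightedHomogeneousSubmodule R (fun s => (Pi.single (dir s) 1 : τ → ℤ)) d

variable [Fintype τ]

noncomputable instance : GradedAlgebra (polyPiece (R := R) dir) :=
  weightedGradedAlgebra R (fun s => (Pi.single (dir s) 1 : τ → ℤ))

omit [Fintype τ] in
theorem X_mem_polyPiece (s : σ) : (X s : MvPolynomial σ R) ∈ polyPiece dir (Pi.single (dir s) 1) :=
  isWeightedHomogeneous_X R _ s

omit [Fintype τ] in
theorem polyPiece_weight_apply {d : τ → ℤ} {f : MvPolynomial σ R} (hf : f ∈ polyPiece dir d)
    {m : σ →₀ ℕ} (hm : coeff m f ≠ 0) (j : τ) :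
    d j = ∑ s ∈ m.support, (m s : ℤ) * (if dir s = j then 1 else 0) := by
  have h : Finsupp.weight (fun s => (Pi.single (dir s) 1 : τ → ℤ)) m = d := hf hm
  rw [← h, Finsupp.weight_apply, Finsupp.sum, Finset.sum_apply]
  refine Finset.sum_congr rfl fun s _ => ?_
  simp [Pi.single_apply, eq_comm]

omit [Fintype τ] in
-- Each monomial of `f` involves a variable of direction `j`.
theorem mem_of_mem_polyPiece {d : τ → ℤ} {f : MvPolynomial σ R} (hf : f ∈ polyPiece dir d)
    {j : τ} (hd : d j ≠ 0) {P : Ideal (MvPolynomial σ R)} (hP : ∀ s, dir s = j → X s ∈ P) :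
    f ∈ P := by
  rw [f.as_sum]
  refine P.sum_mem fun m hm => ?_
  rw [mem_support_iff] at hm
  have h := polyPiece_weight_apply dir hf hm j
  obtain ⟨s, hs, hs2⟩ := Finset.exists_ne_zero_of_sum_ne_zero (h ▸ hd)
  have hsj : dir s = j := by
    by_contra hc
    simp [hc] at hs2
  have hms : m s ≠ 0 := by simpa using hs
  have : m = (m - Finsupp.single s 1) + Finsupp.single s 1 := by
    rw [tsub_add_cancel_of_le]
    simpa using Nat.one_le_iff_ne_zero.2 hms
  have e : monomial m (coeff m f) = monomial (m - Finsupp.single s 1) (coeff m f) * X s := by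
    rw [X, monomial_mul, mul_one, ← this]
  rw [e]
  exact P.mul_mem_left _ (hP s hsj)

omit [Fintype τ] in
theorem polyPiece_eq_zero {d : τ → ℤ} {f : MvPolynomial σ R} (hf : f ∈ polyPiece dir d)
    {j : τ} (hd : d j < 0) : f = 0 := by
  by_contra h
  obtain ⟨m, hm⟩ := MvPolynomial.ne_zero_iff.1 h
  have h := polyPiece_weight_apply dir hf hm j
  have : 0 ≤ d j := by
    rw [h]
    refine Finset.sum_nonneg fun s _ => ?_
    split_ifs <;> simp
  omega

instance polyPiece_finite [Finite σ] (d : τ → ℤ) : Module.Finite R (polyPiece (R := R) dir d) := by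
  have hfin : {m : σ →₀ ℕ | Finsupp.weight (fun s => (Pi.single (dir s) 1 : τ → ℤ)) m = d}.Finite := by
    classical
    have : Fintype σ := Fintype.ofFinite σ
    refine (Set.finite_Iic (Finsupp.equivFunOnFinite.symm fun s => (d (dir s)).toNat)).subset ?_
    intro m hm s
    replace hm : Finsupp.weight (fun s => (Pi.single (dir s) 1 : τ → ℤ)) m = d := hm
    change m s ≤ (d (dir s)).toNat
    rw [← hm, Finsupp.weight_eq_sum, Finset.sum_apply]
    have h1 : (m s : ℤ) ≤ ∑ c, (m c • (Pi.single (dir c) 1 : τ → ℤ)) (dir s) := by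
      have h2 : (m s : ℤ) = (m s • (Pi.single (dir s) 1 : τ → ℤ)) (dir s) := by simp
      rw [h2]
      refine Finset.single_le_sum (f := fun c => (m c • (Pi.single (dir c) 1 : τ → ℤ)) (dir s))
        (fun c _ => ?_) (Finset.mem_univ s)
      simp only [Pi.smul_apply, Pi.single_apply]
      split_ifs <;> simp
    omega
  have := hfin.to_subtype
  unfold polyPiece
  rw [weightedHomogeneousSubmodule_eq_finsupp_supported]
  exact Module.Finite.of_basis (basisRestrictSupport R _)

theorem isPrime_of_homogeneous_polyPiece {I : Ideal (MvPolynomial σ R)}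
    (hI : I.IsHomogeneous (polyPiece dir)) (hne : I ≠ ⊤)
    (h : ∀ x y : MvPolynomial σ R, SetLike.IsHomogeneousElem (polyPiece (R := R) dir) x →
      SetLike.IsHomogeneousElem (polyPiece (R := R) dir) y →
      x * y ∈ I → x ∈ I ∨ y ∈ I) : I.IsPrime :=
  isPrime_of_homogeneous id Function.injective_id (fun _ _ => rfl) _ hI hne h

/-- A relevant prime is a homogeneous prime which in each direction avoids some variable. -/
structure IsRelevant (P : Ideal (MvPolynomial σ R)) : Prop where
  isPrime : P.IsPrime
  isHomogeneous : P.IsHomogeneous (polyPiece dir)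
  exists_notMem : ∀ j, ∃ s, dir s = j ∧ X s ∉ P

/-- Every strictly increasing chain of relevant primes containing `J` has at most `r` members. -/
def RelevantBound : ℕ → Ideal (MvPolynomial σ R) → Prop
  | 0, J => ∀ P, IsRelevant dir P → ¬ J ≤ P
  | r + 1, J => ∀ P, IsRelevant dir P → J ≤ P → ∀ J', P < J' → RelevantBound r J'

variable {dir}

theorem RelevantBound.of_le {r : ℕ} {J J' : Ideal (MvPolynomial σ R)} (h : RelevantBound dir r J)
    (hJ : J ≤ J') : RelevantBound dir r J' := by
  cases r with
  | zero => exact fun P hP hJP => h P hP (hJ.trans hJP)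
  | succ r => exact fun P hP hJP => h P hP (hJ.trans hJP)

end PolyGrading

end JointBlowup

namespace JointBlowup

/-! ### Hilbert functions of graded subquotients -/

section HilbertFunction

open MvPolynomial DirectSum

variable {τ σ R W : Type*} [DecidableEq τ] [CommRing R] {dir : σ → τ}
  [AddCommGroup W] [Module R W] [Module (MvPolynomial σ R) W]
  [IsScalarTower R (MvPolynomial σ R) W] {ℳ : (τ → ℤ) → Submodule R W}

/-- The Hilbert function of the subquotient `A / A'`. -/
noncomputable def hilb (ℳ : (τ → ℤ) → Submodule R W) (A' A : Submodule (MvPolynomial σ R) W)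
    (d : τ → ℤ) : ℕ∞ :=
  relLength (A'.restrictScalars R ⊓ ℳ d) (A.restrictScalars R ⊓ ℳ d)

omit [DecidableEq τ] in
theorem hilb_add {A' A₁ A : Submodule (MvPolynomial σ R) W} (h1 : A' ≤ A₁) (h2 : A₁ ≤ A)
    (d : τ → ℤ) : hilb ℳ A' A d = hilb ℳ A' A₁ d + hilb ℳ A₁ A d :=
  relLength_add (inf_le_inf_right _ h1) (inf_le_inf_right _ h2)

omit [DecidableEq τ] in
theorem hilb_self (A : Submodule (MvPolynomial σ R) W) (d : τ → ℤ) : hilb ℳ A A d = 0 :=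
  relLength_self_of_le le_rfl

/-- The ideal of all `f` with `f • w ∈ A`. -/
noncomputable def colonIdeal (A : Submodule (MvPolynomial σ R) W) (w : W) :
    Ideal (MvPolynomial σ R) :=
  A.comap (LinearMap.toSpanSingleton _ W w)

omit [Module R W] [IsScalarTower R (MvPolynomial σ R) W] in
theorem mem_colonIdeal {A : Submodule (MvPolynomial σ R) W} {w : W} {f : MvPolynomial σ R} :
    f ∈ colonIdeal A w ↔ f • w ∈ A := Iff.rfl

/-- `W` is a graded module over the multigraded polynomial ring. -/
def IsGradedAction (dir : σ → τ) (ℳ : (τ → ℤ) → Submodule R W) : Prop :=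
  ∀ s d, ∀ x ∈ ℳ d, (X s : MvPolynomial σ R) • x ∈ ℳ (Pi.single (dir s) 1 + d)

theorem IsGradedAction.smul_mem (hℳ : IsGradedAction dir ℳ) {d e : τ → ℤ} {f : MvPolynomial σ R}
    (hf : f ∈ polyPiece dir e) {x : W} (hx : x ∈ ℳ d) : f • x ∈ ℳ (e + d) := by
  have key : ∀ m : σ →₀ ℕ, ∀ (a : R) (d : τ → ℤ) (x : W), x ∈ ℳ d → monomial m a • x ∈
      ℳ (Finsupp.weight (fun s => (Pi.single (dir s) 1 : τ → ℤ)) m + d) := by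
    have hC : ∀ (a : R) (d : τ → ℤ) (x : W), x ∈ ℳ d → (C a : MvPolynomial σ R) • x ∈ ℳ d := by
      intro a d x hx
      rw [← MvPolynomial.algebraMap_eq, algebraMap_smul]
      exact (ℳ d).smul_mem a hx
    intro m
    induction m using Finsupp.induction_linear with
    | zero => simpa [← C_apply] using hC
    | add m₁ m₂ h1 h2 =>
      intro a d x hx
      have := h1 a _ _ (h2 1 d x hx)
      rw [smul_smul, monomial_mul, mul_one, ← add_assoc, ← map_add] at this
      exact this
    | single s n =>
      induction n with
      | zero => simpa [← C_apply] using hC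
      | succ n ih =>
        intro a d x hx
        have := hℳ s _ _ (ih a d x hx)
        rw [smul_smul, X, monomial_mul, one_mul, ← Finsupp.single_add, ← add_assoc,
          Finsupp.weight_single, add_comm 1 n] at this
        rw [Finsupp.weight_single, succ_nsmul' (n := n)]
        exact this
  rw [f.as_sum, Finset.sum_smul]
  refine (ℳ _).sum_mem fun m hm => ?_
  have h : Finsupp.weight (fun s => (Pi.single (dir s) 1 : τ → ℤ)) m = e :=
    hf (mem_support_iff.1 hm)
  rw [← h]
  exact key m _ d x hx

variable [Fintype τ] [Decomposition ℳ]

theorem decompose_smul_of_mem (hℳ : IsGradedAction dir ℳ) {e : τ → ℤ} (f : MvPolynomial σ R) {w : W}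
    (hw : w ∈ ℳ e) (d : τ → ℤ) : (decompose ℳ (f • w) d : W) =
      (decompose (polyPiece (R := R) dir) f (d - e) : MvPolynomial σ R) • w := by
  classical
  conv_lhs => rw [← sum_support_decompose (polyPiece (R := R) dir) f, Finset.sum_smul,
    decompose_sum, DFinsupp.finsetSum_apply, AddSubmonoidClass.coe_finsetSum]
  rw [Finset.sum_eq_single (d - e)]
  · exact decompose_of_mem_same ℳ (by
      simpa using hℳ.smul_mem (decompose (polyPiece (R := R) dir) f (d - e)).2 hw)
  · intro b _ hb
    exact decompose_of_mem_ne ℳ (hℳ.smul_mem (decompose (polyPiece (R := R) dir) f b).2 hw)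
      (fun h => hb (by rw [← h]; simp))
  · intro hd
    have : decompose (polyPiece (R := R) dir) f (d - e) = 0 := by simpa using hd
    rw [this]
    simp

theorem colonIdeal_isHomogeneous (hℳ : IsGradedAction dir ℳ) {A : Submodule (MvPolynomial σ R) W}
    (hA : A.IsHomogeneous ℳ) {e : τ → ℤ} {w : W} (hw : w ∈ ℳ e) :
    (colonIdeal A w).IsHomogeneous (polyPiece (R := R) dir) := by
  intro d f hf
  have := hA (d + e) hf
  have h2 := decompose_smul_of_mem hℳ f hw (d + e)
  rw [add_sub_cancel_right] at h2
  rw [LinearMap.toSpanSingleton_apply, h2] at this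
  exact this

theorem span_sup_isHomogeneous (hℳ : IsGradedAction dir ℳ) {A : Submodule (MvPolynomial σ R) W}
    (hA : A.IsHomogeneous ℳ) {e : τ → ℤ} {w : W} (hw : w ∈ ℳ e) :
    (A ⊔ Submodule.span (MvPolynomial σ R) {w}).IsHomogeneous ℳ := by
  intro d x hx
  obtain ⟨a, ha, y, hy, rfl⟩ := Submodule.mem_sup.1 hx
  obtain ⟨f, rfl⟩ := Submodule.mem_span_singleton.1 hy
  rw [decompose_add, DFinsupp.add_apply, Submodule.coe_add, decompose_smul_of_mem hℳ f hw]
  exact Submodule.add_mem_sup (hA d ha)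
    (Submodule.smul_mem _ _ (Submodule.mem_span_singleton_self w))

theorem isGradedAction_polyPiece : IsGradedAction dir (polyPiece (R := R) dir) :=
  fun s _ _ hx => SetLike.GradedMul.mul_mem (X_mem_polyPiece dir s) hx

/-- A cyclic subquotient is a shifted quotient of the polynomial ring. -/
theorem hilb_sup_span (hℳ : IsGradedAction dir ℳ) {A : Submodule (MvPolynomial σ R) W}
    (hA : A.IsHomogeneous ℳ) {e : τ → ℤ} {w : W} (hw : w ∈ ℳ e) (d : τ → ℤ) :
    hilb ℳ A (A ⊔ Submodule.span (MvPolynomial σ R) {w}) d =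
      hilb (polyPiece (R := R) dir) (colonIdeal A w) ⊤ (d - e) := by
  refine (relLength_eq_of_map
    ((LinearMap.toSpanSingleton (MvPolynomial σ R) W w).restrictScalars R) ?_ ?_ ?_).symm
  · rintro f ⟨-, hf⟩
    refine ⟨Submodule.mem_sup_right (Submodule.mem_span_singleton.2 ⟨f, rfl⟩), ?_⟩
    simpa using hℳ.smul_mem hf hw
  · rintro f ⟨-, hf⟩
    constructor
    · exact fun h => ⟨h.1, hf⟩
    · exact fun h => ⟨h.1, by simpa using hℳ.smul_mem hf hw⟩
  · rintro y ⟨hy, hyd⟩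
    obtain ⟨a, ha, z, hz, rfl⟩ := Submodule.mem_sup.1 hy
    obtain ⟨f, rfl⟩ := Submodule.mem_span_singleton.1 hz
    have hdec : (decompose ℳ (a + f • w) d : W) = a + f • w := decompose_of_mem_same ℳ hyd
    rw [decompose_add, DFinsupp.add_apply, Submodule.coe_add,
      decompose_smul_of_mem hℳ f hw] at hdec
    refine ⟨(decompose (polyPiece (R := R) dir) f (d - e) : MvPolynomial σ R),
      ⟨trivial, SetLike.coe_mem _⟩, ?_, ?_⟩
    · rw [← hdec]
      simpa using A.neg_mem (hA d ha)
    · refine (ℳ d).sub_mem ?_ hyd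
      simpa using hℳ.smul_mem (decompose (polyPiece (R := R) dir) f (d - e)).2 hw

/-- Existence of a homogeneous associated prime of `A / A'`: a maximal member among the colon ideals
of homogeneous elements of `A` outside `A'` is prime. -/
theorem exists_colonIdeal_isPrime [IsNoetherianRing R] [Finite σ] (hℳ : IsGradedAction dir ℳ)
    {A' A : Submodule (MvPolynomial σ R) W} (hA' : A'.IsHomogeneous ℳ) (hA : A.IsHomogeneous ℳ)
    (hlt : A' < A) : ∃ e, ∃ w ∈ ℳ e, w ∈ A ∧ w ∉ A' ∧ (colonIdeal A' w).IsPrime := by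
  let colons : Set (Ideal (MvPolynomial σ R)) :=
    {P | ∃ e, ∃ w ∈ ℳ e, w ∈ A ∧ w ∉ A' ∧ P = colonIdeal A' w}
  have hne : colons.Nonempty := by
    obtain ⟨-, a, ha, ha'⟩ := SetLike.lt_iff_le_and_exists.1 hlt
    have : ∃ d, (decompose ℳ a d : W) ∉ A' := by
      by_contra hc
      push Not at hc
      exact ha' ((Submodule.IsHomogeneous.mem_iff ℳ hA').2 hc)
    obtain ⟨d, hd⟩ := this
    exact ⟨_, d, _, SetLike.coe_mem _, hA d ha, hd, rfl⟩
  obtain ⟨P, ⟨e, w, hwe, hwA, hwA', rfl⟩, hmax⟩ := set_has_maximal_iff_noetherian.2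
    (inferInstance : IsNoetherian (MvPolynomial σ R) (MvPolynomial σ R)) colons hne
  refine ⟨e, w, hwe, hwA, hwA', isPrime_of_homogeneous_polyPiece dir
    (colonIdeal_isHomogeneous hℳ hA' hwe) ?_ ?_⟩
  · rw [Ne, Ideal.eq_top_iff_one, mem_colonIdeal, one_smul]
    exact hwA'
  · rintro x y - ⟨c, hyc⟩ hxy
    by_contra hc
    push Not at hc
    refine hmax (colonIdeal A' (y • w)) ⟨c + e, y • w, hℳ.smul_mem hyc hwe, A.smul_mem _ hwA,
      hc.2, rfl⟩ ?_
    refine SetLike.lt_iff_le_and_exists.2 ⟨fun f hf => ?_, x, ?_, hc.1⟩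
    · rw [mem_colonIdeal, smul_comm]
      exact A'.smul_mem _ hf
    · rw [mem_colonIdeal, smul_smul]
      exact hxy

/-- Dévissage: it suffices to know the Hilbert functions of the residue rings by the homogeneous
primes containing the annihilator. -/
theorem evPoly_hilb_of_primes [IsNoetherianRing R] [Finite σ] (hℳ : IsGradedAction dir ℳ) {r : ℕ}
    {A : Submodule (MvPolynomial σ R) W} (hA : A.IsHomogeneous ℳ) (hfg : A.FG)
    (A' : Submodule (MvPolynomial σ R) W) (hA' : A'.IsHomogeneous ℳ) (hle : A' ≤ A)
    (h : ∀ P : Ideal (MvPolynomial σ R), P.IsPrime → P.IsHomogeneous (polyPiece (R := R) dir) →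
      (∀ f : MvPolynomial σ R, (∀ x ∈ A, f • x ∈ A') → f ∈ P) →
      EvPoly r (hilb (polyPiece (R := R) dir) P ⊤)) :
    EvPoly r (hilb ℳ A' A) := by
  have hN : IsNoetherian (MvPolynomial σ R) A := isNoetherian_of_fg_of_noetherian A hfg
  -- Noetherian induction from `A` downwards. Adjoining an element with prime colon ideal splits off
  -- a shifted residue ring.
  have key : ∀ B : Submodule (MvPolynomial σ R) A, A' ≤ B.map A.subtype →
      (B.map A.subtype).IsHomogeneous ℳ → EvPoly r (hilb ℳ (B.map A.subtype) A) := by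
    intro B
    induction B using WellFoundedGT.induction with
    | ind B ih =>
      intro hB hBh
      rcases eq_or_lt_of_le (Submodule.map_subtype_le A B) with heq | hlt
      · refine (evPoly_zero 0 fun d _ => ?_).mono (Nat.zero_le r)
        rw [heq]
        exact hilb_self A d
      · obtain ⟨e, w, hwe, hwA, hwB, hP⟩ := exists_colonIdeal_isPrime hℳ hBh hA hlt
        set A₁ := B.map A.subtype ⊔ Submodule.span (MvPolynomial σ R) {w} with hA₁
        have hA₁le : A₁ ≤ A := sup_le hlt.le (by simpa using hwA)
        have hmap : (A₁.comap A.subtype).map A.subtype = A₁ := by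
          rw [Submodule.map_comap_subtype, inf_eq_right.2 hA₁le]
        have h1 : EvPoly r (hilb ℳ A₁ A) := by
          rw [← hmap]
          apply ih
          · refine lt_of_le_of_ne ?_ ?_
            · intro b hb
              exact Submodule.mem_sup_left (Submodule.mem_map_of_mem hb)
            · intro hc
              apply hwB
              rw [hc, hmap]
              exact Submodule.mem_sup_right (Submodule.mem_span_singleton_self w)
          · rw [hmap]
            exact hB.trans le_sup_left
          · rw [hmap]
            exact span_sup_isHomogeneous hℳ hBh hwe
        have h2 : EvPoly r (hilb (polyPiece (R := R) dir) (colonIdeal (B.map A.subtype) w) ⊤) :=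
          h _ hP (colonIdeal_isHomogeneous hℳ hBh hwe) fun f hf => hB (hf w hwA)
        refine ((h2.shift e).add h1).congr 0 fun d _ => ?_
        rw [← hilb_sup_span hℳ hBh hwe]
        exact hilb_add le_sup_left hA₁le d
  have hmap : (A'.comap A.subtype).map A.subtype = A' := by
    rw [Submodule.map_comap_subtype, inf_eq_right.2 hle]
  have := key (A'.comap A.subtype) hmap.ge (by rw [hmap]; exact hA')
  rwa [hmap] at this

end HilbertFunction

end JointBlowup

namespace JointBlowup

/-! ### Hilbert polynomials over a local base ring -/

section HilbertPolynomials

open MvPolynomial DirectSum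

variable {τ σ R W : Type*} [DecidableEq τ] [Fintype τ] [Finite σ] [CommRing R] [IsLocalRing R]
  [IsNoetherianRing R] {dir : σ → τ}
  [AddCommGroup W] [Module R W] [Module (MvPolynomial σ R) W]
  [IsScalarTower R (MvPolynomial σ R) W] {ℳ : (τ → ℤ) → Submodule R W} [Decomposition ℳ]

omit [IsNoetherianRing R] in
-- Such a module is a quotient of a finite power of the residue field.
theorem length_ne_top_of_smul_eq_zero {V : Type*} [AddCommGroup V] [Module R V] [Module.Finite R V]
    (h : ∀ a ∈ IsLocalRing.maximalIdeal R, ∀ x : V, a • x = 0) : Module.length R V ≠ ⊤ := by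
  obtain ⟨n, v, hv⟩ := Module.Finite.exists_fin (R := R) (M := V)
  let g : Fin n → (R ⧸ IsLocalRing.maximalIdeal R) →ₗ[R] V := fun i =>
    Submodule.liftQ _ (LinearMap.toSpanSingleton R V (v i)) fun a ha => h a ha _
  let f := LinearMap.lsum R (fun _ : Fin n => R ⧸ IsLocalRing.maximalIdeal R) R g
  have hf : Function.Surjective f := by
    rw [← LinearMap.range_eq_top, eq_top_iff, ← hv, Submodule.span_le]
    rintro _ ⟨i, rfl⟩
    refine ⟨Pi.single i (Submodule.Quotient.mk 1), ?_⟩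
    simp only [f, LinearMap.lsum_apply, LinearMap.sum_apply, LinearMap.comp_apply,
      LinearMap.proj_apply]
    rw [Finset.sum_eq_single i]
    · rw [Pi.single_eq_same]
      exact one_smul R (v i)
    · intro j _ hj
      simp [hj]
    · simp
  have h1 := Module.length_le_of_surjective f hf
  have hs : IsSimpleModule R (R ⧸ IsLocalRing.maximalIdeal R) := by
    rw [isSimpleModule_iff_isCoatom]
    exact Ideal.isMaximal_def.1 inferInstance
  intro htop
  rw [htop, Module.length_pi, Module.length_eq_one, ENat.card_eq_coe_natCard] at h1
  exact absurd h1 (by simp)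

omit [Fintype τ] [IsNoetherianRing R] in
theorem hilb_ne_top {P : Ideal (MvPolynomial σ R)}
    (hm : ∀ a ∈ IsLocalRing.maximalIdeal R, C a ∈ P) (d : τ → ℤ) :
    hilb (polyPiece (R := R) dir) P ⊤ d ≠ ⊤ := by
  have hfin : Module.Finite R ↥((⊤ : Ideal (MvPolynomial σ R)).restrictScalars R ⊓
      polyPiece (R := R) dir d) := by
    rw [Submodule.restrictScalars_top, top_inf_eq]
    infer_instance
  refine length_ne_top_of_smul_eq_zero fun a ha x => ?_
  obtain ⟨x, rfl⟩ := Submodule.mkQ_surjective _ x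
  rw [← map_smul, mkQ_submoduleOf_eq_zero]
  refine ⟨?_, Submodule.smul_mem _ a x.2.2⟩
  rw [Submodule.coe_smul, ← algebraMap_smul (MvPolynomial σ R), smul_eq_mul,
    MvPolynomial.algebraMap_eq]
  exact P.mul_mem_right _ (hm a ha)

/-- Noetherian induction on `P`. For relevant `P`, choose in each direction `j` a variable outside
`P`. It is a nonzerodivisor modulo `P`, so the difference of the Hilbert function in direction `j`
is the Hilbert function modulo `P` and this variable. By dévissage that one is governed by strictly
larger primes, with a chain bound smaller by one. If `P` contains all variables of a direction, the
residue ring vanishes once the degree is positive there. -/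
theorem evPoly_hilb_of_isPrime (P : Ideal (MvPolynomial σ R)) : ∀ r : ℕ, P.IsPrime →
    P.IsHomogeneous (polyPiece (R := R) dir) → (∀ a ∈ IsLocalRing.maximalIdeal R, C a ∈ P) →
    RelevantBound dir r P → EvPoly r (hilb (polyPiece (R := R) dir) P ⊤) := by
  induction P using WellFoundedGT.induction with
  | ind P ih =>
    intro r hP hPh hm hr
    by_cases hrel : ∀ j, ∃ s, dir s = j ∧ X s ∉ P
    · have hR : IsRelevant dir P := ⟨hP, hPh, hrel⟩
      cases r with
      | zero => exact absurd le_rfl (hr P hR)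
      | succ r =>
        choose s hs hsP using hrel
        have hXs : ∀ j, (X (s j) : MvPolynomial σ R) ∈
            polyPiece (R := R) dir (Pi.single j 1) := by
          intro j
          have := X_mem_polyPiece (R := R) dir (s j)
          rwa [hs] at this
        let J : τ → Ideal (MvPolynomial σ R) := fun j => P ⊔ Ideal.span {X (s j)}
        have hPJ : ∀ j, P < J j := fun j => by
          refine lt_of_le_of_ne le_sup_left fun h => hsP j ?_
          rw [h]
          exact Ideal.mem_sup_right (Ideal.mem_span_singleton_self _)
        have hJh : ∀ j, (J j).IsHomogeneous (polyPiece (R := R) dir) := fun j =>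
          span_sup_isHomogeneous isGradedAction_polyPiece hPh (hXs j)
        refine EvPoly.of_differences (hilb_ne_top hm) 0
          -- The double negation puts the translation by `+e_j` into the form of `EvPoly.shift`.
          (fun j d => hilb (polyPiece (R := R) dir) (J j) ⊤ (d - (-Pi.single j 1)))
          (fun j => EvPoly.shift ?_ _) ?_
        · refine evPoly_hilb_of_primes isGradedAction_polyPiece (Ideal.IsHomogeneous.top _)
            (IsNoetherian.noetherian ⊤) (J j) (hJh j) le_top fun P' hP' hP'h hJP' => ?_
          have hJP : J j ≤ P' := fun f hf => hJP' f fun x _ => (J j).mul_mem_right x hf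
          refine ih P' ((hPJ j).trans_le hJP) r hP' hP'h
            (fun a ha => (hPJ j).le.trans hJP (hm a ha)) ?_
          exact (hr P hR le_rfl _ (hPJ j)).of_le hJP
        · intro j d _
          rw [sub_neg_eq_add, hilb_add (hPJ j).le le_top (d + Pi.single j 1)]
          congr 1
          have h1 := hilb_sup_span isGradedAction_polyPiece hPh (hXs j) (d + Pi.single j 1)
          have h2 : colonIdeal P (X (s j) : MvPolynomial σ R) = P := by
            ext f
            rw [mem_colonIdeal, smul_eq_mul]
            exact ⟨fun h => (hP.mem_or_mem h).resolve_right (hsP j),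
              fun h => P.mul_mem_right _ h⟩
          rw [h2, add_sub_cancel_right] at h1
          exact h1
    · push Not at hrel
      obtain ⟨j, hj⟩ := hrel
      refine (evPoly_zero 1 fun d hd => ?_).mono (Nat.zero_le r)
      refine relLength_self_of_le fun f hf => ⟨?_, hf.2⟩
      exact mem_of_mem_polyPiece dir hf.2 (j := j) (by linarith [hd j]) hj

/-- The Hilbert function of a finitely generated graded module annihilated by a power of the maximal
ideal of `R` is eventually polynomial, of degree less than the number of members of any chain
of relevant primes containing the annihilator. -/
theorem evPoly_hilb (hℳ : IsGradedAction dir ℳ) {r k : ℕ} {A' A : Submodule (MvPolynomial σ R) W}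
    (hA' : A'.IsHomogeneous ℳ) (hA : A.IsHomogeneous ℳ) (hle : A' ≤ A) (hfg : A.FG)
    (hk : ∀ a ∈ IsLocalRing.maximalIdeal R ^ k, ∀ x ∈ A, a • x ∈ A')
    {J : Ideal (MvPolynomial σ R)} (hr : RelevantBound dir r J)
    (hJ : ∀ P : Ideal (MvPolynomial σ R), P.IsPrime →
      (∀ f : MvPolynomial σ R, (∀ x ∈ A, f • x ∈ A') → f ∈ P) → J ≤ P) :
    EvPoly r (hilb ℳ A' A) := by
  refine evPoly_hilb_of_primes hℳ hA hfg A' hA' hle fun P hP hPh hann => ?_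
  refine evPoly_hilb_of_isPrime P r hP hPh (fun a ha => ?_) (hr.of_le (hJ P hP hann))
  refine hP.mem_of_pow_mem k (hann _ fun x hx => ?_)
  rw [← map_pow, ← MvPolynomial.algebraMap_eq, algebraMap_smul]
  exact hk _ (Ideal.pow_mem_pow ha k) x hx

end HilbertPolynomials

end JointBlowup

namespace JointBlowup

/-! ### Local cohomology of graded subquotients -/

section Torsion

open MvPolynomial DirectSum

variable {τ σ R W : Type*} [DecidableEq τ] [Fintype τ] [Finite σ] [CommRing R] [IsLocalRing R]
  [IsNoetherianRing R] {dir : σ → τ}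
  [AddCommGroup W] [Module R W] [Module (MvPolynomial σ R) W]
  [IsScalarTower R (MvPolynomial σ R) W] {ℳ : (τ → ℤ) → Submodule R W} [Decomposition ℳ]

theorem smul_smul_polynomial_comm (a : R) (f : MvPolynomial σ R) (x : W) :
    a • f • x = f • a • x := by
  rw [← algebraMap_smul (MvPolynomial σ R) a, ← algebraMap_smul (MvPolynomial σ R) a, smul_comm]

/-- The elements of `A` whose classes modulo `A'` are annihilated by a power of the maximal
ideal of `R`. -/
def torsionIn (A' A : Submodule (MvPolynomial σ R) W) : Submodule (MvPolynomial σ R) W where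
  carrier := {x | x ∈ A ∧ ∃ k : ℕ, ∀ a ∈ IsLocalRing.maximalIdeal R ^ k, a • x ∈ A'}
  zero_mem' := ⟨A.zero_mem, 0, fun a _ => by rw [smul_zero]; exact A'.zero_mem⟩
  add_mem' := by
    rintro x y ⟨hx, k, hk⟩ ⟨hy, l, hl⟩
    refine ⟨A.add_mem hx hy, k + l, fun a ha => ?_⟩
    rw [smul_add]
    exact A'.add_mem (hk a (Ideal.pow_le_pow_right (Nat.le_add_right k l) ha))
      (hl a (Ideal.pow_le_pow_right (Nat.le_add_left l k) ha))
  smul_mem' := by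
    rintro f x ⟨hx, k, hk⟩
    refine ⟨A.smul_mem f hx, k, fun a ha => ?_⟩
    rw [smul_smul_polynomial_comm]
    exact A'.smul_mem f (hk a ha)

theorem torsionIn_le (A' A : Submodule (MvPolynomial σ R) W) : torsionIn A' A ≤ A :=
  fun _ hx => hx.1

theorem smul_mem_of_mem_submodule (A : Submodule (MvPolynomial σ R) W) (a : R) {x : W}
    (hx : x ∈ A) : a • x ∈ A := by
  rw [← algebraMap_smul (MvPolynomial σ R) a]
  exact A.smul_mem _ hx

theorem le_torsionIn {A' A : Submodule (MvPolynomial σ R) W} (h : A' ≤ A) : A' ≤ torsionIn A' A :=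
  fun _ hx => ⟨h hx, 0, fun a _ => smul_mem_of_mem_submodule A' a hx⟩

theorem torsionIn_isHomogeneous {A' A : Submodule (MvPolynomial σ R) W}
    (hA' : A'.IsHomogeneous ℳ) (hA : A.IsHomogeneous ℳ) : (torsionIn A' A).IsHomogeneous ℳ := by
  rintro d x ⟨hx, k, hk⟩
  refine ⟨hA d hx, k, fun a ha => ?_⟩
  have := hA' d (hk a ha)
  rw [decompose_smul] at this
  exact this

theorem fg_of_le {A B : Submodule (MvPolynomial σ R) W} (hA : A.FG) (h : B ≤ A) : B.FG := by
  have := isNoetherian_of_fg_of_noetherian A hA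
  have h2 := (IsNoetherian.noetherian (B.comap A.subtype)).map A.subtype
  rwa [Submodule.map_comap_subtype, inf_eq_right.2 h] at h2

theorem exists_pow_smul_torsionIn {A' A : Submodule (MvPolynomial σ R) W} (hA : A.FG) :
    ∃ k : ℕ, ∀ a ∈ IsLocalRing.maximalIdeal R ^ k, ∀ x ∈ torsionIn A' A, a • x ∈ A' := by
  obtain ⟨s, hs⟩ := fg_of_le hA (torsionIn_le A' A)
  have h1 : ∀ x ∈ s, ∃ k : ℕ, ∀ a ∈ IsLocalRing.maximalIdeal R ^ k, a • x ∈ A' := fun x hx => by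
    have : x ∈ torsionIn A' A := hs ▸ Submodule.subset_span hx
    exact this.2
  choose! k hk using h1
  refine ⟨s.sup k, fun a ha x hx => ?_⟩
  rw [← hs] at hx
  induction hx using Submodule.span_induction with
  | mem x hx => exact hk x hx a (Ideal.pow_le_pow_right (Finset.le_sup hx) ha)
  | zero => rw [smul_zero]; exact A'.zero_mem
  | add x y _ _ hx hy => rw [smul_add]; exact A'.add_mem hx hy
  | smul f x _ hx => rw [smul_smul_polynomial_comm]; exact A'.smul_mem f hx

/-- The length of the graded pieces of the submodule of elements of `A / A'` that are annihilated
by a power of the maximal ideal. -/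
noncomputable def torsionHilb (ℳ : (τ → ℤ) → Submodule R W) (A' A : Submodule (MvPolynomial σ R) W)
    (d : τ → ℤ) : ℕ∞ :=
  hilb ℳ A' (torsionIn A' A) d

theorem evPoly_torsionHilb (hℳ : IsGradedAction dir ℳ) {r : ℕ}
    {A' A : Submodule (MvPolynomial σ R) W}
    (hA' : A'.IsHomogeneous ℳ) (hA : A.IsHomogeneous ℳ) (hle : A' ≤ A) (hfg : A.FG)
    {J : Ideal (MvPolynomial σ R)} (hr : RelevantBound dir r J) (hJ : ∀ f ∈ J, ∀ x ∈ A, f • x ∈ A') :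
    EvPoly r (torsionHilb ℳ A' A) := by
  obtain ⟨k, hk⟩ := exists_pow_smul_torsionIn (A' := A') hfg
  exact evPoly_hilb hℳ hA' (torsionIn_isHomogeneous hA' hA) (le_torsionIn hle)
    (fg_of_le hfg (torsionIn_le A' A)) hk hr fun P _ h f hf => h f fun x hx => hJ f hf x hx.1

theorem hilb_inf_sup {A B : Submodule (MvPolynomial σ R) W} (hA : A.IsHomogeneous ℳ)
    (hB : B.IsHomogeneous ℳ) (d : τ → ℤ) : hilb ℳ (A ⊓ B) B d = hilb ℳ A (A ⊔ B) d := by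
  refine relLength_eq_of_map LinearMap.id ?_ ?_ ?_
  · rintro y ⟨hy, hyd⟩
    exact ⟨Submodule.mem_sup_right hy, hyd⟩
  · rintro y ⟨hy, hyd⟩
    exact ⟨fun h => ⟨⟨h.1, hy⟩, hyd⟩, fun h => ⟨h.1.1, hyd⟩⟩
  · rintro y ⟨hy, hyd⟩
    obtain ⟨a, ha, b, hb, rfl⟩ := Submodule.mem_sup.1 hy
    have hdec : (decompose ℳ (a + b) d : W) = a + b := decompose_of_mem_same ℳ hyd
    rw [decompose_add, DFinsupp.add_apply, Submodule.coe_add] at hdec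
    refine ⟨decompose ℳ b d, ⟨hB d hb, SetLike.coe_mem _⟩, ?_, ?_⟩
    · rw [← hdec]
      simpa using A.neg_mem (hA d ha)
    · exact (ℳ d).sub_mem (SetLike.coe_mem _) hyd

/-- A chain over `J'` can be prolonged at its lower end by one more relevant prime over `J`. -/
theorem RelevantBound.of_not_minimal {r : ℕ} {J J' : Ideal (MvPolynomial σ R)}
    (h : RelevantBound dir (r + 1) J) (hJ' : ∀ P, IsRelevant dir P → J' ≤ P →
      ∃ P', IsRelevant dir P' ∧ J ≤ P' ∧ P' < P) : RelevantBound dir r J' := by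
  cases r with
  | zero =>
    intro P hP hle
    obtain ⟨P', hP', hJP', hlt⟩ := hJ' P hP hle
    exact h P' hP' hJP' P hlt P hP le_rfl
  | succ r =>
    intro P hP hle K hK
    obtain ⟨P', hP', hJP', hlt⟩ := hJ' P hP hle
    exact h P' hP' hJP' P hlt P hP le_rfl K hK

/-- Near the minimal prime `P` the radical of `J` is `P`. An element of all the other minimal
primes, outside `P`, multiplies `I` into the radical, and a power of the radical lies in `J`. -/
theorem exists_mul_pow_le_of_mem_minimalPrimes {S : Type*} [CommRing S] [IsNoetherianRing S]
    {J I P : Ideal S} (hP : P ∈ J.minimalPrimes) (hI : I ≤ P) :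
    ∃ b ∉ P, ∃ n : ℕ, ∀ x ∈ I ^ n, b * x ∈ J := by
  classical
  have hPp := hP.1.1
  set F := J.finite_minimalPrimes_of_isNoetherianRing.toFinset.erase P with hF
  have hmem : ∀ Q ∈ F, Q ≠ P ∧ Q ∈ J.minimalPrimes := fun Q hQ => by
    simpa [hF] using hQ
  obtain ⟨b, hbF, hbP⟩ : ∃ b ∈ F.inf id, b ∉ P := by
    by_contra hc
    push Not at hc
    obtain ⟨Q, hQ, hQP⟩ := (Ideal.IsPrime.inf_le' hPp).1 hc
    obtain ⟨hne, hQm⟩ := hmem Q hQ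
    exact hne (le_antisymm hQP (hP.2 hQm.1 hQP))
  have hrad : ∀ x ∈ I, b * x ∈ J.radical := by
    intro x hx
    rw [← Ideal.sInf_minimalPrimes, Submodule.mem_sInf]
    intro Q hQ
    by_cases hQP : Q = P
    · exact Ideal.mul_mem_left (Q : Ideal S) _ (hQP ▸ hI hx)
    · refine Ideal.mul_mem_right _ (Q : Ideal S) ?_
      have : F.inf id ≤ Q := Finset.inf_le (f := id) (by simpa [hF] using ⟨hQP, hQ⟩)
      exact this hbF
  obtain ⟨n, hn⟩ := J.exists_radical_pow_le_of_fg (IsNoetherian.noetherian _)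
  refine ⟨b ^ n, fun h => hbP (hPp.mem_of_pow_mem n h), n, fun x hx => hn ?_⟩
  have h1 : Ideal.span {b} * I ≤ J.radical := by
    rw [Ideal.mul_le]
    intro c hc x hx
    obtain ⟨e, rfl⟩ := Ideal.mem_span_singleton'.1 hc
    rw [mul_assoc]
    exact Ideal.mul_mem_left _ _ (hrad x hx)
  have h2 := Ideal.pow_right_mono h1 n
  rw [mul_pow] at h2
  exact h2 (Ideal.mul_mem_mul (Ideal.pow_mem_pow (Ideal.mem_span_singleton_self b) n) hx)

/-- The homogeneous core of a minimal prime of `J` below `P` still contains the homogeneous ideal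
`J`, and it avoids every variable that `P` avoids. -/
theorem exists_isRelevant_lt {J P : Ideal (MvPolynomial σ R)}
    (hJ : J.IsHomogeneous (polyPiece (R := R) dir)) (hP : IsRelevant dir P) (hJP : J ≤ P)
    (hmin : P ∉ J.minimalPrimes) : ∃ P', IsRelevant dir P' ∧ J ≤ P' ∧ P' < P := by
  classical
  have hPp := hP.isPrime
  obtain ⟨Q, hQ, hQP⟩ := Ideal.exists_minimalPrimes_le hJP
  have hlt : Q < P := lt_of_le_of_ne hQP fun h => hmin (h ▸ hQ)
  have hcore : (Q.homogeneousCore (polyPiece (R := R) dir)).toIdeal ≤ Q :=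
    Ideal.toIdeal_homogeneousCore_le _ Q
  refine ⟨(Q.homogeneousCore (polyPiece (R := R) dir)).toIdeal, ⟨?_, ?_, ?_⟩, ?_,
    hcore.trans_lt hlt⟩
  · exact isPrime_homogeneousCore id Function.injective_id (fun _ _ => rfl) _ hQ.1.1
  · exact (Q.homogeneousCore _).isHomogeneous
  · intro j
    obtain ⟨s, hs, hs2⟩ := hP.exists_notMem j
    exact ⟨s, hs, fun h => hs2 (hQP (hcore h))⟩
  · intro f hf
    rw [← sum_support_decompose (polyPiece (R := R) dir) f]
    refine Ideal.sum_mem _ fun d _ => ?_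
    exact Ideal.mem_homogeneousCore_of_homogeneous_of_mem ⟨d, SetLike.coe_mem _⟩
      (hQ.1.2 (hJ d hf))

/-- The function `torsionHilb` is additive in short exact sequences, up to terms of degree smaller
than the dimension. -/
theorem torsionHilb_add (hℳ : IsGradedAction dir ℳ) {r : ℕ}
    {A' A₁ A : Submodule (MvPolynomial σ R) W}
    (hA' : A'.IsHomogeneous ℳ) (hA₁ : A₁.IsHomogeneous ℳ) (hA : A.IsHomogeneous ℳ)
    (hle' : A' ≤ A₁) (hle : A₁ ≤ A) (hfg : A.FG) {J : Ideal (MvPolynomial σ R)}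
    (hJh : J.IsHomogeneous (polyPiece (R := R) dir))
    (hr : RelevantBound dir (r + 1) J) (hJ : ∀ f ∈ J, ∀ x ∈ A, f • x ∈ A') :
    ∃ c : (τ → ℤ) → ℕ∞, EvPoly r c ∧ ∀ d,
      torsionHilb ℳ A' A₁ d + torsionHilb ℳ A₁ A d = torsionHilb ℳ A' A d + c d := by
  set T := torsionIn A' A with hT
  have hTh : T.IsHomogeneous ℳ := torsionIn_isHomogeneous hA' hA
  have hT₁ : A₁ ⊓ T = torsionIn A' A₁ := by
    ext x
    exact ⟨fun h => ⟨h.1, h.2.2⟩, fun h => ⟨h.1, hle h.1, h.2⟩⟩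
  have hsup : A₁ ⊔ T ≤ torsionIn A₁ A := sup_le (le_torsionIn hle) fun x hx =>
    ⟨hx.1, hx.2.imp fun k hk a ha => hle' (hk a ha)⟩
  have hsuph : (A₁ ⊔ T).IsHomogeneous ℳ := by
    intro d x hx
    obtain ⟨a, ha, b, hb, rfl⟩ := Submodule.mem_sup.1 hx
    rw [decompose_add, DFinsupp.add_apply, Submodule.coe_add]
    exact Submodule.add_mem_sup (hA₁ d ha) (hTh d hb)
  -- Torsion is left exact; the error term is the cokernel of the map from the torsion of `A / A'`
  -- to that of `A / A₁`. The ideal `Q` below is its annihilator.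
  refine ⟨hilb ℳ (A₁ ⊔ T) (torsionIn A₁ A), ?_, fun d => ?_⟩
  · obtain ⟨k, hk⟩ := exists_pow_smul_torsionIn (A' := A₁) hfg
    let Q : Ideal (MvPolynomial σ R) :=
      { carrier := {f | ∀ x ∈ torsionIn A₁ A, f • x ∈ A₁ ⊔ T}
        zero_mem' := fun x _ => by rw [zero_smul]; exact Submodule.zero_mem _
        add_mem' := fun {f g} hf hg x hx => by
          rw [add_smul]; exact Submodule.add_mem _ (hf x hx) (hg x hx)
        smul_mem' := fun f g hg x hx => by
          rw [smul_eq_mul, mul_smul]; exact Submodule.smul_mem _ _ (hg x hx) }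
    refine evPoly_hilb hℳ hsuph (torsionIn_isHomogeneous hA₁ hA) hsup
      (fg_of_le hfg (torsionIn_le _ _)) (fun a ha x hx => Submodule.mem_sup_left (hk a ha x hx))
      (J := Q) (hr.of_not_minimal fun P hP hQP => ?_) (fun P _ h f hf => h f hf)
    have hmP : (IsLocalRing.maximalIdeal R).map C ≤ P := by
      rw [Ideal.map_le_iff_le_comap]
      intro a ha
      refine hP.isPrime.mem_of_pow_mem k (hQP fun x hx => Submodule.mem_sup_left ?_)
      rw [← map_pow, ← MvPolynomial.algebraMap_eq, algebraMap_smul]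
      exact hk _ (Ideal.pow_mem_pow ha k) x hx
    have hJP : J ≤ P := fun f hf => hQP fun x hx =>
      Submodule.mem_sup_left (hle' (hJ f hf x hx.1))
    -- If `P` were minimal over `J`, then, as it contains `𝔪`, some `b ∉ P` would multiply a power
    -- of `𝔪` into `J`. Hence `b` maps all of `A` into the torsion modulo `A'`, so it annihilates
    -- the cokernel and lies in `P`.
    refine exists_isRelevant_lt hJh hP hJP fun hmin => ?_
    obtain ⟨b, hb, n, hn⟩ := exists_mul_pow_le_of_mem_minimalPrimes hmin hmP
    refine hb (hQP fun x hx => Submodule.mem_sup_right ⟨A.smul_mem b hx.1, n, fun a ha => ?_⟩)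
    rw [← algebraMap_smul (MvPolynomial σ R) a, smul_smul, mul_comm]
    refine hJ _ (hn _ ?_) x hx.1
    rw [← Ideal.map_pow]
    exact Ideal.mem_map_of_mem _ ha
  · have h1 : torsionHilb ℳ A' A d = torsionHilb ℳ A' A₁ d + hilb ℳ (torsionIn A' A₁) T d := by
      refine hilb_add (le_torsionIn hle') ?_ d
      rw [← hT₁]
      exact inf_le_right
    have h2 : hilb ℳ (torsionIn A' A₁) T d = hilb ℳ A₁ (A₁ ⊔ T) d := by
      rw [← hT₁]
      exact hilb_inf_sup hA₁ hTh d
    have h3 : torsionHilb ℳ A₁ A d = hilb ℳ A₁ (A₁ ⊔ T) d + hilb ℳ (A₁ ⊔ T) (torsionIn A₁ A) d :=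
      hilb_add le_sup_left hsup d
    rw [h1, h2, h3, add_assoc]

end Torsion

end JointBlowup

namespace JointBlowup

/-! ### A dimension inequality -/

section DimensionInequality

theorem length_le_height_of_surjective {A A' : Type*} [CommRing A] [CommRing A'] {f : A →+* A'}
    (hf : Function.Surjective f) (Q : Ideal A') [Q.IsPrime] (l : LTSeries (PrimeSpectrum A))
    (hhead : RingHom.ker f ≤ l.head.asIdeal) (hlast : l.last.asIdeal ≤ Q.comap f) :
    (l.length : ℕ∞) ≤ Q.height := by
  have hker : ∀ i, RingHom.ker f ≤ (l i).asIdeal := fun i =>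
    hhead.trans (show l.head ≤ l i from l.monotone (Fin.zero_le i))
  have hcm : ∀ i, ((l i).asIdeal.map f).comap f = (l i).asIdeal := fun i => by
    rw [Ideal.comap_map_of_surjective f hf]
    exact sup_of_le_left (hker i)
  let l' : LTSeries (PrimeSpectrum A') :=
    { length := l.length
      toFun := fun i => ⟨(l i).asIdeal.map f, Ideal.map_isPrime_of_surjective hf (hker i)⟩
      step := fun i => by
        have h1 : l i.castSucc < l i.succ := l.step i
        refine lt_of_le_of_ne (Ideal.map_mono (show (l i.castSucc).asIdeal ≤ _ from h1.le)) ?_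
        intro h
        have h2 : (l i.castSucc).asIdeal.map f = (l i.succ).asIdeal.map f :=
          by
            simpa only [PrimeSpectrum.mk.injEq] using h
        apply h1.ne
        ext1
        rw [← hcm, ← hcm i.succ, h2] }
  have h1 : l'.last ≤ ⟨Q, inferInstance⟩ := by
    change l.last.asIdeal.map f ≤ Q
    exact Ideal.map_le_iff_le_comap.2 hlast
  have := Order.length_le_height h1
  rw [← PrimeSpectrum.height_eq_orderHeight] at this
  exact this

theorem height_le_height_comap_of_surjective {A A' : Type*} [CommRing A] [CommRing A']
    {f : A →+* A'} (hf : Function.Surjective f) (Q : Ideal A') [Q.IsPrime] :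
    Q.height ≤ (Q.comap f).height := by
  have h := Order.height_le_height_apply_of_strictMono (PrimeSpectrum.comap f)
    (RingHom.strictMono_comap_of_surjective hf) ⟨Q, inferInstance⟩
  rw [← PrimeSpectrum.height_eq_orderHeight, ← PrimeSpectrum.height_eq_orderHeight] at h
  exact h

/-- The pulled back chain starts above the nonzero kernel, so the zero ideal of the domain `A` can
be added below it. -/
theorem height_add_one_le_height_comap_of_surjective {A A' : Type*} [CommRing A] [IsDomain A]
    [CommRing A'] [IsNoetherianRing A'] {f : A →+* A'} (hf : Function.Surjective f)
    (hker : RingHom.ker f ≠ ⊥) (Q : Ideal A') [Q.IsPrime] :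
    Q.height + 1 ≤ (Q.comap f).height := by
  obtain ⟨l, hl, hlen⟩ := Q.exists_ltSeries_length_eq_height
  let l₁ := l.map (PrimeSpectrum.comap f) (RingHom.strictMono_comap_of_surjective hf)
  have hlt : (⟨⊥, Ideal.isPrime_bot⟩ : PrimeSpectrum A) < l₁.head := by
    refine lt_of_le_of_ne bot_le fun h => hker ?_
    have h1 : (⊥ : Ideal A) = l₁.head.asIdeal :=
      congrArg (fun q : PrimeSpectrum A => q.asIdeal) h
    rw [eq_bot_iff, h1]
    intro x hx
    rw [RingHom.mem_ker] at hx
    rw [LTSeries.head_map]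
    change f x ∈ l.head.asIdeal
    rw [hx]
    exact Ideal.zero_mem _
  have h2 : (l₁.cons _ hlt).last ≤ ⟨Q.comap f, inferInstance⟩ := by
    rw [RelSeries.last_cons, LTSeries.last_map, hl]
    exact le_rfl
  have := Order.length_le_height h2
  rw [← PrimeSpectrum.height_eq_orderHeight] at this
  rw [← hlen]
  have h3 : (l₁.cons _ hlt).length = l.length + 1 := by
    rw [RelSeries.cons_length]
    rfl
  rw [h3] at this
  exact_mod_cast this

variable {D V k : Type*} [CommRing D] [CommRing V] [Algebra D V] [Field k]

/-- The kernel of the restriction of `χ` to a subalgebra. -/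
def augmentationIdeal (χ : V →+* k) (K : Subalgebra D V) : Ideal K :=
  RingHom.ker (χ.comp K.val.toRingHom)

instance (χ : V →+* k) (K : Subalgebra D V) : (augmentationIdeal χ K).IsPrime :=
  RingHom.ker_isPrime _

variable [IsNoetherianRing D]

/-- Present `K[y]` as a quotient of `K[X]`. Since `χ` is surjective on `D`, the augmentation ideal
pulls back to a maximal ideal of `K[X]` over that of `K`, of height exactly one more. A relation `a
* y ∈ K` with `a ≠ 0` makes the kernel nonzero, which takes that one away again. -/
theorem height_augmentationIdeal_insert {χ : V →+* k}
    (hχ : Function.Surjective (χ.comp (algebraMap D V))) {s : Set V} (hs : s.Finite) (y : V) :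
    (augmentationIdeal χ (Algebra.adjoin D (insert y s))).height ≤
      (augmentationIdeal χ (Algebra.adjoin D s)).height + 1 ∧
    (IsDomain V → (∃ a ∈ Algebra.adjoin D s, a ≠ 0 ∧ a * y ∈ Algebra.adjoin D s) →
      (augmentationIdeal χ (Algebra.adjoin D (insert y s))).height ≤
      (augmentationIdeal χ (Algebra.adjoin D s)).height) := by
  have hNoeth : ∀ t : Set V, t.Finite → IsNoetherianRing (Algebra.adjoin D t) := by
    intro t ht
    exact isNoetherianRing_of_fg (Subalgebra.fg_def.2 ⟨t, ht, rfl⟩)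
  have := hNoeth s hs
  have := hNoeth _ (hs.insert y)
  set K := Algebra.adjoin D s with hK
  set K' := Algebra.adjoin D (insert y s) with hK'
  have hle : K ≤ K' := Algebra.adjoin_mono (Set.subset_insert y s)
  have hy : y ∈ K' := Algebra.subset_adjoin (Set.mem_insert y s)
  let f : Polynomial K →+* K' := Polynomial.eval₂RingHom (Subalgebra.inclusion hle).toRingHom ⟨y, hy⟩
  have hfC : ∀ a : K, f (Polynomial.C a) = Subalgebra.inclusion hle a := fun a => by simp [f]
  have hfX : f Polynomial.X = ⟨y, hy⟩ := by simp [f]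
  have hf : Function.Surjective f := by
    have h1 : ∀ z ∈ K', ∃ g, (f g : V) = z := by
      intro z hz
      induction hz using Algebra.adjoin_induction with
      | mem x hx =>
        rcases Set.mem_insert_iff.1 hx with rfl | hx
        · exact ⟨Polynomial.X, by rw [hfX]⟩
        · exact ⟨Polynomial.C ⟨x, Algebra.subset_adjoin hx⟩, by rw [hfC]; rfl⟩
      | algebraMap r => exact ⟨Polynomial.C (algebraMap D K r), by rw [hfC]; rfl⟩
      | add a b _ _ ha hb =>
        obtain ⟨g, rfl⟩ := ha
        obtain ⟨g', rfl⟩ := hb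
        exact ⟨g + g', by rw [map_add]; rfl⟩
      | mul a b _ _ ha hb =>
        obtain ⟨g, rfl⟩ := ha
        obtain ⟨g', rfl⟩ := hb
        exact ⟨g * g', by rw [map_mul]; rfl⟩
    rintro ⟨z, hz⟩
    obtain ⟨g, hg⟩ := h1 z hz
    exact ⟨g, Subtype.ext hg⟩
  have hsurj : Function.Surjective ((χ.comp K'.val.toRingHom).comp f) := by
    intro c
    obtain ⟨r, hr⟩ := hχ c
    refine ⟨Polynomial.C (algebraMap D K r), ?_⟩
    rw [RingHom.comp_apply, hfC]
    exact hr
  have hmax : ((augmentationIdeal χ K').comap f).IsMaximal := by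
    rw [augmentationIdeal, RingHom.comap_ker]
    exact RingHom.ker_isMaximal_of_surjective _ hsurj
  have hlies : ((augmentationIdeal χ K').comap f).LiesOver (augmentationIdeal χ K) := by
    refine ⟨?_⟩
    ext a
    change χ a = 0 ↔ χ (f (Polynomial.C a)) = 0
    rw [hfC]
    rfl
  have hht := Polynomial.height_eq_height_add_one (augmentationIdeal χ K)
    ((augmentationIdeal χ K').comap f)
  refine ⟨hht ▸ height_le_height_comap_of_surjective hf _, ?_⟩
  rintro hV ⟨a, ha, ha0, hay⟩
  have hker : RingHom.ker f ≠ ⊥ := by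
    intro hbot
    have h1 : Polynomial.C (⟨a, ha⟩ : K) * Polynomial.X - Polynomial.C ⟨a * y, hay⟩ ∈
        RingHom.ker f := by
      rw [RingHom.mem_ker, map_sub, map_mul, hfC, hfC, hfX, sub_eq_zero]
      rfl
    rw [hbot, Ideal.mem_bot] at h1
    have h2 := congrArg (fun q => Polynomial.coeff q 1) h1
    simp only [Polynomial.coeff_sub, Polynomial.coeff_C_mul, Polynomial.coeff_X_one, mul_one,
      Polynomial.coeff_C_succ, sub_zero, Polynomial.coeff_zero] at h2
    exact ha0 (congrArg Subtype.val h2)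
  have h2 := height_add_one_le_height_comap_of_surjective hf hker (augmentationIdeal χ K')
  rw [hht] at h2
  exact (ENat.add_le_add_iff_right (by simp)).1 h2

/-- The dimension inequality for a finitely generated extension in which all but the generators
in `s` satisfy a linear equation. -/
theorem height_augmentationIdeal_adjoin_union [IsDomain V] {χ : V →+* k}
    (hχ : Function.Surjective (χ.comp (algebraMap D V))) {n : ℕ} (s : Fin n → V) {t : Set V}
    (ht : t.Finite)
    (hst : ∀ y ∈ t, ∃ a ∈ Algebra.adjoin D (Set.range s), a ≠ 0 ∧
      a * y ∈ Algebra.adjoin D (Set.range s)) :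
    (augmentationIdeal χ (Algebra.adjoin D (t ∪ Set.range s))).height ≤
      (RingHom.ker (χ.comp (algebraMap D V))).height + n := by
  induction t, ht using Set.Finite.induction_on with
  | empty =>
    rw [Set.empty_union]
    clear hst
    induction n with
    | zero =>
      rw [Set.range_eq_empty, Algebra.adjoin_empty]
      let f : D →+* (⊥ : Subalgebra D V) := algebraMap D _
      have hf : Function.Surjective f := by
        rintro ⟨z, hz⟩
        obtain ⟨d, rfl⟩ := Algebra.mem_bot.1 hz
        exact ⟨d, rfl⟩
      have := height_le_height_comap_of_surjective hf (augmentationIdeal χ (⊥ : Subalgebra D V))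
      rw [Nat.cast_zero, add_zero]
      exact this
    | succ n ih =>
      have h1 : Set.range s = insert (s (Fin.last n)) (Set.range fun i : Fin n => s i.castSucc) := by
        ext x
        constructor
        · rintro ⟨i, rfl⟩
          induction i using Fin.lastCases with
          | last => exact Set.mem_insert _ _
          | cast i => exact Set.mem_insert_of_mem _ ⟨i, rfl⟩
        · rintro (rfl | ⟨i, rfl⟩)
          · exact ⟨_, rfl⟩
          · exact ⟨_, rfl⟩
      rw [h1]
      refine (height_augmentationIdeal_insert hχ (Set.finite_range _) _).1.trans ?_
      refine (add_le_add_left (ih fun i : Fin n => s i.castSucc) 1).trans ?_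
      push_cast
      rw [add_assoc]
  | insert _ ht ih =>
    rename_i y t _
    rw [Set.insert_union]
    refine ((height_augmentationIdeal_insert hχ (ht.union (Set.finite_range s)) y).2
      inferInstance ?_).trans (ih fun z hz => hst z (Set.mem_insert_of_mem _ hz))
    obtain ⟨a, ha, ha0, hay⟩ := hst y (Set.mem_insert _ _)
    exact ⟨a, Algebra.adjoin_mono Set.subset_union_right ha, ha0,
      Algebra.adjoin_mono Set.subset_union_right hay⟩

end DimensionInequality

end JointBlowup

namespace JointBlowup

open MvPolynomial DirectSum

/-! ### Killing the variables of one direction -/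

section Truncation

variable {σ τ R : Type*} [CommRing R] [DecidableEq τ] (dir : σ → τ)

/-- The endomorphism sending the variables in direction `j` to zero. -/
noncomputable def killVars (j : τ) : MvPolynomial σ R →ₐ[R] MvPolynomial σ R :=
  aeval fun s => if dir s = j then 0 else X s

theorem killVars_of_ne_zero {d : τ → ℤ} {f : MvPolynomial σ R} (hf : f ∈ polyPiece dir d) {j : τ}
    (hd : d j ≠ 0) : killVars dir j f = 0 :=
  RingHom.mem_ker.1 (mem_of_mem_polyPiece dir hf hd (P := RingHom.ker (killVars (R := R) dir j))
    fun s hs => by simp [RingHom.mem_ker, killVars, hs])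

theorem killVars_of_eq_zero {d : τ → ℤ} {f : MvPolynomial σ R} (hf : f ∈ polyPiece dir d) {j : τ}
    (hd : d j = 0) : killVars dir j f = f := by
  have h : killVars dir j f = aeval X f := by
    refine eval₂Hom_congr' rfl (fun s hs _ => ?_) rfl
    rw [if_neg]
    intro hsj
    obtain ⟨m, hm, hms⟩ := (mem_vars_iff_mem_support s).1 hs
    have h1 := polyPiece_weight_apply dir hf (mem_support_iff.1 hm) j
    rw [hd, eq_comm, Finset.sum_eq_zero_iff_of_nonneg] at h1
    · have h2 := h1 s hms
      rw [if_pos hsj, mul_one] at h2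
      exact Finsupp.mem_support_iff.1 hms (by exact_mod_cast h2)
    · intro i _
      split_ifs <;> simp
  rw [h, aeval_X_left_apply]

variable [Fintype τ]

theorem decompose_killVars (j : τ) (f : MvPolynomial σ R) (d : τ → ℤ) :
    (decompose (polyPiece (R := R) dir) (killVars dir j f) d : MvPolynomial σ R) =
      killVars dir j (decompose (polyPiece (R := R) dir) f d : MvPolynomial σ R) := by
  classical
  induction f using Decomposition.inductionOn (polyPiece (R := R) dir) with
  | zero => simp
  | @homogeneous i m =>
    have hmem : killVars dir j (m : MvPolynomial σ R) ∈ polyPiece (R := R) dir i := by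
      by_cases h : i j = 0
      · rw [killVars_of_eq_zero dir m.2 h]
        exact m.2
      · rw [killVars_of_ne_zero dir m.2 h]
        exact Submodule.zero_mem _
    by_cases h : i = d
    · subst h
      rw [decompose_of_mem_same _ hmem, decompose_of_mem_same _ m.2]
    · rw [decompose_of_mem_ne _ hmem h, decompose_of_mem_ne _ m.2 h, map_zero]
  | add a b ha hb =>
    rw [map_add, decompose_add, decompose_add, DFinsupp.add_apply, DFinsupp.add_apply,
      Submodule.coe_add, Submodule.coe_add, map_add, ha, hb]

/-- The ideal of all polynomials that are in `P` after killing the variables in direction `j`. -/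
noncomputable def truncateIdeal (j : τ) (P : Ideal (MvPolynomial σ R)) : Ideal (MvPolynomial σ R) :=
  P.comap (killVars dir j)

instance (j : τ) (P : Ideal (MvPolynomial σ R)) [P.IsPrime] : (truncateIdeal dir j P).IsPrime :=
  Ideal.comap_isPrime _ _

theorem mem_truncateIdeal_of_ne_zero {j : τ} {P : Ideal (MvPolynomial σ R)} {d : τ → ℤ}
    {f : MvPolynomial σ R} (hf : f ∈ polyPiece dir d) (hd : d j ≠ 0) : f ∈ truncateIdeal dir j P := by
  rw [truncateIdeal, Ideal.mem_comap, killVars_of_ne_zero dir hf hd]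
  exact P.zero_mem

theorem mem_truncateIdeal_iff_of_eq_zero {j : τ} {P : Ideal (MvPolynomial σ R)} {d : τ → ℤ}
    {f : MvPolynomial σ R} (hf : f ∈ polyPiece dir d) (hd : d j = 0) :
    f ∈ truncateIdeal dir j P ↔ f ∈ P := by
  rw [truncateIdeal, Ideal.mem_comap, killVars_of_eq_zero dir hf hd]

variable {dir}

theorem le_of_forall_homogeneous {I J : Ideal (MvPolynomial σ R)}
    (hI : I.IsHomogeneous (polyPiece (R := R) dir))
    (h : ∀ d, ∀ f ∈ polyPiece (R := R) dir d, f ∈ I → f ∈ J) : I ≤ J := by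
  classical
  intro f hf
  rw [← sum_support_decompose (polyPiece (R := R) dir) f]
  exact J.sum_mem fun d _ => h d _ (SetLike.coe_mem _) (hI d hf)

theorem truncateIdeal_isHomogeneous {j : τ} {P : Ideal (MvPolynomial σ R)}
    (hP : P.IsHomogeneous (polyPiece (R := R) dir)) :
    (truncateIdeal dir j P).IsHomogeneous (polyPiece (R := R) dir) := by
  intro d f hf
  rw [truncateIdeal, Ideal.mem_comap, ← decompose_killVars]
  exact hP d hf

theorem le_truncateIdeal {j : τ} {P : Ideal (MvPolynomial σ R)}
    (hP : P.IsHomogeneous (polyPiece (R := R) dir)) : P ≤ truncateIdeal dir j P := by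
  refine le_of_forall_homogeneous hP fun d f hf hfP => ?_
  by_cases h : d j = 0
  · exact (mem_truncateIdeal_iff_of_eq_zero dir hf h).2 hfP
  · exact mem_truncateIdeal_of_ne_zero dir hf h

theorem X_mem_truncateIdeal {j : τ} {P : Ideal (MvPolynomial σ R)} {s : σ} (hs : dir s = j) :
    X s ∈ truncateIdeal dir j P := by
  subst hs
  exact mem_truncateIdeal_of_ne_zero dir (X_mem_polyPiece dir s) (by simp)

theorem truncateIdeal_le {j : τ} {P Q : Ideal (MvPolynomial σ R)}
    (hP : P.IsHomogeneous (polyPiece (R := R) dir)) (hPQ : P ≤ Q) (hQ : ∀ s, dir s = j → X s ∈ Q) :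
    truncateIdeal dir j P ≤ Q := by
  refine le_of_forall_homogeneous (truncateIdeal_isHomogeneous hP) fun d f hf hfP => ?_
  by_cases h : d j = 0
  · exact hPQ ((mem_truncateIdeal_iff_of_eq_zero dir hf h).1 hfP)
  · exact mem_of_mem_polyPiece dir hf h hQ

variable (dir) in
/-- The directions in which `P` does not contain all variables. -/
def varSupport (P : Ideal (MvPolynomial σ R)) : Set τ := {j | ∃ s, dir s = j ∧ X s ∉ P}

theorem varSupport_truncateIdeal (j : τ) (P : Ideal (MvPolynomial σ R)) :
    varSupport dir (truncateIdeal dir j P) = varSupport dir P \ {j} := by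
  ext i
  constructor
  · rintro ⟨s, rfl, hs⟩
    have hne : dir s ≠ j := fun h => hs (X_mem_truncateIdeal h)
    refine ⟨⟨s, rfl, fun h => hs ?_⟩, hne⟩
    exact (mem_truncateIdeal_iff_of_eq_zero dir (X_mem_polyPiece dir s) (by simp [hne.symm])).2 h
  · rintro ⟨⟨s, rfl, hs⟩, hne⟩
    refine ⟨s, rfl, fun h => hs ?_⟩
    have hne : j ≠ dir s := fun h => hne h.symm
    exact (mem_truncateIdeal_iff_of_eq_zero dir (X_mem_polyPiece dir s) (by simp [hne])).1 h

theorem lt_truncateIdeal {j : τ} {P : Ideal (MvPolynomial σ R)}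
    (hP : P.IsHomogeneous (polyPiece (R := R) dir)) (hj : j ∈ varSupport dir P) :
    P < truncateIdeal dir j P := by
  obtain ⟨s, hs, hsP⟩ := hj
  exact SetLike.lt_iff_le_and_exists.2 ⟨le_truncateIdeal hP, X s, X_mem_truncateIdeal hs, hsP⟩

end Truncation

/-! ### Lifting homogeneous primes -/

section Lift

variable {σ τ R : Type*} [CommRing R] [DecidableEq τ] {dir : σ → τ}

variable (R dir) in
/-- The ideal generated by the homogeneous polynomials of degree at least `N` in direction `j`. -/
noncomputable def truncGE (j : τ) (N : ℕ) : Ideal (MvPolynomial σ R) :=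
  Ideal.span {f | ∃ e : τ → ℤ, (N : ℤ) ≤ e j ∧ f ∈ polyPiece dir e}

theorem truncGE_le_pow (j : τ) (N : ℕ) :
    truncGE R dir j N ≤ Ideal.span ((fun s => X s) '' {s | dir s = j}) ^ N := by
  induction N with
  | zero => simp
  | succ N ih =>
    rw [truncGE, Ideal.span_le]
    rintro f ⟨e, he, hf⟩
    rw [f.as_sum]
    refine Ideal.sum_mem _ fun m hm => ?_
    rw [mem_support_iff] at hm
    have h := polyPiece_weight_apply dir hf hm j
    obtain ⟨s, hs, hs2⟩ := Finset.exists_ne_zero_of_sum_ne_zero (h ▸ (by omega : e j ≠ 0))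
    have hsj : dir s = j := by
      by_contra hc
      simp [hc] at hs2
    have hms : m s ≠ 0 := by simpa using hs
    have hdec : m = (m - Finsupp.single s 1) + Finsupp.single s 1 := by
      rw [tsub_add_cancel_of_le]
      simpa using Nat.one_le_iff_ne_zero.2 hms
    have e1 : monomial m (coeff m f) = monomial (m - Finsupp.single s 1) (coeff m f) * X s := by
      rw [X, monomial_mul, mul_one, ← hdec]
    rw [e1, pow_succ]
    refine Ideal.mul_mem_mul (ih (Ideal.subset_span ⟨e - Pi.single j 1, ?_, ?_⟩))
      (Ideal.subset_span ⟨s, hsj, rfl⟩)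
    · simp only [Pi.sub_apply, Pi.single_eq_same]
      push_cast at he
      omega
    · refine isWeightedHomogeneous_monomial _ _ _ ?_
      have h1 : Finsupp.weight (fun s => (Pi.single (dir s) 1 : τ → ℤ)) m = e := hf hm
      rw [hdec, map_add, Finsupp.weight_single, one_smul, hsj] at h1
      rw [← h1, add_sub_cancel_right]

variable [Fintype τ]

/-- The generators taken from `Q` have degree zero in direction `j`, so their cofactors have to
supply the whole degree `e j ≥ N`. -/
theorem mem_sup_mul_truncGE {j : τ} {P Q : Ideal (MvPolynomial σ R)}
    (hP : P.IsHomogeneous (polyPiece (R := R) dir)) {e : τ → ℤ} {y : MvPolynomial σ R}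
    (hy : y ∈ polyPiece (R := R) dir e) {N : ℕ} (hN : (N : ℤ) ≤ e j)
    (hyJ : y ∈ P ⊔ Ideal.span {q | q ∈ Q ∧ ∃ d, d j = 0 ∧ q ∈ polyPiece (R := R) dir d}) :
    y ∈ P ⊔ Q * truncGE R dir j N := by
  obtain ⟨u, hu, v, hv, rfl⟩ := Submodule.mem_sup.1 hyJ
  rw [← decompose_of_mem_same _ hy, decompose_add, DFinsupp.add_apply, Submodule.coe_add]
  refine Submodule.add_mem_sup (hP e hu) ?_
  clear hy hyJ
  induction hv using Submodule.closure_induction with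
  | zero => simp
  | add a b _ _ ha hb =>
    rw [decompose_add, DFinsupp.add_apply, Submodule.coe_add]
    exact Ideal.add_mem _ ha hb
  | smul_mem r q hq =>
    obtain ⟨hqQ, d, hd, hqd⟩ := hq
    have h1 := coe_decompose_mul_add_of_right_mem (polyPiece (R := R) dir) (i := e - d) (a := r) hqd
    rw [sub_add_cancel] at h1
    rw [smul_eq_mul, h1, mul_comm _ q]
    refine Ideal.mul_mem_mul hqQ (Ideal.subset_span ⟨e - d, ?_, SetLike.coe_mem _⟩)
    rw [Pi.sub_apply, hd, sub_zero]
    exact hN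

variable [Finite σ] [IsNoetherianRing R]

/-- The Cayley–Hamilton argument: `a ∉ Q` cannot multiply all elements of large degree into
`P + Q · (elements of large degree)`. -/
theorem mem_of_mul_truncGE_le {j : τ} {P Q : Ideal (MvPolynomial σ R)} [P.IsPrime] [Q.IsPrime]
    (hPQ : P ≤ Q) {s : σ} (hs : dir s = j) (hsP : X s ∉ P) {a : MvPolynomial σ R} {N : ℕ}
    (h : ∀ f ∈ truncGE R dir j N, a * f ∈ P ⊔ Q * truncGE R dir j N) : a ∈ Q := by
  set F := truncGE R dir j N with hF
  let M : Submodule (MvPolynomial σ R) (MvPolynomial σ R ⧸ P) := Submodule.map P.mkQ F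
  have hfin : Module.Finite (MvPolynomial σ R) M := inferInstance
  -- Cayley–Hamilton for multiplication by `a` on `M`, the image of `F` modulo `P`, which is mapped
  -- into `Q • M`.
  obtain ⟨p, hp, -, hcoeff, haeval⟩ :=
    LinearMap.exists_monic_and_natDegree_eq_and_coeff_mem_pow_and_aeval_eq_zero (MvPolynomial σ R)
      (algebraMap (MvPolynomial σ R) (Module.End (MvPolynomial σ R) M) a) Q (by
        rintro _ ⟨⟨_, f, hf, rfl⟩, rfl⟩
        rw [Submodule.mem_smul_top_iff]
        obtain ⟨u, hu, v, hv, huv⟩ := Submodule.mem_sup.1 (h f hf)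
        change a • P.mkQ f ∈ Q • Submodule.map P.mkQ F
        rw [← map_smul, smul_eq_mul, ← huv, map_add,
          (show P.mkQ u = 0 from (Submodule.Quotient.mk_eq_zero P).2 hu),
          zero_add, ← Submodule.map_smul'']
        exact Submodule.mem_map_of_mem hv)
  rw [Polynomial.aeval_algebraMap_apply, Polynomial.coe_aeval_eq_eval] at haeval
  have hXF : (X s : MvPolynomial σ R) ^ N ∈ F := by
    refine Ideal.subset_span ⟨N • Pi.single (dir s) 1, ?_, SetLike.pow_mem_graded N (X_mem_polyPiece dir s)⟩
    simp [hs]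
  have h1 := congrArg (fun g => ((g ⟨P.mkQ (X s ^ N), X s ^ N, hXF, rfl⟩ : M) : MvPolynomial σ R ⧸ P))
    haeval
  have h2 : p.eval a * X s ^ N ∈ P := by
    rw [← Ideal.Quotient.eq_zero_iff_mem]
    exact h1
  have h3 : p.eval a ∈ Q :=
    hPQ ((Ideal.IsPrime.mem_or_mem ‹_› h2).resolve_right fun h => hsP (Ideal.IsPrime.mem_of_pow_mem ‹_› _ h))
  -- Modulo `Q` only the leading term of the monic polynomial survives, so a power of `a` is in `Q`.
  rw [Polynomial.eval_eq_sum_range, Finset.sum_range_succ, hp.coeff_natDegree, one_mul] at h3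
  have h4 : ∑ k ∈ Finset.range p.natDegree, p.coeff k * a ^ k ∈ Q := by
    refine Q.sum_mem fun k hk => Q.mul_mem_right _ (Ideal.pow_le_self ?_ (hcoeff k))
    have := Finset.mem_range.1 hk
    omega
  exact Ideal.IsPrime.mem_of_pow_mem ‹_› _ ((Ideal.add_mem_iff_right _ h4).1 h3)

/-- Geometrically, forgetting direction `j` is a projective map, hence closed, and so its image
contains every `Q` above the truncation of `P`. The prime `Q'` is the homogeneous core of a prime
over `P` and the part of `Q` of degree zero in direction `j`, disjoint from all `g * X s ^ n` with
`g ∉ Q`, for a suitable variable `X s`. That some variable is suitable is the Cayley–Hamilton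
argument `mem_of_mul_truncGE_le`. -/
theorem exists_lift {j : τ} {P Q : Ideal (MvPolynomial σ R)} (hPp : P.IsPrime)
    (hP : P.IsHomogeneous (polyPiece (R := R) dir)) (hj : j ∈ varSupport dir P) (hQp : Q.IsPrime)
    (hQ : Q.IsHomogeneous (polyPiece (R := R) dir)) (hPQ : truncateIdeal dir j P ≤ Q) :
    ∃ Q' : Ideal (MvPolynomial σ R), Q'.IsPrime ∧ Q'.IsHomogeneous (polyPiece (R := R) dir) ∧
      P ≤ Q' ∧ j ∈ varSupport dir Q' ∧ truncateIdeal dir j Q' = Q := by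
  classical
  have : Fintype σ := Fintype.ofFinite σ
  have hXQ : ∀ s, dir s = j → X s ∈ Q := fun s hs => hPQ (X_mem_truncateIdeal hs)
  set Q₀ : Ideal (MvPolynomial σ R) :=
    Ideal.span {q | q ∈ Q ∧ ∃ d, d j = 0 ∧ q ∈ polyPiece (R := R) dir d} with hQ₀
  have hJ : (P ⊔ Q₀).IsHomogeneous (polyPiece (R := R) dir) :=
    hP.sup (Ideal.homogeneous_span _ _ fun q hq => ⟨hq.2.choose, hq.2.choose_spec.2⟩)
  let T : σ → Submonoid (MvPolynomial σ R) := fun s =>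
    { carrier := {f | ∃ g ∉ Q, ∃ n : ℕ, g * X s ^ n = f}
      one_mem' := ⟨1, fun h => hQp.ne_top ((Ideal.eq_top_iff_one _).2 h), 0, by simp⟩
      mul_mem' := by
        rintro _ _ ⟨g, hg, n, rfl⟩ ⟨g', hg', n', rfl⟩
        exact ⟨g * g', fun h => (hQp.mem_or_mem h).elim hg hg', n + n', by ring⟩ }
  obtain ⟨s, hsj, hdis⟩ : ∃ s, dir s = j ∧ Disjoint ((P ⊔ Q₀ : Ideal _) : Set (MvPolynomial σ R)) (T s) := by
    by_contra! hcon
    have h1 : ∀ s, ∃ g : MvPolynomial σ R, ∃ d : τ → ℤ, ∃ n : ℕ, dir s = j → g ∉ Q ∧ d j = 0 ∧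
        g ∈ polyPiece (R := R) dir d ∧ g * X s ^ n ∈ P ⊔ Q₀ := by
      intro s
      by_cases hs : dir s = j
      swap
      · exact ⟨0, 0, 0, fun h => absurd h hs⟩
      obtain ⟨_, hf, g, hg, n, rfl⟩ := Set.not_disjoint_iff.1 (hcon s hs)
      obtain ⟨d, hd⟩ : ∃ d, (decompose (polyPiece (R := R) dir) g d : MvPolynomial σ R) ∉ Q := by
        by_contra! hc
        apply hg
        rw [← sum_support_decompose (polyPiece (R := R) dir) g]
        exact Q.sum_mem fun d _ => hc d
      refine ⟨_, d, n, fun _ => ⟨hd, ?_, SetLike.coe_mem _, ?_⟩⟩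
      · by_contra hc
        exact hd (mem_of_mem_polyPiece dir (SetLike.coe_mem _) hc hXQ)
      · rw [← coe_decompose_mul_add_of_right_mem (polyPiece (R := R) dir)
          (SetLike.pow_mem_graded n (X_mem_polyPiece dir s))]
        exact hJ _ hf
    choose g d n h1 using h1
    set U : Finset σ := Finset.univ.filter fun s => dir s = j with hU
    have hmemU : ∀ s ∈ U, dir s = j := fun s hs => by simpa [hU] using hs
    -- This single element, of degree zero in direction `j` and outside `Q`, multiplies a power of
    -- every variable of direction `j` into `P ⊔ Q₀`, hence also everything of large degree in
    -- direction `j`.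
    set a : MvPolynomial σ R := ∏ s ∈ U, g s with ha
    have haQ : a ∉ Q := by
      intro h
      obtain ⟨s, hs, hsQ⟩ := (Ideal.IsPrime.prod_mem_iff (hp := hQp)).1 h
      exact (h1 s (hmemU s hs)).1 hsQ
    have had : a ∈ polyPiece (R := R) dir (∑ s ∈ U, d s) :=
      SetLike.prod_mem_graded _ _ _ fun s hs => (h1 s (hmemU s hs)).2.2.1
    have hadj : (∑ s ∈ U, d s) j = 0 := by
      rw [Finset.sum_apply]
      exact Finset.sum_eq_zero fun s hs => (h1 s (hmemU s hs)).2.1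
    have hrad : Ideal.span ((fun s => X s) '' {s | dir s = j}) ≤
        (colonIdeal (P ⊔ Q₀ : Ideal (MvPolynomial σ R)) a).radical := by
      rw [Ideal.span_le]
      rintro _ ⟨s, hs, rfl⟩
      refine ⟨n s, ?_⟩
      rw [mem_colonIdeal, smul_eq_mul, ha,
        ← Finset.prod_erase_mul U g (a := s) (by simpa [hU] using hs), mul_comm, mul_assoc]
      exact Ideal.mul_mem_left _ _ (h1 s hs).2.2.2
    obtain ⟨N, hN⟩ := Ideal.exists_pow_le_of_le_radical_of_fg hrad (IsNoetherian.noetherian _)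
    obtain ⟨s, hs, hsP⟩ := hj
    refine haQ (mem_of_mul_truncGE_le ((le_truncateIdeal hP).trans hPQ) hs hsP (N := N) ?_)
    intro f hf
    induction hf using Submodule.closure_induction with
    | zero => simp
    | add x y _ _ hx hy =>
      rw [mul_add]
      exact Ideal.add_mem _ hx hy
    | smul_mem r f hf =>
      rw [smul_eq_mul, mul_left_comm]
      refine Ideal.mul_mem_left _ _ ?_
      have h2 := hN (truncGE_le_pow j N (Ideal.subset_span hf))
      obtain ⟨e, he, hfe⟩ := hf
      rw [mem_colonIdeal, smul_eq_mul, mul_comm] at h2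
      refine mem_sup_mul_truncGE hP (SetLike.mul_mem_graded had hfe) ?_ h2
      rw [Pi.add_apply, hadj, zero_add]
      exact he
  obtain ⟨Q', hQ'p, hle, hdis'⟩ := Ideal.exists_le_prime_disjoint _ _ hdis
  have hcore := Ideal.toIdeal_homogeneousCore_le (polyPiece (R := R) dir) Q'
  have hle' : P ⊔ Q₀ ≤ (Q'.homogeneousCore (polyPiece (R := R) dir)).toIdeal := by
    rw [← hJ.toIdeal_homogeneousCore_eq_self]
    exact Ideal.homogeneousCore_mono _ hle
  refine ⟨_, isPrime_homogeneousCore id Function.injective_id (fun _ _ => rfl) _ hQ'p,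
    HomogeneousIdeal.isHomogeneous _, le_sup_left.trans hle', ⟨s, hsj, fun h => ?_⟩, ?_⟩
  · exact Set.disjoint_left.1 hdis' (hcore h)
      ⟨1, fun h => hQp.ne_top ((Ideal.eq_top_iff_one _).2 h), 1, by simp⟩
  · apply le_antisymm
    · refine le_of_forall_homogeneous (truncateIdeal_isHomogeneous (HomogeneousIdeal.isHomogeneous _))
        fun d f hf hfQ => ?_
      by_cases h : d j = 0
      · by_contra hc
        exact Set.disjoint_left.1 hdis' (hcore ((mem_truncateIdeal_iff_of_eq_zero dir hf h).1 hfQ))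
          ⟨f, hc, 0, by simp⟩
      · exact mem_of_mem_polyPiece dir hf h hXQ
    · refine le_of_forall_homogeneous hQ fun d f hf hfQ => ?_
      by_cases h : d j = 0
      · exact (mem_truncateIdeal_iff_of_eq_zero dir hf h).2
          (hle' (Submodule.mem_sup_right (Ideal.subset_span ⟨hfQ, d, h, hf⟩)))
      · exact mem_truncateIdeal_of_ne_zero dir hf h

end Lift

end JointBlowup

namespace JointBlowup

open MvPolynomial DirectSum

/-! ### Chains of primes -/

section Chains

variable {A : Type*} [CommRing A]

/-- There is a chain of primes of length `d` that starts above `P` and ends with `M`. -/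
def ChainTo (M P : Ideal A) (d : ℕ) : Prop :=
  ∃ l : LTSeries (PrimeSpectrum A), l.length = d ∧ P ≤ l.head.asIdeal ∧ l.last.asIdeal = M

theorem ChainTo.anti {M P P' : Ideal A} {d : ℕ} (h : ChainTo M P d) (hP : P' ≤ P) :
    ChainTo M P' d := by
  obtain ⟨l, hl, hh, hlast⟩ := h
  exact ⟨l, hl, hP.trans hh, hlast⟩

theorem ChainTo.cons {M P P' : Ideal A} [hP : P.IsPrime] {d : ℕ} (h : ChainTo M P' d)
    (hlt : P < P') : ChainTo M P (d + 1) := by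
  obtain ⟨l, hl, hh, hlast⟩ := h
  refine ⟨l.cons ⟨P, hP⟩ (show P < _ from hlt.trans_le hh), ?_, ?_, ?_⟩
  · rw [RelSeries.cons_length, hl]
  · rw [RelSeries.head_cons]
  · rw [RelSeries.last_cons, hlast]

theorem ChainTo.exists_succ {M P : Ideal A} {d : ℕ} (h : ChainTo M P (d + 1)) :
    ∃ P' P'' : Ideal A, P'.IsPrime ∧ P ≤ P' ∧ P' < P'' ∧ ChainTo M P'' d := by
  obtain ⟨l, hl, hh, hlast⟩ := h
  have h0 : l.length ≠ 0 := by omega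
  have hlt : l.head < (l.tail h0).head := by
    rw [RelSeries.head_tail]
    have : NeZero l.length := ⟨h0⟩
    exact l.strictMono (Fin.lt_def.2 (by simp [Nat.mod_eq_of_lt, Nat.pos_of_ne_zero h0]))
  refine ⟨_, _, l.head.isPrime, hh, hlt, l.tail h0, ?_, le_rfl, ?_⟩
  · rw [RelSeries.tail_length, hl, Nat.add_sub_cancel]
  · rw [RelSeries.last_tail, hlast]

theorem ChainTo.of_le {M P : Ideal A} {d e : ℕ} (h : ChainTo M P e) (hde : d ≤ e) :
    ChainTo M P d := by
  induction e with
  | zero => rwa [Nat.le_zero.1 hde]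
  | succ e ih =>
    rcases hde.eq_or_lt with rfl | hlt
    · exact h
    · obtain ⟨P', P'', -, h1, h2, h3⟩ := h.exists_succ
      exact ih (h3.anti (h1.trans h2.le)) (by omega)

theorem chainTo_of_le_height {M : Ideal A} [M.IsPrime] [IsNoetherianRing A] {d : ℕ}
    (h : (d : ℕ∞) ≤ M.height) : ChainTo M ⊥ d := by
  obtain ⟨l, hl, hlen⟩ := M.exists_ltSeries_length_eq_height
  refine ChainTo.of_le ⟨l, rfl, bot_le, by rw [hl]⟩ ?_
  rw [← hlen] at h
  exact_mod_cast h

theorem ChainTo.comap {A' : Type*} [CommRing A'] {f : A →+* A'} (hf : Function.Surjective f)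
    {M P : Ideal A'} {d : ℕ} (h : ChainTo M P d) : ChainTo (M.comap f) (P.comap f) d := by
  obtain ⟨l, hl, hh, hlast⟩ := h
  refine ⟨l.map (PrimeSpectrum.comap f) (RingHom.strictMono_comap_of_surjective hf), hl, ?_, ?_⟩
  · rw [LTSeries.head_map]
    exact Ideal.comap_mono hh
  · rw [LTSeries.last_map, ← hlast]
    rfl

theorem ChainTo.le_height {A' : Type*} [CommRing A'] {f : A →+* A'} (hf : Function.Surjective f)
    {M : Ideal A'} [M.IsPrime] {d : ℕ} (h : ChainTo (M.comap f) (RingHom.ker f) d) :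
    (d : ℕ∞) ≤ M.height := by
  obtain ⟨l, rfl, hh, hlast⟩ := h
  exact length_le_height_of_surjective hf M l hh hlast.le

variable [IsNoetherianRing A]

/-- In a Noetherian ring a chain whose last member contains `x` can be rerouted, with the same ends
and length, so that its second member already contains `x`. -/
theorem ChainTo.exists_minimalPrimes {M P : Ideal A} {d : ℕ} (h : ChainTo M P (d + 1)) {x : A}
    (hx : x ∈ M) : ∃ P' ∈ (P ⊔ Ideal.span {x}).minimalPrimes, ChainTo M P' d := by
  obtain ⟨l, hl, hh, hlast⟩ := h
  obtain ⟨q, hq1, hqlen, hqh, hqlast⟩ :=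
    PrimeSpectrum.exist_ltSeries_mem_one_of_mem_last l (x := x) (by rwa [hlast])
  have h0 : q.length ≠ 0 := by omega
  have hle : P ⊔ Ideal.span {x} ≤ (q 1).asIdeal := by
    refine sup_le (hh.trans ?_) ((Ideal.span_singleton_le_iff_mem _).2 hq1)
    rw [hqh]
    exact q.monotone (Fin.zero_le 1)
  obtain ⟨P', hP', hle'⟩ := Ideal.exists_minimalPrimes_le hle
  refine ⟨P', hP', q.tail h0, ?_, ?_, ?_⟩
  · rw [RelSeries.tail_length]
    omega
  · rw [RelSeries.head_tail]
    exact hle'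
  · rw [RelSeries.last_tail, ← hqlast, hlast]

/-- By Krull's principal ideal theorem `P'` has height at most one modulo `P`, which leaves no room
for a prime strictly in between. -/
theorem eq_of_mem_minimalPrimes {P Q P' : Ideal A} [hP : P.IsPrime] [hQ : Q.IsPrime] {x : A}
    (hP' : P' ∈ (P ⊔ Ideal.span {x}).minimalPrimes) (hPQ : P < Q) (hQP' : Q ≤ P') : Q = P' := by
  by_contra hne
  have hlt := lt_of_le_of_ne hQP' hne
  have h1 := Ideal.map_height_le_one_of_mem_minimalPrimes hP'
  have hP'p := hP'.1.1
  have hker : RingHom.ker (Ideal.Quotient.mk P) ≤ P' := by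
    rw [Ideal.mk_ker]
    exact hPQ.le.trans hQP'
  have := Ideal.map_isPrime_of_surjective Ideal.Quotient.mk_surjective hker
  have h2 : ChainTo P' P' 0 := ⟨RelSeries.singleton _ ⟨P', hP'p⟩, rfl, le_rfl, rfl⟩
  have h3 := (h2.cons hlt).cons hPQ
  have h4 : ChainTo ((P'.map (Ideal.Quotient.mk P)).comap (Ideal.Quotient.mk P))
      (RingHom.ker (Ideal.Quotient.mk P)) (0 + 1 + 1) := by
    rwa [Ideal.comap_map_of_surjective' _ Ideal.Quotient.mk_surjective, Ideal.mk_ker,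
      sup_of_le_left (hPQ.le.trans hQP')]
  have h5 := (h4.le_height Ideal.Quotient.mk_surjective).trans h1
  exact absurd h5 (by norm_num)

end Chains

/-! ### Chains of homogeneous primes -/

section HomogeneousChains

variable {σ τ R : Type*} [CommRing R] [DecidableEq τ] [Fintype τ] {dir : σ → τ}

variable (R σ) in
/-- The ideal of all polynomials whose constant coefficient is not a unit. -/
noncomputable def originIdeal [IsLocalRing R] : Ideal (MvPolynomial σ R) :=
  (IsLocalRing.maximalIdeal R).comap (constantCoeff (R := R) (σ := σ))

instance [IsLocalRing R] : (originIdeal σ R).IsPrime := Ideal.comap_isPrime _ _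

theorem X_mem_originIdeal [IsLocalRing R] (s : σ) : X s ∈ originIdeal σ R := by
  simp [originIdeal]

theorem mem_of_mem_polyPiece_of_ne_zero {d : τ → ℤ} {f : MvPolynomial σ R}
    (hf : f ∈ polyPiece dir d) (hd : d ≠ 0) {P : Ideal (MvPolynomial σ R)} (hP : ∀ s, X s ∈ P) :
    f ∈ P := by
  obtain ⟨j, hj⟩ := Function.ne_iff.1 hd
  exact mem_of_mem_polyPiece dir hf hj fun s _ => hP s

/-- All components of nonzero degree lie in `P`, so the component of degree zero of an element of
`P` does too. -/
theorem isHomogeneous_of_X_mem {P : Ideal (MvPolynomial σ R)} (hP : ∀ s, X s ∈ P) :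
    P.IsHomogeneous (polyPiece (R := R) dir) := by
  classical
  have h1 : ∀ (f : MvPolynomial σ R) (d : τ → ℤ), d ≠ 0 →
      (decompose (polyPiece (R := R) dir) f d : MvPolynomial σ R) ∈ P := fun f d hd =>
    mem_of_mem_polyPiece_of_ne_zero (SetLike.coe_mem _) hd hP
  intro d f hf
  by_cases hd : d = 0
  swap
  · exact h1 f d hd
  subst hd
  rw [← sum_support_decompose (polyPiece (R := R) dir) f] at hf
  by_cases h0 : (0 : τ → ℤ) ∈ (decompose (polyPiece (R := R) dir) f).support
  · rw [← Finset.add_sum_erase _ _ h0] at hf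
    exact (Ideal.add_mem_iff_left _ (Ideal.sum_mem _ fun d hd => h1 f d (Finset.ne_of_mem_erase hd))).1 hf
  · rw [DFinsupp.notMem_support_iff.1 h0]
    exact P.zero_mem

/-- A homogeneous element of degree zero is a scalar, not a unit if it lies in `P`; those of other
degrees have no constant term. -/
theorem le_originIdeal [IsLocalRing R] {P : Ideal (MvPolynomial σ R)} (hPp : P ≠ ⊤)
    (hP : P.IsHomogeneous (polyPiece (R := R) dir)) : P ≤ originIdeal σ R := by
  classical
  refine le_of_forall_homogeneous hP fun d f hf hfP => ?_
  by_cases hd : d = 0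
  · subst hd
    have h1 : f = C (coeff 0 f) := by
      ext m
      rw [coeff_C]
      split_ifs with h
      · rw [h]
      · by_contra hm
        obtain ⟨s, hs⟩ := Finsupp.ne_iff.1 (Ne.symm h)
        have h2 := polyPiece_weight_apply dir hf hm (dir s)
        rw [Pi.zero_apply, eq_comm, Finset.sum_eq_zero_iff_of_nonneg] at h2
        · have h3 := h2 s (Finsupp.mem_support_iff.2 hs)
          rw [if_pos rfl, mul_one] at h3
          exact hs (by exact_mod_cast h3)
        · intro i _
          split_ifs <;> simp
    rw [originIdeal, Ideal.mem_comap, IsLocalRing.mem_maximalIdeal, mem_nonunits_iff]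
    intro hu
    apply hPp
    rw [h1] at hfP
    exact Ideal.eq_top_of_isUnit_mem _ hfP (hu.map C)
  · exact mem_of_mem_polyPiece_of_ne_zero hf hd X_mem_originIdeal

variable (dir) in
/-- There is a chain of length `n` of homogeneous primes with variable support `S`, starting at
`P`. -/
def HasChain (S : Set τ) : ℕ → Ideal (MvPolynomial σ R) → Prop
  | 0, P => P.IsPrime ∧ P.IsHomogeneous (polyPiece (R := R) dir) ∧ varSupport dir P = S
  | n + 1, P => (P.IsPrime ∧ P.IsHomogeneous (polyPiece (R := R) dir) ∧ varSupport dir P = S) ∧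
      ∃ Q, P < Q ∧ HasChain S n Q

theorem HasChain.base {S : Set τ} {n : ℕ} {P : Ideal (MvPolynomial σ R)} (h : HasChain dir S n P) :
    P.IsPrime ∧ P.IsHomogeneous (polyPiece (R := R) dir) ∧ varSupport dir P = S := by
  cases n with
  | zero => exact h
  | succ n => exact h.1

/-- A homogeneous prime lies under a chain to the origin of length at least the number of
directions that it sees. -/
theorem chainTo_originIdeal [IsLocalRing R] {n : ℕ} {P : Ideal (MvPolynomial σ R)} (hPp : P.IsPrime)
    (hP : P.IsHomogeneous (polyPiece (R := R) dir)) (hn : (varSupport dir P).ncard = n) :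
    ChainTo (originIdeal σ R) P n := by
  induction n generalizing P with
  | zero =>
    exact ⟨RelSeries.singleton _ ⟨originIdeal σ R, inferInstance⟩, rfl,
      le_originIdeal hPp.ne_top hP, rfl⟩
  | succ n ih =>
    obtain ⟨j, hj⟩ := Set.nonempty_of_ncard_ne_zero (by rw [hn]; exact n.succ_ne_zero)
    -- Killing a direction that `P` sees gives a strictly larger homogeneous prime that sees one
    -- direction fewer.
    refine ChainTo.cons (ih (P := truncateIdeal dir j P) inferInstance
      (truncateIdeal_isHomogeneous hP) ?_) (lt_truncateIdeal hP hj)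
    rw [varSupport_truncateIdeal, Set.ncard_sdiff_singleton_of_mem hj, hn, Nat.add_sub_cancel]

/-- Failure of the bound means `r + 1` relevant primes, that is `r` strict inclusions. The largest
of them sees every direction, and each direction contributes one further step towards the origin. -/
theorem exists_chainTo_of_not_relevantBound [IsLocalRing R] {r : ℕ} {J : Ideal (MvPolynomial σ R)}
    (h : ¬ RelevantBound dir r J) : ∃ P, IsRelevant dir P ∧ J ≤ P ∧
      ChainTo (originIdeal σ R) P (Fintype.card τ + r) := by
  induction r generalizing J with
  | zero =>
    rw [RelevantBound] at h
    push Not at h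
    obtain ⟨P, hP, hJP⟩ := h
    refine ⟨P, hP, hJP, chainTo_originIdeal hP.isPrime hP.isHomogeneous ?_⟩
    have : varSupport dir P = Set.univ := Set.eq_univ_of_forall fun j => hP.exists_notMem j
    rw [this, Set.ncard_univ, Nat.card_eq_fintype_card, add_zero]
  | succ r ih =>
    rw [RelevantBound] at h
    push Not at h
    obtain ⟨P, hP, hJP, J', hlt, hJ'⟩ := h
    obtain ⟨P', hP', hJP', hc⟩ := ih hJ'
    have := hP.isPrime
    exact ⟨P, hP, hJP, hc.cons (hlt.trans_le hJP')⟩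

/-- The chain is lifted one prime at a time by `exists_lift`; inclusions stay strict because the
lifts have different truncations. -/
theorem HasChain.lift [Finite σ] [IsNoetherianRing R] {n : ℕ} {S : Set τ} {j : τ} (hj : j ∈ S)
    {P : Ideal (MvPolynomial σ R)} (hPp : P.IsPrime)
    (hP : P.IsHomogeneous (polyPiece (R := R) dir)) (hPS : varSupport dir P = S)
    (h : HasChain dir (S \ {j}) n (truncateIdeal dir j P)) : HasChain dir S n P := by
  induction n generalizing P with
  | zero => exact ⟨hPp, hP, hPS⟩
  | succ n ih =>
    obtain ⟨-, Q, hlt, hQ⟩ := h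
    obtain ⟨hQp, hQh, hQS⟩ := hQ.base
    obtain ⟨Q', hQ'p, hQ'h, hle, hj', rfl⟩ := exists_lift hPp hP (hPS ▸ hj) hQp hQh hlt.le
    refine ⟨⟨hPp, hP, hPS⟩, Q', lt_of_le_of_ne hle fun he => ?_, ih hQ'p hQ'h ?_ hQ⟩
    · subst he
      exact hlt.ne rfl
    · rw [varSupport_truncateIdeal] at hQS
      rw [← Set.insert_sdiff_self_of_mem hj', hQS, Set.insert_sdiff_self_of_mem hj]

theorem hasChain_of_X_mem {M : Ideal (MvPolynomial σ R)} {d : ℕ} {P : Ideal (MvPolynomial σ R)}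
    (hPp : P.IsPrime) (hP : ∀ s, X s ∈ P) (h : ChainTo M P d) : HasChain dir ∅ d P := by
  have hS : ∀ Q : Ideal (MvPolynomial σ R), (∀ s, X s ∈ Q) → varSupport dir Q = ∅ := fun Q hQ =>
    Set.eq_empty_of_forall_notMem fun j ⟨s, _, hs⟩ => hs (hQ s)
  induction d generalizing P with
  | zero => exact ⟨hPp, isHomogeneous_of_X_mem hP, hS P hP⟩
  | succ d ih =>
    obtain ⟨P', P'', hP', h1, h2, hc⟩ := h.exists_succ
    obtain ⟨l, hl, hh, hlast⟩ := hc
    refine ⟨⟨hPp, isHomogeneous_of_X_mem hP, hS P hP⟩, l.head.asIdeal,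
      h1.trans_lt (h2.trans_le hh), ih l.head.isPrime (fun s => hh (h2.le (h1 (hP s))))
      ⟨l, hl, le_rfl, hlast⟩⟩

/-- From a chain of primes between `P` and the origin one obtains a chain of homogeneous primes
with the same variable support as `P`, shorter at most by the number of directions. -/
theorem hasChain_of_chainTo [Finite σ] [IsLocalRing R] [IsNoetherianRing R]
    (P : Ideal (MvPolynomial σ R)) : P.IsPrime → P.IsHomogeneous (polyPiece (R := R) dir) →
    ∀ d, ChainTo (originIdeal σ R) P d →
      HasChain dir (varSupport dir P) (d - (varSupport dir P).ncard) P := by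
  induction P using WellFoundedGT.induction with
  | ind P ih =>
  intro hPp hP d hd
  rcases Set.eq_empty_or_nonempty (varSupport dir P) with hS | ⟨j, hj⟩
  · rw [hS, Set.ncard_empty, Nat.sub_zero]
    refine hasChain_of_X_mem hPp (fun s => ?_) hd
    by_contra hs
    have : dir s ∈ varSupport dir P := ⟨s, rfl, hs⟩
    rw [hS] at this
    exact this
  rcases d with _ | d
  · rw [Nat.zero_sub]
    exact ⟨hPp, hP, rfl⟩
  obtain ⟨s, hs, hsP⟩ := id hj
  -- The chain is rerouted through a minimal prime of `P ⊔ (X s)`, which is again homogeneous and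
  -- strictly larger than `P`.
  obtain ⟨P₁, hP₁, hc⟩ := hd.exists_minimalPrimes (X_mem_originIdeal s)
  have hlt : P < P₁ := SetLike.lt_iff_le_and_exists.2 ⟨le_sup_left.trans hP₁.1.2, X s,
    hP₁.1.2 (Submodule.mem_sup_right (Ideal.mem_span_singleton_self _)), hsP⟩
  have hP₁p := hP₁.1.1
  have hcore := Ideal.toIdeal_homogeneousCore_le (polyPiece (R := R) dir) P₁
  have hP₁h : P₁.IsHomogeneous (polyPiece (R := R) dir) := by
    have hle : P ⊔ Ideal.span {X s} ≤ (P₁.homogeneousCore (polyPiece (R := R) dir)).toIdeal := by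
      have hh : (P ⊔ Ideal.span {X s}).IsHomogeneous (polyPiece (R := R) dir) := by
        refine hP.sup (Ideal.homogeneous_span _ _ ?_)
        rintro _ rfl
        exact ⟨_, X_mem_polyPiece dir s⟩
      rw [← hh.toIdeal_homogeneousCore_eq_self]
      exact Ideal.homogeneousCore_mono _ hP₁.1.2
    have h1 := hP₁.2 ⟨isPrime_homogeneousCore id Function.injective_id (fun _ _ => rfl) _ hP₁p, hle⟩ hcore
    rw [← le_antisymm hcore h1]
    exact HomogeneousIdeal.isHomogeneous _
  have hSS : varSupport dir P₁ ⊆ varSupport dir P := fun i ⟨s, hs, hsP⟩ =>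
    ⟨s, hs, fun h => hsP (hlt.le h)⟩
  have hIH := ih P₁ hlt hP₁p hP₁h d hc
  by_cases hEq : varSupport dir P₁ = varSupport dir P
  · rw [hEq] at hIH
    rcases Nat.lt_or_ge d (varSupport dir P).ncard with hlt' | hge
    · rw [Nat.sub_eq_zero_of_le (by omega)]
      exact ⟨hPp, hP, rfl⟩
    · rw [Nat.succ_sub hge]
      exact ⟨⟨hPp, hP, rfl⟩, P₁, hlt, hIH⟩
  · obtain ⟨i, hi, hi₁⟩ := Set.exists_of_ssubset (lt_of_le_of_ne hSS hEq)
    have hX : ∀ s, dir s = i → X s ∈ P₁ := fun s hs => by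
      by_contra hc
      exact hi₁ ⟨s, hs, hc⟩
    -- If `P₁` has lost a direction `i`, it contains the truncation of `P` at `i`, a prime strictly
    -- above `P`, so the two coincide. The chain above the truncation then lifts to one above `P`:
    -- the step lost from `d` is made up by the smaller variable support.
    have h1 := eq_of_mem_minimalPrimes hP₁ (lt_truncateIdeal hP hi) (truncateIdeal_le hP hlt.le hX)
    subst h1
    rw [varSupport_truncateIdeal, Set.ncard_sdiff_singleton_of_mem hi] at hIH
    have hpos : 0 < (varSupport dir P).ncard := (Set.ncard_pos (Set.toFinite _)).2 ⟨i, hi⟩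
    have h2 : d + 1 - (varSupport dir P).ncard = d - ((varSupport dir P).ncard - 1) := by omega
    rw [h2]
    exact HasChain.lift hi hPp hP rfl hIH

end HomogeneousChains

end JointBlowup

namespace JointBlowup

open MvPolynomial DirectSum

/-! ### Presentations of the joint blow-up -/

section Presentation

variable {p : ℕ} {R B : Type*} [CommRing R] [CommRing B] [Algebra R B]

/-- Finitely many generators of `B` as an `R`-algebra and of the ideals generated by the `H i`. -/
structure Presentation (𝒜 : (Fin p → ℕ) → Submodule R B) (H : Fin p → Submodule R B) where
  /-- the number of algebra generators -/
  m : ℕ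
  /-- the number of ideal generators -/
  n : ℕ
  /-- the algebra generators -/
  x : Fin m → B
  /-- the directions of the algebra generators -/
  dx : Fin m → Fin p
  /-- the ideal generators -/
  y : Fin n → B
  /-- the directions of the ideal generators -/
  dy : Fin n → Fin p
  x_mem : ∀ s, x s ∈ 𝒜 (Pi.single (dx s) 1)
  y_mem : ∀ s, y s ∈ 𝒜 (Pi.single (dy s) 1)
  adjoin_x : Algebra.adjoin R (Set.range x) = ⊤
  span_y : ∀ i, Ideal.span (H i : Set B) = Ideal.span (y '' {s | dy s = i})

namespace Presentation

variable {𝒜 : (Fin p → ℕ) → Submodule R B} {H : Fin p → Submodule R B} (D : Presentation 𝒜 H)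

/-- The variables: one for each generator of `B`, and for each ideal generator `y` of direction
`i` one variable for `y T` and one for `y T_i`. -/
abbrev Vars : Type := Fin D.m ⊕ (Fin D.n ⊕ Fin D.n)

/-- The directions of the variables. -/
def dir : D.Vars → Fin p ⊕ Fin p :=
  Sum.elim (fun s => Sum.inl (D.dx s)) (Sum.elim (fun s => Sum.inl (D.dy s)) fun s => Sum.inr (D.dy s))

/-- The surjection from a polynomial ring onto `B`. -/
noncomputable def toAlgebra : MvPolynomial (Fin D.m) R →ₐ[R] B := aeval D.x

theorem toAlgebra_surjective : Function.Surjective D.toAlgebra := by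
  rw [← AlgHom.range_eq_top, toAlgebra, ← Algebra.adjoin_range_eq_range_aeval, D.adjoin_x]

/-- The ring `B[T, T_1, …, T_p]`, as a module over the polynomial ring of the presentation. -/
def Ambient (_ : Presentation 𝒜 H) : Type _ := AddMonoidAlgebra B (ℕ × (Fin p → ℕ))

noncomputable instance : CommRing D.Ambient :=
  inferInstanceAs (CommRing (AddMonoidAlgebra B (ℕ × (Fin p → ℕ))))

noncomputable instance : Algebra R D.Ambient :=
  inferInstanceAs (Algebra R (AddMonoidAlgebra B (ℕ × (Fin p → ℕ))))

/-- The coefficient at `z`. -/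
noncomputable def coef (z : ℕ × (Fin p → ℕ)) : D.Ambient →ₗ[R] B where
  toFun w := AddMonoidAlgebra.coeff w z
  map_add' _ _ := rfl
  map_smul' _ _ := rfl

/-- The monomial with coefficient `b` at `z`. -/
noncomputable def mono (z : ℕ × (Fin p → ℕ)) : B →ₗ[R] D.Ambient where
  toFun b := AddMonoidAlgebra.single z b
  map_add' _ _ := AddMonoidAlgebra.single_add _ _ _
  map_smul' a b := (AddMonoidAlgebra.smul_single a z b).symm

/-- The map from the polynomial ring to `B[T, T_1, …, T_p]`. -/
noncomputable def toAmbient : MvPolynomial D.Vars R →ₐ[R] D.Ambient :=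
  aeval (Sum.elim (fun s => D.mono 0 (D.x s))
    (Sum.elim (fun s => D.mono (1, 0) (D.y s))
      fun s => D.mono (0, Pi.single (D.dy s) 1) (D.y s)))

noncomputable instance : Module (MvPolynomial D.Vars R) D.Ambient :=
  Module.compHom D.Ambient (D.toAmbient.toRingHom)

theorem smul_def (f : MvPolynomial D.Vars R) (w : D.Ambient) : f • w = D.toAmbient f * w :=
  rfl

instance : IsScalarTower R (MvPolynomial D.Vars R) D.Ambient := by
  refine IsScalarTower.of_algebraMap_smul fun r w => ?_
  rw [smul_def, AlgHom.commutes]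
  exact (Algebra.smul_def r w).symm

theorem coef_mono (z z' : ℕ × (Fin p → ℕ)) (b : B) :
    D.coef z' (D.mono z b) = if z = z' then b else 0 := by
  classical
  exact Finsupp.single_apply

theorem ext_coef {w w' : D.Ambient} (h : ∀ z, D.coef z w = D.coef z w') : w = w' :=
  AddMonoidAlgebra.ext (Finsupp.ext h)

theorem mono_mul_mono (z z' : ℕ × (Fin p → ℕ)) (b b' : B) :
    D.mono z b * D.mono z' b' = D.mono (z + z') (b * b') :=
  AddMonoidAlgebra.single_mul_single z z' b b'

theorem one_eq_mono : (1 : D.Ambient) = D.mono 0 1 := rfl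

theorem mem_of_mono_coef_mem {M : Type*} [SetLike M D.Ambient] [AddSubmonoidClass M D.Ambient] {A : M}
    {w : D.Ambient} (h : ∀ z, D.mono z (D.coef z w) ∈ A) : w ∈ A := by
  have h1 : ∑ z ∈ (AddMonoidAlgebra.coeff w).support, D.mono z (D.coef z w) = w :=
    AddMonoidAlgebra.sum_coeff_single w
  rw [← h1]
  exact sum_mem fun z _ => h z

theorem coef_mul_mem {𝔞 𝔟 𝔠 : ℕ × (Fin p → ℕ) → Ideal B} (h : ∀ z z', 𝔞 z * 𝔟 z' ≤ 𝔠 (z + z'))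
    {w w' : D.Ambient} (hw : ∀ z, D.coef z w ∈ 𝔞 z) (hw' : ∀ z, D.coef z w' ∈ 𝔟 z)
    (z : ℕ × (Fin p → ℕ)) : D.coef z (w * w') ∈ 𝔠 z := by
  classical
  have h1 : D.coef z (w * w') = _ := AddMonoidAlgebra.coeff_mul (R := B) w w' z
  rw [h1]
  refine Ideal.sum_mem _ fun a _ => Ideal.sum_mem _ fun b _ => ?_
  dsimp only
  split_ifs with hab
  · rw [← hab]
    exact h a b (Ideal.mul_mem_mul (hw a) (hw' b))
  · exact Ideal.zero_mem _

theorem X_inl_smul (s : Fin D.m) (w : D.Ambient) :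
    (X (Sum.inl s) : MvPolynomial D.Vars R) • w = D.mono 0 (D.x s) * w := by
  rw [smul_def, toAmbient, aeval_X]
  rfl

theorem X_inr_inl_smul (s : Fin D.n) (w : D.Ambient) :
    (X (Sum.inr (Sum.inl s)) : MvPolynomial D.Vars R) • w = D.mono (1, 0) (D.y s) * w := by
  rw [smul_def, toAmbient, aeval_X]
  rfl

theorem X_inr_inr_smul (s : Fin D.n) (w : D.Ambient) :
    (X (Sum.inr (Sum.inr s)) : MvPolynomial D.Vars R) • w =
      D.mono (0, Pi.single (D.dy s) 1) (D.y s) * w := by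
  rw [smul_def, toAmbient, aeval_X]
  rfl

/-- The polynomials in the generators of `B` act through `B`. -/
theorem rename_inl_smul (f : MvPolynomial (Fin D.m) R) (w : D.Ambient) :
    (rename Sum.inl f : MvPolynomial D.Vars R) • w = D.mono 0 (D.toAlgebra f) * w := by
  have h : ∀ f, D.toAmbient (rename Sum.inl f) = D.mono 0 (D.toAlgebra f) := fun f => by
    induction f using MvPolynomial.induction_on with
    | C r =>
      rw [rename_C, ← algebraMap_eq, AlgHom.commutes, ← algebraMap_eq, AlgHom.commutes]
      rfl
    | add f g hf hg => rw [map_add, map_add, hf, hg, map_add, map_add]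
    | mul_X f s hf =>
      rw [map_mul, map_mul, hf, rename_X, toAmbient, aeval_X, map_mul, toAlgebra, aeval_X]
      exact D.mono_mul_mono 0 0 _ _
  rw [smul_def, h]

end Presentation

/-! ### Rees modules -/

variable (H : Fin p → Submodule R B)

/-- The ideal `I^{k+a} I_1^{n_1} ⋯ I_p^{n_p} J`. -/
def reesIdeal (a : ℕ) (J : Ideal B) (z : ℕ × (Fin p → ℕ)) : Ideal B :=
  sumIdeal H ^ (z.1 + a) * powerIdeal H z.2 * J

variable {H}

theorem powerIdeal_add (n n' : Fin p → ℕ) : powerIdeal H (n + n') = powerIdeal H n * powerIdeal H n' := by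
  simp only [powerIdeal, Pi.add_apply, pow_add, Finset.prod_mul_distrib]

theorem powerIdeal_single (i : Fin p) : powerIdeal H (Pi.single i 1) = Ideal.span (H i : Set B) := by
  rw [powerIdeal, Finset.prod_eq_single i]
  · rw [Pi.single_eq_same, pow_one]
  · intro j _ hj
    rw [Pi.single_eq_of_ne hj, pow_zero]
  · exact fun h => absurd (Finset.mem_univ i) h

theorem powerIdeal_zero : powerIdeal H (0 : Fin p → ℕ) = 1 := by
  simp [powerIdeal]

theorem reesIdeal_mul (a a' : ℕ) (J J' : Ideal B) (z z' : ℕ × (Fin p → ℕ)) :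
    reesIdeal H a J z * reesIdeal H a' J' z' = reesIdeal H (a + a') (J * J') (z + z') := by
  simp only [reesIdeal, Prod.fst_add, Prod.snd_add, powerIdeal_add]
  ring

theorem reesIdeal_mono {a a' : ℕ} (ha : a' ≤ a) {J J' : Ideal B} (hJ : J ≤ J') (z : ℕ × (Fin p → ℕ)) :
    reesIdeal H a J z ≤ reesIdeal H a' J' z :=
  Ideal.mul_mono (Ideal.mul_mono_left (Ideal.pow_le_pow_right (by omega))) hJ

namespace Presentation

variable {𝒜 : (Fin p → ℕ) → Submodule R B} (D : Presentation 𝒜 H)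

theorem span_y_le (s : Fin D.n) : D.y s ∈ Ideal.span (H (D.dy s) : Set B) := by
  rw [D.span_y]
  exact Ideal.subset_span ⟨s, rfl, rfl⟩

theorem y_mem_sumIdeal (s : Fin D.n) : D.y s ∈ sumIdeal H :=
  (le_iSup (fun i => Ideal.span (H i : Set B)) (D.dy s)) (D.span_y_le s)

theorem coef_toAmbient_mem (f : MvPolynomial D.Vars R) (z : ℕ × (Fin p → ℕ)) :
    D.coef z (D.toAmbient f : D.Ambient) ∈ reesIdeal H 0 ⊤ z := by
  have hone : ∀ b, b ∈ reesIdeal H 0 ⊤ 0 := fun b => by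
    simp [reesIdeal, powerIdeal_zero]
  have hsingle : ∀ z b, b ∈ reesIdeal H 0 ⊤ z → ∀ z', D.coef z' (D.mono z b) ∈ reesIdeal H 0 ⊤ z' := by
    intro z b hb z'
    rw [coef_mono]
    split_ifs with h
    · rwa [← h]
    · exact Ideal.zero_mem _
  induction f using MvPolynomial.induction_on generalizing z with
  | C r =>
    rw [← algebraMap_eq, AlgHom.commutes]
    exact hsingle 0 (algebraMap R B r) (hone _) z
  | add f g hf hg =>
    rw [map_add]
    exact Ideal.add_mem _ (hf z) (hg z)
  | mul_X f s hf =>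
    rw [map_mul]
    refine D.coef_mul_mem (𝔞 := reesIdeal H 0 ⊤) (𝔟 := reesIdeal H 0 ⊤) (fun z z' => ?_) hf ?_ z
    · rw [reesIdeal_mul, Ideal.top_mul]
    · rw [toAmbient, aeval_X]
      rcases s with s | s | s
      · exact hsingle 0 _ (hone _)
      · refine hsingle (1, 0) _ ?_
        simpa [reesIdeal, powerIdeal_zero] using D.y_mem_sumIdeal s
      · refine hsingle (0, Pi.single (D.dy s) 1) _ ?_
        simpa [reesIdeal, powerIdeal_single] using D.span_y_le s

/-- The polynomials whose coefficient at `(k, n)` lies in `I^{k+a} I_1^{n_1} ⋯ I_p^{n_p} J`. -/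
noncomputable def rees (a : ℕ) (J : Ideal B) : Submodule (MvPolynomial D.Vars R) D.Ambient where
  carrier := {w | ∀ z, D.coef z w ∈ reesIdeal H a J z}
  zero_mem' z := by
    rw [map_zero]
    exact Ideal.zero_mem _
  add_mem' hw hw' z := by
    rw [map_add]
    exact Ideal.add_mem _ (hw z) (hw' z)
  smul_mem' f w hw z := by
    rw [smul_def]
    refine D.coef_mul_mem (𝔞 := reesIdeal H 0 ⊤) (fun z z' => ?_) (D.coef_toAmbient_mem f) hw z
    rw [reesIdeal_mul, zero_add, Ideal.top_mul]

theorem mem_rees {a : ℕ} {J : Ideal B} {w : D.Ambient} :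
    w ∈ D.rees a J ↔ ∀ z, D.coef z w ∈ reesIdeal H a J z := Iff.rfl

theorem mono_mem_rees {a : ℕ} {J : Ideal B} {z : ℕ × (Fin p → ℕ)} {b : B} (hb : b ∈ reesIdeal H a J z) :
    D.mono z b ∈ D.rees a J := by
  intro z'
  rw [coef_mono]
  split_ifs with h
  · rwa [← h]
  · exact Ideal.zero_mem _

theorem rees_mono {a a' : ℕ} (ha : a' ≤ a) {J J' : Ideal B} (hJ : J ≤ J') :
    D.rees a J ≤ D.rees a' J' := fun _ hw z => reesIdeal_mono ha hJ z (hw z)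

/-- The polynomials acting as zero on the associated graded modules. -/
noncomputable def annIdeal : Ideal (MvPolynomial D.Vars R) := colonIdeal (D.rees 1 ⊤) 1

theorem smul_mem_of_mem_annIdeal {f : MvPolynomial D.Vars R} (hf : f ∈ D.annIdeal) {J : Ideal B}
    {w : D.Ambient} (hw : w ∈ D.rees 0 J) : f • w ∈ D.rees 1 J := by
  intro z
  rw [annIdeal, mem_colonIdeal, smul_def, mul_one] at hf
  rw [smul_def]
  refine D.coef_mul_mem (𝔞 := reesIdeal H 1 ⊤) (𝔟 := reesIdeal H 0 J) (fun z z' => ?_) hf hw z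
  rw [reesIdeal_mul, add_zero, Ideal.top_mul]

theorem isNoetherianRing (D : Presentation 𝒜 H) [IsNoetherianRing R] : IsNoetherianRing B :=
  isNoetherianRing_of_surjective _ _ (D.toAlgebra : MvPolynomial (Fin D.m) R →+* B)
    D.toAlgebra_surjective

/-- Lets a factor from an ideal spanned by some `y` be traded for the action of the corresponding
variables. -/
theorem mono_mem_of_mem_span_mul {z z' : ℕ × (Fin p → ℕ)} {s : Set (Fin D.n)}
    {A : Submodule (MvPolynomial D.Vars R) D.Ambient} {K : Ideal B}
    (h : ∀ i ∈ s, ∀ b ∈ K, D.mono z (D.y i) * D.mono z' b ∈ A) {b : B}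
    (hb : b ∈ Ideal.span (D.y '' s) * K) : D.mono (z + z') b ∈ A := by
  induction hb using Submodule.mul_induction_on' with
  | mem_mul_mem a ha b hb =>
    induction ha using Submodule.span_induction generalizing b with
    | mem a ha =>
      obtain ⟨i, hi, rfl⟩ := ha
      rw [← mono_mul_mono]
      exact h i hi b hb
    | zero =>
      rw [zero_mul, map_zero]
      exact A.zero_mem
    | add a a' _ _ ih ih' =>
      rw [add_mul, map_add]
      exact A.add_mem (ih b hb) (ih' b hb)
    | smul c a _ ih =>
      rw [smul_eq_mul, mul_comm c, mul_assoc]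
      exact ih _ (K.mul_mem_left c hb)
  | add a _ b _ ha hb =>
    rw [map_add]
    exact A.add_mem ha hb

theorem sumIdeal_eq : sumIdeal H = Ideal.span (D.y '' Set.univ) := by
  simp only [sumIdeal, D.span_y]
  apply le_antisymm
  · exact iSup_le fun i => Ideal.span_mono (Set.image_mono (Set.subset_univ _))
  · rw [Ideal.span_le]
    rintro _ ⟨s, -, rfl⟩
    exact Ideal.mem_iSup_of_mem (D.dy s) (Ideal.subset_span ⟨s, rfl, rfl⟩)

/-- Factors from `I` and the `I_i` are peeled off one at a time, each absorbed by a variable for `y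
T` or `y T_i`, until an element of `J` at `z = 0` remains. Hence finitely many generators of `J`
generate the Rees module. -/
theorem mono_mem_span {J : Ideal B} (z : ℕ × (Fin p → ℕ)) {b : B} (hb : b ∈ reesIdeal H 0 J z) :
    D.mono z b ∈ Submodule.span (MvPolynomial D.Vars R) (D.mono 0 '' (J : Set B)) := by
  obtain ⟨k, n⟩ := z
  rw [reesIdeal, add_zero] at hb
  dsimp only at hb
  induction k generalizing b with
  | zero =>
    obtain ⟨N, hN⟩ : ∃ N, ∑ i, n i = N := ⟨_, rfl⟩
    induction N generalizing n b with
    | zero =>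
      have hn : n = 0 := by
        funext i
        exact (Finset.sum_eq_zero_iff.1 hN) i (Finset.mem_univ i)
      subst hn
      rw [pow_zero, powerIdeal_zero, one_mul, one_mul] at hb
      exact Submodule.subset_span ⟨b, hb, rfl⟩
    | succ N ih =>
      obtain ⟨i, -, hi⟩ := Finset.exists_ne_zero_of_sum_ne_zero (hN.trans_ne N.succ_ne_zero)
      have hdec : n = Pi.single i 1 + (n - Pi.single i 1) := by
        rw [add_tsub_cancel_of_le]
        intro j
        rcases eq_or_ne j i with rfl | hj
        · rw [Pi.single_eq_same]
          exact Nat.one_le_iff_ne_zero.2 hi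
        · rw [Pi.single_eq_of_ne hj]
          exact Nat.zero_le _
      generalize n - Pi.single i 1 = n' at hdec
      subst hdec
      have hN' : ∑ j, n' j = N := by
        simp only [Pi.add_apply, Finset.sum_add_distrib] at hN
        rw [Finset.sum_pi_single'] at hN
        simp at hN
        omega
      have hz : ((0, Pi.single i 1 + n') : ℕ × (Fin p → ℕ)) = (0, Pi.single i 1) + (0, n') := rfl
      rw [hz]
      rw [powerIdeal_add, powerIdeal_single, mul_left_comm, mul_assoc, D.span_y] at hb
      refine D.mono_mem_of_mem_span_mul ?_ hb
      rintro s rfl b hb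
      rw [← X_inr_inr_smul]
      exact Submodule.smul_mem _ _ (ih n' hb hN')
  | succ k ih =>
    have hz : ((k + 1, n) : ℕ × (Fin p → ℕ)) = (1, 0) + (k, n) := by
      rw [Prod.mk_add_mk, zero_add, add_comm]
    rw [hz]
    rw [pow_succ', mul_assoc, mul_assoc] at hb
    nth_rewrite 1 [D.sumIdeal_eq] at hb
    refine D.mono_mem_of_mem_span_mul ?_ hb
    intro s _ b hb
    rw [← X_inr_inl_smul]
    rw [← mul_assoc] at hb
    exact Submodule.smul_mem _ _ (ih hb)

theorem rees_fg [IsNoetherianRing R] (J : Ideal B) : (D.rees 0 J).FG := by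
  classical
  have := D.isNoetherianRing
  obtain ⟨s, hs⟩ := IsNoetherian.noetherian J
  refine ⟨s.image (D.mono 0), le_antisymm ?_ ?_⟩
  · rw [Submodule.span_le, Finset.coe_image]
    rintro _ ⟨b, hb, rfl⟩
    refine D.mono_mem_rees ?_
    have : b ∈ J := hs ▸ Submodule.subset_span hb
    simpa [reesIdeal, powerIdeal_zero] using this
  · intro w hw
    refine D.mem_of_mono_coef_mem fun z => ?_
    refine (Submodule.span_le.2 ?_) (D.mono_mem_span z (hw z))
    rintro _ ⟨b, hb, rfl⟩
    rw [← hs] at hb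
    rw [Finset.coe_image, SetLike.mem_coe]
    induction hb using Submodule.closure_induction with
    | zero =>
      rw [map_zero]
      exact Submodule.zero_mem _
    | add a b _ _ ha hb =>
      rw [map_add]
      exact Submodule.add_mem _ ha hb
    | smul_mem r b hb =>
      obtain ⟨f, rfl⟩ := D.toAlgebra_surjective r
      have h1 := D.mono_mul_mono 0 0 (D.toAlgebra f) b
      rw [add_zero] at h1
      rw [smul_eq_mul, ← h1, ← rename_inl_smul]
      exact Submodule.smul_mem _ _ (Submodule.subset_span ⟨b, hb, rfl⟩)

end Presentation

end Presentation

end JointBlowup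

namespace JointBlowup

open MvPolynomial DirectSum

section Grading

variable {p : ℕ} {R B : Type*} [CommRing R] [CommRing B] [Algebra R B]
  {𝒜 : (Fin p → ℕ) → Submodule R B} [GradedAlgebra 𝒜] {H : Fin p → Submodule R B}

/-! ### The grading of the ambient module -/

/-- The degree `(u - n, n)` of a monomial `b T^k T_1^{n_1} ⋯ T_p^{n_p}` with `b` of degree `u`. -/
def bidegree (z : ℕ × (Fin p → ℕ)) (u : Fin p → ℕ) : Fin p ⊕ Fin p → ℤ :=
  Sum.elim (fun i => (u i : ℤ) - z.2 i) (fun i => z.2 i)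

theorem bidegree_add (z z' : ℕ × (Fin p → ℕ)) (u u' : Fin p → ℕ) :
    bidegree (z + z') (u + u') = bidegree z u + bidegree z' u' := by
  funext i
  rcases i with i | i
  · simp only [bidegree, Sum.elim_inl, Pi.add_apply, Prod.snd_add]
    push_cast
    ring
  · simp [bidegree]

theorem bidegree_injective {z : ℕ × (Fin p → ℕ)} {u u' : Fin p → ℕ}
    (h : bidegree z u = bidegree z u') : u = u' := by
  funext i
  have := congrFun h (Sum.inl i)
  simp only [bidegree, Sum.elim_inl] at this
  omega

theorem isHomogeneous_span_of_le {S : Set B} {i : Fin p} (hS : S ⊆ 𝒜 (Pi.single i 1)) :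
    (Ideal.span S).IsHomogeneous 𝒜 :=
  Ideal.homogeneous_span _ _ fun _ hx => ⟨_, hS hx⟩

theorem isHomogeneous_pow {I : Ideal B} (hI : I.IsHomogeneous 𝒜) (k : ℕ) :
    (I ^ k).IsHomogeneous 𝒜 := by
  induction k with
  | zero =>
    rw [pow_zero, Ideal.one_eq_top]
    exact Ideal.IsHomogeneous.top 𝒜
  | succ k ih =>
    rw [pow_succ]
    exact ih.mul hI

theorem isHomogeneous_sumIdeal (hH : ∀ i, H i ≤ 𝒜 (Pi.single i 1)) :
    (sumIdeal H).IsHomogeneous 𝒜 :=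
  Ideal.IsHomogeneous.iSup fun i => isHomogeneous_span_of_le (hH i)

theorem isHomogeneous_powerIdeal (hH : ∀ i, H i ≤ 𝒜 (Pi.single i 1)) (n : Fin p → ℕ) :
    (powerIdeal H n).IsHomogeneous 𝒜 := by
  classical
  unfold powerIdeal
  induction (Finset.univ : Finset (Fin p)) using Finset.induction_on with
  | empty =>
    rw [Finset.prod_empty, Ideal.one_eq_top]
    exact Ideal.IsHomogeneous.top 𝒜
  | insert i s hi ih =>
    rw [Finset.prod_insert hi]
    exact (isHomogeneous_pow (isHomogeneous_span_of_le (hH i)) _).mul ih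

theorem isHomogeneous_reesIdeal (hH : ∀ i, H i ≤ 𝒜 (Pi.single i 1)) {a : ℕ} {J : Ideal B}
    (hJ : J.IsHomogeneous 𝒜) (z : ℕ × (Fin p → ℕ)) : (reesIdeal H a J z).IsHomogeneous 𝒜 :=
  ((isHomogeneous_pow (isHomogeneous_sumIdeal hH) _).mul (isHomogeneous_powerIdeal hH _)).mul hJ

theorem isHomogeneous_degreeIdeal (t : Fin p → ℕ) : (degreeIdeal 𝒜 t).IsHomogeneous 𝒜 :=
  Ideal.homogeneous_span _ _ fun _ hx => ⟨t, hx⟩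

theorem isHomogeneous_positiveIdeal : (positiveIdeal 𝒜).IsHomogeneous 𝒜 :=
  Ideal.homogeneous_span _ _ fun _ ⟨v, _, hx⟩ => ⟨v, hx⟩

namespace Presentation

variable (D : Presentation 𝒜 H)

/-- The graded pieces of the ambient module. -/
noncomputable def piece (d : Fin p ⊕ Fin p → ℤ) : Submodule R D.Ambient where
  carrier := {w | ∀ z u, bidegree z u ≠ d → (decompose 𝒜 (D.coef z w) u : B) = 0}
  zero_mem' z u _ := by simp
  add_mem' hw hw' z u h := by
    rw [map_add, decompose_add, DFinsupp.add_apply, Submodule.coe_add, hw z u h, hw' z u h, add_zero]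
  smul_mem' r w hw z u h := by
    rw [map_smul, decompose_smul, DFinsupp.smul_apply, Submodule.coe_smul, hw z u h, smul_zero]

theorem mem_piece {d : Fin p ⊕ Fin p → ℤ} {w : D.Ambient} : w ∈ D.piece d ↔
    ∀ z u, bidegree z u ≠ d → (decompose 𝒜 (D.coef z w) u : B) = 0 := Iff.rfl

theorem mono_mem_piece (z : ℕ × (Fin p → ℕ)) {u : Fin p → ℕ} {b : B} (hb : b ∈ 𝒜 u) :
    D.mono z b ∈ D.piece (bidegree z u) := by
  intro z' u' h
  rw [coef_mono]
  split_ifs with hz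
  · subst hz
    exact decompose_of_mem_ne 𝒜 hb fun h' => h (by rw [h'])
  · simp

theorem mem_of_mono_decompose_mem {M : Type*} [SetLike M D.Ambient] [AddSubmonoidClass M D.Ambient]
    {A : M} {w : D.Ambient}
    (h : ∀ z u, D.mono z (decompose 𝒜 (D.coef z w) u : B) ∈ A) : w ∈ A := by
  classical
  refine D.mem_of_mono_coef_mem fun z => ?_
  rw [← sum_support_decompose 𝒜 (D.coef z w), map_sum]
  exact sum_mem fun u _ => h z u

theorem piece_isInternal : DirectSum.IsInternal D.piece := by
  apply DirectSum.isInternal_submodule_of_iSupIndep_of_iSup_eq_top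
  · intro d
    rw [Submodule.disjoint_def]
    intro w hw hw'
    have h0 : ∀ z u, (decompose 𝒜 (D.coef z w) u : B) = 0 := by
      intro z u
      by_cases h : bidegree z u = d
      swap
      · exact hw z u h
      have hle : ⨆ d', ⨆ (_ : d' ≠ d), D.piece d' ≤
          { carrier := {w | (decompose 𝒜 (D.coef z w) u : B) = 0}
            zero_mem' := by simp
            add_mem' := fun ha hb => by
              rw [Set.mem_ofPred_eq] at ha hb ⊢
              rw [map_add, decompose_add, DFinsupp.add_apply, Submodule.coe_add, ha, hb, add_zero]
            smul_mem' := fun r w hw => by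
              rw [Set.mem_ofPred_eq] at hw ⊢
              rw [map_smul, decompose_smul, DFinsupp.smul_apply, Submodule.coe_smul, hw, smul_zero] } :=
        iSup₂_le fun d' hd' w hw => hw z u (h ▸ hd'.symm)
      exact hle hw'
    rw [← Submodule.mem_bot R]
    refine D.mem_of_mono_decompose_mem fun z u => ?_
    rw [h0, map_zero]
    exact Submodule.zero_mem _
  · rw [eq_top_iff]
    intro w _
    exact D.mem_of_mono_decompose_mem fun z u =>
      Submodule.mem_iSup_of_mem _ (D.mono_mem_piece z (SetLike.coe_mem _))

noncomputable instance : Decomposition D.piece := D.piece_isInternal.chooseDecomposition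

theorem mono_mul_mem_piece {z : ℕ × (Fin p → ℕ)} {u : Fin p → ℕ} {b : B} (hb : b ∈ 𝒜 u)
    {d : Fin p ⊕ Fin p → ℤ} {w : D.Ambient} (hw : w ∈ D.piece d) :
    D.mono z b * w ∈ D.piece (bidegree z u + d) := by
  have h : w ∈ (D.piece (bidegree z u + d)).comap
      (LinearMap.mulLeft R (D.mono z b)) := by
    refine D.mem_of_mono_decompose_mem fun z' u' => ?_
    rw [Submodule.mem_comap, LinearMap.mulLeft_apply, mono_mul_mono]
    by_cases h : bidegree z' u' = d
    · rw [← h, ← bidegree_add]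
      exact D.mono_mem_piece _ (SetLike.mul_mem_graded hb (SetLike.coe_mem _))
    · rw [hw z' u' h, mul_zero, map_zero]
      exact Submodule.zero_mem _
  exact h

theorem isGradedAction_piece : IsGradedAction D.dir D.piece := by
  classical
  intro s d w hw
  rcases s with s | s | s
  · rw [X_inl_smul]
    convert D.mono_mul_mem_piece (z := 0) (D.x_mem s) hw using 2
    funext i
    rcases i with i | i <;> simp [dir, bidegree, Pi.single_apply]
  · rw [X_inr_inl_smul]
    convert D.mono_mul_mem_piece (z := (1, 0)) (D.y_mem s) hw using 2
    funext i
    rcases i with i | i <;> simp [dir, bidegree, Pi.single_apply]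
  · rw [X_inr_inr_smul]
    convert D.mono_mul_mem_piece (z := (0, Pi.single (D.dy s) 1)) (D.y_mem s) hw using 2
    funext i
    rcases i with i | i <;> simp [dir, bidegree, Pi.single_apply]

theorem rees_isHomogeneous (hH : ∀ i, H i ≤ 𝒜 (Pi.single i 1)) {a : ℕ} {J : Ideal B}
    (hJ : J.IsHomogeneous 𝒜) : (D.rees a J).IsHomogeneous D.piece := by
  intro d w hw
  have h1 : ∀ z u, D.mono z (decompose 𝒜 (D.coef z w) u : B) ∈ D.rees a J := fun z u =>
    D.mono_mem_rees (isHomogeneous_reesIdeal hH hJ z u (hw z))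
  have h2 : w ∈ ((D.rees a J).toAddSubmonoid.comap ((D.piece d).toAddSubmonoid.subtype.comp
      ((DFinsupp.evalAddMonoidHom d).comp (decomposeAddEquiv D.piece).toAddMonoidHom))) := by
    refine D.mem_of_mono_decompose_mem fun z u => ?_
    change (decompose D.piece _ d : D.Ambient) ∈ D.rees a J
    by_cases h : bidegree z u = d
    · subst h
      rw [decompose_of_mem_same _ (D.mono_mem_piece z (SetLike.coe_mem _))]
      exact h1 z u
    · rw [decompose_of_mem_ne _ (D.mono_mem_piece z (SetLike.coe_mem _)) h]
      exact Submodule.zero_mem _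
  exact h2

theorem annIdeal_isHomogeneous (hH : ∀ i, H i ≤ 𝒜 (Pi.single i 1)) :
    D.annIdeal.IsHomogeneous (polyPiece (R := R) D.dir) := by
  refine colonIdeal_isHomogeneous D.isGradedAction_piece
    (D.rees_isHomogeneous hH (Ideal.IsHomogeneous.top 𝒜)) (e := bidegree 0 0) ?_
  rw [one_eq_mono]
  exact D.mono_mem_piece _ SetLike.GradedOne.one_mem

/-- An element of degree `d` has homogeneous coefficients. -/
theorem coef_mem_of_mem_piece {z : ℕ × (Fin p → ℕ)} {u : Fin p → ℕ} {w : D.Ambient}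
    (hw : w ∈ D.piece (bidegree z u)) : D.coef z w ∈ 𝒜 u := by
  classical
  rw [← sum_support_decompose 𝒜 (D.coef z w)]
  refine Submodule.sum_mem _ fun u' _ => ?_
  by_cases h : u' = u
  · subst h
    exact SetLike.coe_mem _
  · rw [hw z u' fun h' => h (bidegree_injective h')]
    exact Submodule.zero_mem _

theorem coef_eq_zero_of_mem_piece {z : ℕ × (Fin p → ℕ)} {d : Fin p ⊕ Fin p → ℤ} {w : D.Ambient}
    (hw : w ∈ D.piece d) (h : ∀ u, bidegree z u ≠ d) : D.coef z w = 0 := by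
  classical
  rw [← sum_support_decompose 𝒜 (D.coef z w)]
  exact Finset.sum_eq_zero fun u _ => hw z u (h u)

end Presentation

/-! ### Ideals generated in given degrees -/

/-- The ideal `𝔞` is generated by homogeneous elements whose degrees have `φ`-value in `s`. -/
def GeneratedIn (𝒜 : (Fin p → ℕ) → Submodule R B) (φ : (Fin p → ℕ) →+ ℕ) (s : Set ℕ) (𝔞 : Ideal B) :
    Prop :=
  𝔞 ≤ Ideal.span {b | b ∈ 𝔞 ∧ ∃ u, φ u ∈ s ∧ b ∈ 𝒜 u}

variable {φ : (Fin p → ℕ) →+ ℕ}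

theorem generatedIn_span {S : Set B} {s : Set ℕ} (h : ∀ b ∈ S, ∃ u, φ u ∈ s ∧ b ∈ 𝒜 u) :
    GeneratedIn 𝒜 φ s (Ideal.span S) :=
  Ideal.span_mono fun b hb => ⟨Ideal.subset_span hb, h b hb⟩

theorem GeneratedIn.mul {s s' s'' : Set ℕ} {𝔞 𝔟 : Ideal B} (h : GeneratedIn 𝒜 φ s 𝔞)
    (h' : GeneratedIn 𝒜 φ s' 𝔟) (hs : ∀ a ∈ s, ∀ b ∈ s', a + b ∈ s'') :
    GeneratedIn 𝒜 φ s'' (𝔞 * 𝔟) := by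
  refine (Ideal.mul_mono h h').trans ?_
  rw [Ideal.span_mul_span', Ideal.span_le]
  rintro _ ⟨a, ⟨ha, u, hu, hau⟩, b, ⟨hb, v, hv, hbv⟩, rfl⟩
  exact Ideal.subset_span ⟨Ideal.mul_mem_mul ha hb, u + v, by
    rw [map_add]
    exact hs _ hu _ hv, SetLike.mul_mem_graded hau hbv⟩

theorem generatedIn_one : GeneratedIn 𝒜 φ {0} (1 : Ideal B) := by
  rw [GeneratedIn, Ideal.one_eq_top, top_le_iff, Ideal.eq_top_iff_one]
  exact Ideal.subset_span ⟨trivial, 0, by simp, SetLike.GradedOne.one_mem⟩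

theorem GeneratedIn.pow {e : ℕ} {𝔞 : Ideal B} (h : GeneratedIn 𝒜 φ {e} 𝔞) (k : ℕ) :
    GeneratedIn 𝒜 φ {k * e} (𝔞 ^ k) := by
  induction k with
  | zero =>
    rw [pow_zero, zero_mul]
    exact generatedIn_one
  | succ k ih =>
    rw [pow_succ]
    refine ih.mul h ?_
    rintro _ rfl _ rfl
    rw [add_mul, one_mul]
    exact rfl

theorem GeneratedIn.iSup {ι : Sort*} {s : Set ℕ} {𝔞 : ι → Ideal B}
    (h : ∀ i, GeneratedIn 𝒜 φ s (𝔞 i)) : GeneratedIn 𝒜 φ s (⨆ i, 𝔞 i) :=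
  iSup_le fun i => (h i).trans (Ideal.span_mono fun _ hb => ⟨Ideal.mem_iSup_of_mem i hb.1, hb.2⟩)

theorem generatedIn_span_H (hH : ∀ i, H i ≤ 𝒜 (Pi.single i 1)) (i : Fin p) :
    GeneratedIn 𝒜 φ {φ (Pi.single i 1)} (Ideal.span (H i : Set B)) :=
  generatedIn_span fun _ hb => ⟨_, rfl, hH i hb⟩

theorem generatedIn_powerIdeal (hH : ∀ i, H i ≤ 𝒜 (Pi.single i 1)) (n : Fin p → ℕ) :
    GeneratedIn 𝒜 φ {φ n} (powerIdeal H n) := by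
  classical
  have h1 : φ n = ∑ i, n i * φ (Pi.single i 1) := by
    conv_lhs => rw [← Finset.univ_sum_single n, map_sum]
    refine Finset.sum_congr rfl fun i _ => ?_
    rw [← smul_eq_mul, ← map_nsmul, ← Pi.single_smul, smul_eq_mul, mul_one]
  rw [h1, powerIdeal]
  induction (Finset.univ : Finset (Fin p)) using Finset.induction_on with
  | empty => simpa using generatedIn_one
  | insert i s hi ih =>
    rw [Finset.prod_insert hi, Finset.sum_insert hi]
    refine ((generatedIn_span_H hH i).pow (n i)).mul ih ?_
    rintro _ rfl _ rfl
    exact rfl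

theorem generatedIn_degreeIdeal (t : Fin p → ℕ) : GeneratedIn 𝒜 φ {φ t} (degreeIdeal 𝒜 t) :=
  generatedIn_span fun _ hb => ⟨t, rfl, hb⟩

theorem GeneratedIn.eq_zero {e : ℕ} {𝔞 : Ideal B} (h : GeneratedIn 𝒜 φ (Set.Ici e) 𝔞) {b : B}
    (hb : b ∈ 𝔞) {u : Fin p → ℕ} (hbu : b ∈ 𝒜 u) (hu : φ u < e) : b = 0 := by
  have hb' := h hb
  rw [← decompose_of_mem_same 𝒜 hbu]
  clear hb hbu
  induction hb' using Submodule.closure_induction with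
  | zero => simp
  | add a b _ _ ha hb => rw [decompose_add, DFinsupp.add_apply, Submodule.coe_add, ha, hb, add_zero]
  | smul_mem r g hg =>
    obtain ⟨-, w, hw, hgw⟩ := hg
    rw [smul_eq_mul]
    refine coe_decompose_mul_of_right_mem_of_not_le 𝒜 hgw fun hle => ?_
    obtain ⟨v, rfl⟩ := le_iff_exists_add.1 hle
    rw [map_add] at hu
    rw [Set.mem_Ici] at hw
    omega

/-- The ideal generated by the homogeneous elements whose degrees have positive `φ`-value. -/
def posIdeal (𝒜 : (Fin p → ℕ) → Submodule R B) (φ : (Fin p → ℕ) →+ ℕ) : Ideal B :=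
  Ideal.span {b | ∃ u, φ u ≠ 0 ∧ b ∈ 𝒜 u}

/-- The generators have `φ`-degree exactly `e`, so the excess degree of `b` has to come from the
coefficients. -/
theorem GeneratedIn.mem_posIdeal_mul {e : ℕ} {𝔞 : Ideal B} (h : GeneratedIn 𝒜 φ {e} 𝔞)
    {b : B} (hb : b ∈ 𝔞) {u : Fin p → ℕ} (hbu : b ∈ 𝒜 u) (hu : e < φ u) :
    b ∈ posIdeal 𝒜 φ * 𝔞 := by
  have hb' := h hb
  rw [← decompose_of_mem_same 𝒜 hbu]
  clear hb hbu
  induction hb' using Submodule.closure_induction with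
  | zero => simp
  | add a b _ _ ha hb =>
    rw [decompose_add, DFinsupp.add_apply, Submodule.coe_add]
    exact Ideal.add_mem _ ha hb
  | smul_mem r g hg =>
    obtain ⟨hg, w, rfl, hgw⟩ := hg
    rw [smul_eq_mul]
    by_cases hle : w ≤ u
    · rw [coe_decompose_mul_of_right_mem_of_le 𝒜 hgw hle]
      refine Ideal.mul_mem_mul (Ideal.subset_span ⟨u - w, ?_, SetLike.coe_mem _⟩) hg
      have := tsub_add_cancel_of_le hle
      rw [← this, map_add] at hu
      omega
    · rw [coe_decompose_mul_of_right_mem_of_not_le 𝒜 hgw hle]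
      exact Ideal.zero_mem _

/-! ### Comparing generators of neighbouring degrees -/

namespace Presentation

theorem toAlgebra_monomial_mem (D : Presentation 𝒜 H) (m : Fin D.m →₀ ℕ) (a : R) :
    D.toAlgebra (monomial m a) ∈
      𝒜 (Finsupp.weight (fun s => (Pi.single (D.dx s) 1 : Fin p → ℕ)) m) := by
  rw [toAlgebra, aeval_monomial, ← Algebra.smul_def, Finsupp.weight_apply]
  exact Submodule.smul_mem _ _ (SetLike.prod_mem_graded _ _ _ fun s _ =>
    SetLike.pow_mem_graded _ (D.x_mem s))

theorem mem_of_forall_monomial_mem (D : Presentation 𝒜 H) {u : Fin p → ℕ} {b : B} (hb : b ∈ 𝒜 u)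
    {M : Submodule R B} (h : ∀ (m : Fin D.m →₀ ℕ) (a : R),
      Finsupp.weight (fun s => (Pi.single (D.dx s) 1 : Fin p → ℕ)) m = u →
      D.toAlgebra (monomial m a) ∈ M) : b ∈ M := by
  obtain ⟨f, rfl⟩ := D.toAlgebra_surjective b
  rw [← decompose_of_mem_same 𝒜 hb]
  clear hb
  induction f using MvPolynomial.induction_on' with
  | add f g hf hg =>
    rw [map_add, decompose_add, DFinsupp.add_apply, Submodule.coe_add]
    exact M.add_mem hf hg
  | monomial m a =>
    have hmem := D.toAlgebra_monomial_mem m a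
    by_cases hm : Finsupp.weight (fun s => (Pi.single (D.dx s) 1 : Fin p → ℕ)) m = u
    · rw [hm] at hmem
      rw [decompose_of_mem_same 𝒜 hmem]
      exact h m a hm
    · rw [decompose_of_mem_ne 𝒜 hmem hm]
      exact M.zero_mem

/-- Every element of degree `w + e_i` is a combination of the generators of direction `i` with
coefficients of degree `w`. -/
theorem mem_of_mem_add_single (D : Presentation 𝒜 H) {w : Fin p → ℕ} {i : Fin p} {b : B}
    (hb : b ∈ 𝒜 (w + Pi.single i 1)) {M : Submodule R B}
    (h : ∀ s, D.dx s = i → ∀ c ∈ 𝒜 w, D.x s * c ∈ M) : b ∈ M := by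
  refine D.mem_of_forall_monomial_mem hb fun m a hm => ?_
  have h1 := congrFun hm i
  rw [Finsupp.weight_apply, Finsupp.sum, Finset.sum_apply, Pi.add_apply, Pi.single_eq_same] at h1
  obtain ⟨s, hs, hs2⟩ := Finset.exists_ne_zero_of_sum_ne_zero (h1.trans_ne (Nat.succ_ne_zero _))
  have hsi : D.dx s = i := by
    by_contra hc
    rw [Pi.smul_apply, Pi.single_eq_of_ne (Ne.symm hc), smul_zero] at hs2
    exact hs2 rfl
  have hdec : m = Finsupp.single s 1 + (m - Finsupp.single s 1) := by
    rw [add_tsub_cancel_of_le]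
    simpa using Nat.one_le_iff_ne_zero.2 (Finsupp.mem_support_iff.1 hs)
  generalize m - Finsupp.single s 1 = m' at hdec
  subst hdec
  have h2 : monomial (Finsupp.single s 1 + m') a = X s * monomial m' a := by
    rw [X, monomial_mul, one_mul]
  rw [map_add, Finsupp.weight_single, one_smul, hsi, add_comm] at hm
  rw [h2, map_mul, toAlgebra, aeval_X]
  refine h s hsi _ ?_
  rw [← add_right_cancel hm]
  exact D.toAlgebra_monomial_mem m' a

theorem mem_degreeIdeal_of_le (D : Presentation 𝒜 H) {t u : Fin p → ℕ} (htu : t ≤ u) {b : B}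
    (hb : b ∈ 𝒜 u) : b ∈ degreeIdeal 𝒜 t := by
  obtain ⟨v, rfl⟩ := le_iff_exists_add.1 htu
  obtain ⟨N, hN⟩ : ∃ N, ∑ i, v i = N := ⟨_, rfl⟩
  induction N generalizing v b with
  | zero =>
    have hv : v = 0 := by
      funext i
      exact (Finset.sum_eq_zero_iff.1 hN) i (Finset.mem_univ i)
    subst hv
    rw [add_zero] at hb
    exact Ideal.subset_span hb
  | succ N ih =>
    obtain ⟨i, -, hi⟩ := Finset.exists_ne_zero_of_sum_ne_zero (hN.trans_ne N.succ_ne_zero)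
    have hdec : v = (v - Pi.single i 1) + Pi.single i 1 := by
      rw [tsub_add_cancel_of_le]
      intro j
      rcases eq_or_ne j i with rfl | hj
      · rw [Pi.single_eq_same]
        exact Nat.one_le_iff_ne_zero.2 hi
      · rw [Pi.single_eq_of_ne hj]
        exact Nat.zero_le _
    generalize v - Pi.single i 1 = v' at hdec
    subst hdec
    have hN' : ∑ j, v' j = N := by
      simp only [Pi.add_apply, Finset.sum_add_distrib] at hN
      rw [Finset.sum_pi_single'] at hN
      simp at hN
      omega
    rw [← add_assoc] at hb
    exact D.mem_of_mem_add_single (M := (degreeIdeal 𝒜 t).restrictScalars R) hb fun s _ c hc =>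
      Ideal.mul_mem_left _ _ (ih v' (le_self_add) hc hN')

theorem degreeIdeal_le (D : Presentation 𝒜 H) {t u : Fin p → ℕ} (htu : t ≤ u) :
    degreeIdeal 𝒜 u ≤ degreeIdeal 𝒜 t :=
  Ideal.span_le.2 fun _ hb => D.mem_degreeIdeal_of_le htu hb

theorem posIdeal_mul_degreeIdeal_le (D : Presentation 𝒜 H) (t : Fin p → ℕ) (i : Fin p) :
    posIdeal 𝒜 (Pi.evalAddMonoidHom _ i) * degreeIdeal 𝒜 t ≤ degreeIdeal 𝒜 (t + Pi.single i 1) := by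
  rw [posIdeal, degreeIdeal, Ideal.span_mul_span', Ideal.span_le]
  rintro _ ⟨a, ⟨u, hu, ha⟩, b, hb, rfl⟩
  refine D.mem_degreeIdeal_of_le (u := u + t) ?_ (SetLike.mul_mem_graded ha hb)
  rw [add_comm u]
  refine add_le_add_right (fun j => ?_) t
  rcases eq_or_ne j i with rfl | hj
  · rw [Pi.single_eq_same]
    exact Nat.one_le_iff_ne_zero.2 hu
  · rw [Pi.single_eq_of_ne hj]
    exact Nat.zero_le _

end Presentation

theorem span_H_mul_degreeIdeal_le (hH : ∀ i, H i ≤ 𝒜 (Pi.single i 1)) (t : Fin p → ℕ) (i : Fin p) :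
    Ideal.span (H i : Set B) * degreeIdeal 𝒜 t ≤ degreeIdeal 𝒜 (t + Pi.single i 1) := by
  rw [degreeIdeal, Ideal.span_mul_span', Ideal.span_le]
  rintro _ ⟨a, ha, b, hb, rfl⟩
  refine Ideal.subset_span ?_
  rw [add_comm t]
  exact SetLike.mul_mem_graded (hH i ha) hb

/-- Among `k + 1` factors either one comes from `I` or all come from `K`. -/
theorem sup_pow_succ_le (I K : Ideal B) (k : ℕ) :
    (I ⊔ K) ^ (k + 1) ≤ I * (I ⊔ K) ^ k ⊔ K ^ (k + 1) := by
  induction k with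
  | zero => simp
  | succ k ih =>
    rw [pow_succ' _ (k + 1)]
    refine (Ideal.mul_mono_right ih).trans ?_
    rw [Ideal.mul_sup, mul_left_comm, ← pow_succ', Ideal.sup_mul I K (K ^ (k + 1)), ← pow_succ' K]
    refine sup_le le_sup_left (sup_le (le_sup_of_le_left (Ideal.mul_mono_right ?_)) le_sup_right)
    exact Ideal.pow_right_mono le_sup_right _

theorem mem_sup_of_mem_piece {I K I' K' : Ideal B} (hI : I.IsHomogeneous 𝒜) (hK : K.IsHomogeneous 𝒜)
    {u : Fin p → ℕ} {b : B} (hb : b ∈ 𝒜 u) (hbIK : b ∈ I ⊔ K) (h : ∀ c ∈ 𝒜 u, c ∈ I → c ∈ I')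
    (h' : ∀ c ∈ 𝒜 u, c ∈ K → c ∈ K') : b ∈ I' ⊔ K' := by
  obtain ⟨c, hc, c', hc', rfl⟩ := Submodule.mem_sup.1 hbIK
  rw [← decompose_of_mem_same 𝒜 hb, decompose_add, DFinsupp.add_apply, Submodule.coe_add]
  exact Submodule.add_mem_sup (h _ (SetLike.coe_mem _) (hI u hc)) (h' _ (SetLike.coe_mem _) (hK u hc'))

/-- Here a factor `I` is traded for raising `t` by `e_i`. Write `I = I_i + K` with `K` the sum of
the other `I_j`, and use `I^{k+1} ⊆ I_i I^k + K^{k+1}`. In the first term `I_i ℋ_t ⊆ ℋ_{t+e_i}`. The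
second term is generated in degree `n_i + t_i` of direction `i`, and `b` has larger degree there, so
a coefficient of positive degree in direction `i` is left to move `ℋ_t` into `ℋ_{t+e_i}`. -/
theorem Presentation.mem_reesIdeal_of_mem_one (D : Presentation 𝒜 H)
    (hH : ∀ i, H i ≤ 𝒜 (Pi.single i 1)) {t : Fin p → ℕ} {i : Fin p} {z : ℕ × (Fin p → ℕ)}
    {u : Fin p → ℕ} {b : B} (hb : b ∈ 𝒜 u) (hu : z.2 i + t i < u i)
    (hbz : b ∈ reesIdeal H 1 (degreeIdeal 𝒜 t) z) :
    b ∈ reesIdeal H 0 (degreeIdeal 𝒜 (t + Pi.single i 1)) z := by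
  obtain ⟨k, n⟩ := z
  set K : Ideal B := ⨆ j : {j : Fin p // j ≠ i}, Ideal.span (H j : Set B) with hK
  set I' : Ideal B := Ideal.span (H i : Set B) with hI'
  have hIK : sumIdeal H = I' ⊔ K := by
    apply le_antisymm
    · refine iSup_le fun j => ?_
      by_cases hj : j = i
      · subst hj
        exact le_sup_left
      · exact le_sup_of_le_right (le_iSup (fun j : {j : Fin p // j ≠ i} => Ideal.span (H j : Set B)) ⟨j, hj⟩)
    · exact sup_le (le_iSup (fun j => Ideal.span (H j : Set B)) i)
        (iSup_le fun j => le_iSup (fun j => Ideal.span (H j : Set B)) j.1)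
  have hKh : K.IsHomogeneous 𝒜 := Ideal.IsHomogeneous.iSup fun j => isHomogeneous_span_of_le (hH j)
  have hI'h : I'.IsHomogeneous 𝒜 := isHomogeneous_span_of_le (hH i)
  have h1 : reesIdeal H 1 (degreeIdeal 𝒜 t) (k, n) ≤
      I' * sumIdeal H ^ k * powerIdeal H n * degreeIdeal 𝒜 t ⊔
        K ^ (k + 1) * powerIdeal H n * degreeIdeal 𝒜 t := by
    rw [← Ideal.sup_mul, ← Ideal.sup_mul]
    refine Ideal.mul_mono_left (Ideal.mul_mono_left ?_)
    have := sup_pow_succ_le I' K k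
    rwa [← hIK] at this
  have h2 := mem_sup_of_mem_piece
    (I' := reesIdeal H 0 (degreeIdeal 𝒜 (t + Pi.single i 1)) (k, n))
    (K' := reesIdeal H 0 (degreeIdeal 𝒜 (t + Pi.single i 1)) (k, n))
    (((hI'h.mul (isHomogeneous_pow (isHomogeneous_sumIdeal hH) k)).mul
      (isHomogeneous_powerIdeal hH n)).mul (isHomogeneous_degreeIdeal t))
    (((isHomogeneous_pow hKh (k + 1)).mul (isHomogeneous_powerIdeal hH n)).mul
      (isHomogeneous_degreeIdeal t)) hb (h1 hbz) ?_ ?_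
  · rwa [sup_idem] at h2
  · intro c _ hc
    refine (?_ : I' * sumIdeal H ^ k * powerIdeal H n * degreeIdeal 𝒜 t ≤ _) hc
    have : I' * sumIdeal H ^ k * powerIdeal H n * degreeIdeal 𝒜 t =
      sumIdeal H ^ k * powerIdeal H n * (I' * degreeIdeal 𝒜 t) := by ring
    rw [this, reesIdeal, add_zero]
    exact Ideal.mul_mono_right (span_H_mul_degreeIdeal_le hH t i)
  · intro c hcu hc
    have hKg : GeneratedIn 𝒜 (Pi.evalAddMonoidHom (fun _ => ℕ) i) {0} K := by
      refine GeneratedIn.iSup fun j => ?_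
      have := generatedIn_span_H (φ := Pi.evalAddMonoidHom (fun _ => ℕ) i) hH j
      rwa [Pi.evalAddMonoidHom_apply, Pi.single_eq_of_ne j.2.symm] at this
    have hg : GeneratedIn 𝒜 (Pi.evalAddMonoidHom (fun _ => ℕ) i) {n i + t i}
        (K ^ (k + 1) * powerIdeal H n * degreeIdeal 𝒜 t) := by
      refine ((hKg.pow (k + 1)).mul (generatedIn_powerIdeal hH n) (s'' := {n i}) ?_).mul
        (generatedIn_degreeIdeal t) ?_
      · rintro _ rfl _ rfl
        simp
      · rintro _ rfl _ rfl
        simp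
    have h3 := hg.mem_posIdeal_mul hc hcu hu
    refine (?_ : posIdeal 𝒜 (Pi.evalAddMonoidHom (fun _ => ℕ) i) *
      (K ^ (k + 1) * powerIdeal H n * degreeIdeal 𝒜 t) ≤ _) h3
    have : posIdeal 𝒜 (Pi.evalAddMonoidHom (fun _ => ℕ) i) *
      (K ^ (k + 1) * powerIdeal H n * degreeIdeal 𝒜 t) = K ^ (k + 1) * powerIdeal H n *
        (posIdeal 𝒜 (Pi.evalAddMonoidHom (fun _ => ℕ) i) * degreeIdeal 𝒜 t) := by ring
    rw [this, reesIdeal, add_zero]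
    refine Ideal.mul_mono (Ideal.mul_mono_left ?_) (D.posIdeal_mul_degreeIdeal_le t i)
    refine (Ideal.pow_right_mono (hIK ▸ le_sup_right) _).trans (Ideal.pow_le_pow_right (Nat.le_succ k))

theorem Presentation.mem_reesIdeal_zero_of_mem (D : Presentation 𝒜 H)
    (hH : ∀ i, H i ≤ 𝒜 (Pi.single i 1)) {t : Fin p → ℕ} {i : Fin p} {n : Fin p → ℕ}
    {u : Fin p → ℕ} {b : B} (hb : b ∈ 𝒜 u) (hu : n i + t i < u i)
    (hbz : b ∈ reesIdeal H 0 (degreeIdeal 𝒜 t) (0, n)) :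
    b ∈ reesIdeal H 0 (degreeIdeal 𝒜 (t + Pi.single i 1)) (0, n) := by
  rw [reesIdeal, add_zero, pow_zero, one_mul] at hbz ⊢
  have hg : GeneratedIn 𝒜 (Pi.evalAddMonoidHom (fun _ => ℕ) i) {n i + t i}
      (powerIdeal H n * degreeIdeal 𝒜 t) := by
    refine (generatedIn_powerIdeal hH n).mul (generatedIn_degreeIdeal t) ?_
    rintro _ rfl _ rfl
    simp
  have h3 := hg.mem_posIdeal_mul hbz hb hu
  rw [mul_left_comm] at h3
  exact Ideal.mul_mono_right (D.posIdeal_mul_degreeIdeal_le t i) h3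

variable (p) in
/-- The total degree. -/
def totalDeg : (Fin p → ℕ) →+ ℕ := ∑ i, Pi.evalAddMonoidHom (fun _ => ℕ) i

theorem totalDeg_apply (u : Fin p → ℕ) : totalDeg p u = ∑ i, u i := by
  simp [totalDeg]

theorem totalDeg_single (i : Fin p) : totalDeg p (Pi.single i 1) = 1 := by
  rw [totalDeg_apply, Finset.sum_pi_single']
  simp

theorem generatedIn_reesIdeal (hH : ∀ i, H i ≤ 𝒜 (Pi.single i 1)) (a : ℕ) (t : Fin p → ℕ)
    (z : ℕ × (Fin p → ℕ)) : GeneratedIn 𝒜 (totalDeg p) {z.1 + a + totalDeg p z.2 + totalDeg p t}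
      (reesIdeal H a (degreeIdeal 𝒜 t) z) := by
  have h1 : GeneratedIn 𝒜 (totalDeg p) {1} (sumIdeal H) := by
    refine GeneratedIn.iSup fun j => ?_
    have := generatedIn_span_H (φ := totalDeg p) hH j
    rwa [totalDeg_single] at this
  refine ((h1.pow (z.1 + a)).mul (generatedIn_powerIdeal hH z.2)
    (s'' := {z.1 + a + totalDeg p z.2}) ?_).mul (generatedIn_degreeIdeal t) ?_
  · rintro _ rfl _ rfl
    simp
  · rintro _ rfl _ rfl
    simp

theorem totalDeg_ne_zero {u : Fin p → ℕ} (hu : u ≠ 0) : totalDeg p u ≠ 0 := by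
  rw [totalDeg_apply]
  intro h
  apply hu
  funext i
  exact (Finset.sum_eq_zero_iff.1 h) i (Finset.mem_univ i)

/-- `I^k I^n ℋ_t` is generated in total degree `k + |n| + |t|`. So for homogeneous elements the
factor `B_+` only says that the total degree is larger; `eq_zero_of_mem_reesIdeal_positiveIdeal` is
the other half of this. -/
theorem mem_reesIdeal_positiveIdeal (hH : ∀ i, H i ≤ 𝒜 (Pi.single i 1)) {t : Fin p → ℕ}
    {z : ℕ × (Fin p → ℕ)} {u : Fin p → ℕ} {b : B} (hb : b ∈ 𝒜 u)
    (hu : z.1 + totalDeg p z.2 + totalDeg p t < totalDeg p u)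
    (hbz : b ∈ reesIdeal H 0 (degreeIdeal 𝒜 t) z) :
    b ∈ reesIdeal H 0 (positiveIdeal 𝒜 * degreeIdeal 𝒜 t) z := by
  have h1 := (generatedIn_reesIdeal hH 0 t z).mem_posIdeal_mul hbz hb hu
  rw [reesIdeal, mul_left_comm] at h1
  refine Ideal.mul_mono_right (Ideal.mul_mono_left (Ideal.span_mono ?_)) h1
  rintro b ⟨v, hv, hb⟩
  exact ⟨v, fun h => hv (by rw [h, map_zero]), hb⟩

theorem eq_zero_of_mem_reesIdeal_positiveIdeal (hH : ∀ i, H i ≤ 𝒜 (Pi.single i 1)) {t : Fin p → ℕ}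
    {z : ℕ × (Fin p → ℕ)} {u : Fin p → ℕ} {b : B} (hb : b ∈ 𝒜 u)
    (hu : totalDeg p u ≤ z.1 + totalDeg p z.2 + totalDeg p t)
    (hbz : b ∈ reesIdeal H 0 (positiveIdeal 𝒜 * degreeIdeal 𝒜 t) z) : b = 0 := by
  have h0 : GeneratedIn 𝒜 (totalDeg p) (Set.Ici 1) (positiveIdeal 𝒜) :=
    generatedIn_span fun b ⟨v, hv, hb⟩ => ⟨v, Nat.one_le_iff_ne_zero.2 (totalDeg_ne_zero hv), hb⟩
  have h1 : GeneratedIn 𝒜 (totalDeg p) (Set.Ici (1 + (z.1 + totalDeg p z.2 + totalDeg p t)))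
      (positiveIdeal 𝒜 * reesIdeal H 0 (degreeIdeal 𝒜 t) z) := by
    refine h0.mul (generatedIn_reesIdeal hH 0 t z) ?_
    rintro a ha _ rfl
    rw [Set.mem_Ici] at ha ⊢
    omega
  refine h1.eq_zero ?_ hb (by omega)
  rw [reesIdeal] at hbz ⊢
  rwa [mul_left_comm]

end Grading

end JointBlowup

namespace JointBlowup

open MvPolynomial DirectSum

/-- Torsion and length refer to `R` only, so an `R`-linear map that is an isomorphism of
subquotients in the single degree `d` suffices. This matters for division by `T`, which is not
linear over the polynomial ring. -/
theorem relLength_torsion_eq_of_map {σ τ R W : Type*} [Finite σ] [CommRing R] [IsLocalRing R]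
    [IsNoetherianRing R] [AddCommGroup W]
    [Module R W] [Module (MvPolynomial σ R) W] [IsScalarTower R (MvPolynomial σ R) W]
    {ℳ : (τ → ℤ) → Submodule R W} {A' A B' B : Submodule (MvPolynomial σ R) W} {d : τ → ℤ}
    (f : W →ₗ[R] W) (h1 : ∀ y ∈ A, y ∈ ℳ d → f y ∈ B ∧ f y ∈ ℳ d)
    (h2 : ∀ y ∈ A, y ∈ ℳ d → (f y ∈ B' ↔ y ∈ A'))
    (h3 : ∀ y' ∈ B, y' ∈ ℳ d → ∃ y ∈ A, y ∈ ℳ d ∧ f y - y' ∈ B') :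
    torsionHilb ℳ A' A d = torsionHilb ℳ B' B d := by
  have h4 : ∀ y ∈ A, y ∈ ℳ d → ∀ a : R, (a • f y ∈ B' ↔ a • y ∈ A') := fun y hy hyd a => by
    rw [← map_smul]
    exact h2 _ (smul_mem_of_mem_submodule A a hy) ((ℳ d).smul_mem a hyd)
  refine relLength_eq_of_map f ?_ ?_ ?_
  · rintro y ⟨⟨hy, k, hk⟩, hyd⟩
    exact ⟨⟨(h1 y hy hyd).1, k, fun a ha => (h4 y hy hyd a).2 (hk a ha)⟩, (h1 y hy hyd).2⟩
  · rintro y ⟨⟨hy, k, hk⟩, hyd⟩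
    exact ⟨fun h => ⟨(h2 y hy hyd).1 h.1, hyd⟩, fun h => ⟨(h2 y hy hyd).2 h.1, (h1 y hy hyd).2⟩⟩
  · rintro y' ⟨⟨hy', k, hk⟩, hyd'⟩
    obtain ⟨y, hy, hyd, hyy⟩ := h3 y' hy' hyd'
    refine ⟨y, ⟨⟨hy, k, fun a ha => (h4 y hy hyd a).1 ?_⟩, hyd⟩, hyy,
      (ℳ d).sub_mem (h1 y hy hyd).2 hyd'⟩
    have h5 := B'.add_mem (smul_mem_of_mem_submodule B' a hyy) (hk a ha)
    rwa [smul_sub, sub_add_cancel] at h5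

theorem exists_mem_piece_of_mem_sup {σ τ R W : Type*} [CommRing R] [Fintype τ] [DecidableEq τ] [AddCommGroup W]
    [Module R W] [Module (MvPolynomial σ R) W] [IsScalarTower R (MvPolynomial σ R) W]
    {ℳ : (τ → ℤ) → Submodule R W} [Decomposition ℳ] {A B : Submodule (MvPolynomial σ R) W}
    (hA : A.IsHomogeneous ℳ) (hB : B.IsHomogeneous ℳ) {d : τ → ℤ} {w : W} (hw : w ∈ ℳ d)
    (hwAB : w ∈ A ⊔ B) : ∃ a ∈ A, a ∈ ℳ d ∧ ∃ b ∈ B, b ∈ ℳ d ∧ a + b = w := by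
  obtain ⟨a, ha, b, hb, rfl⟩ := Submodule.mem_sup.1 hwAB
  refine ⟨_, hA d ha, SetLike.coe_mem _, _, hB d hb, SetLike.coe_mem _, ?_⟩
  rw [← Submodule.coe_add, ← DFinsupp.add_apply, ← decompose_add, decompose_of_mem_same _ hw]

theorem sup_isHomogeneous {σ τ R W : Type*} [CommRing R] [Fintype τ] [DecidableEq τ] [AddCommGroup W]
    [Module R W] [Module (MvPolynomial σ R) W] [IsScalarTower R (MvPolynomial σ R) W]
    {ℳ : (τ → ℤ) → Submodule R W} [Decomposition ℳ] {A B : Submodule (MvPolynomial σ R) W}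
    (hA : A.IsHomogeneous ℳ) (hB : B.IsHomogeneous ℳ) : (A ⊔ B).IsHomogeneous ℳ := by
  intro d w hw
  obtain ⟨a, ha, b, hb, rfl⟩ := Submodule.mem_sup.1 hw
  rw [decompose_add, DFinsupp.add_apply, Submodule.coe_add]
  exact Submodule.add_mem_sup (hA d ha) (hB d hb)

/-! ### Comparison of the Hilbert functions for `t` and `t + e_i` -/

section Comparison

variable {p : ℕ} {R B : Type*} [CommRing R] [CommRing B] [Algebra R B]
  {𝒜 : (Fin p → ℕ) → Submodule R B} [GradedAlgebra 𝒜] {H : Fin p → Submodule R B}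

theorem sumIdeal_le_positiveIdeal (hH : ∀ i, H i ≤ 𝒜 (Pi.single i 1)) :
    sumIdeal H ≤ positiveIdeal 𝒜 :=
  iSup_le fun i => Ideal.span_mono fun _ hb => ⟨_, by simp, hH i hb⟩

namespace Presentation

variable (D : Presentation 𝒜 H)

/-- The Rees module of the ideal `ℋ_t`. -/
noncomputable def reesZero (t : Fin p → ℕ) : Submodule (MvPolynomial D.Vars R) D.Ambient :=
  D.rees 0 (degreeIdeal 𝒜 t)

/-- The product of the Rees module of `ℋ_t` with `I`. -/
noncomputable def reesOne (t : Fin p → ℕ) : Submodule (MvPolynomial D.Vars R) D.Ambient :=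
  D.rees 1 (degreeIdeal 𝒜 t)

/-- The product of the Rees module of `ℋ_t` with `B_+`. -/
noncomputable def reesPos (t : Fin p → ℕ) : Submodule (MvPolynomial D.Vars R) D.Ambient :=
  D.rees 0 (positiveIdeal 𝒜 * degreeIdeal 𝒜 t)

theorem reesPos_le (t : Fin p → ℕ) : D.reesPos t ≤ D.reesZero t := D.rees_mono le_rfl Ideal.mul_le_right

theorem reesPos_fg [IsNoetherianRing R] (t : Fin p → ℕ) : (D.reesPos t).FG := D.rees_fg _

/-- Dropping the constant term in `T` and dividing by `T`. -/
noncomputable def lower : D.Ambient →ₗ[R] D.Ambient where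
  toFun w := AddMonoidAlgebra.ofCoeff (Finsupp.comapDomain (fun z => ((1, 0) : ℕ × (Fin p → ℕ)) + z)
    (AddMonoidAlgebra.coeff w) (add_right_injective _).injOn)
  map_add' _ _ := D.ext_coef fun _ => rfl
  map_smul' _ _ := D.ext_coef fun _ => rfl

theorem coef_lower (w : D.Ambient) (z : ℕ × (Fin p → ℕ)) : D.coef z (D.lower w) = D.coef ((1, 0) + z) w :=
  rfl

/-- Multiplication by `T`. -/
noncomputable def raise (w : D.Ambient) : D.Ambient := D.mono (1, 0) 1 * w

theorem coef_raise (w : D.Ambient) (z : ℕ × (Fin p → ℕ)) : D.coef ((1, 0) + z) (D.raise w) = D.coef z w := by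
  have h := AddMonoidAlgebra.coeff_single_mul_add (R := B) w 1 ((1, 0) : ℕ × (Fin p → ℕ)) z
  rw [one_mul] at h
  exact h

theorem coef_raise_zero (w : D.Ambient) (n : Fin p → ℕ) : D.coef (0, n) (D.raise w) = 0 := by
  refine AddMonoidAlgebra.coeff_single_mul_of_forall_add_ne (R := B) (1 : B) w fun z hz => ?_
  have := congrArg Prod.fst hz
  rw [Prod.fst_add] at this
  simp at this

theorem lower_raise (w : D.Ambient) : D.lower (D.raise w) = w :=
  D.ext_coef fun z => by rw [coef_lower, coef_raise]

theorem bidegree_one_zero_add (z : ℕ × (Fin p → ℕ)) (u : Fin p → ℕ) :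
    bidegree ((1, 0) + z) u = bidegree z u := by
  simp [bidegree]

theorem lower_mem_piece {d : Fin p ⊕ Fin p → ℤ} {w : D.Ambient} (hw : w ∈ D.piece d) :
    D.lower w ∈ D.piece d := fun z u h => by
  rw [coef_lower]
  exact hw _ u (by rwa [bidegree_one_zero_add])

theorem raise_mem_piece {d : Fin p ⊕ Fin p → ℤ} {w : D.Ambient} (hw : w ∈ D.piece d) :
    D.raise w ∈ D.piece d := by
  rintro ⟨k, n⟩ u h
  rcases k with _ | k
  · rw [coef_raise_zero]
    simp
  · have hz : ((k + 1, n) : ℕ × (Fin p → ℕ)) = (1, 0) + (k, n) := by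
      rw [Prod.mk_add_mk, zero_add, add_comm]
    rw [hz] at h ⊢
    rw [coef_raise]
    exact hw _ u (by rwa [bidegree_one_zero_add] at h)

theorem coef_eq_zero_or {d : Fin p ⊕ Fin p → ℤ} {w : D.Ambient} (hw : w ∈ D.piece d)
    (z : ℕ × (Fin p → ℕ)) : D.coef z w = 0 ∨ ∃ u, bidegree z u = d ∧ D.coef z w ∈ 𝒜 u := by
  by_cases h : ∃ u, bidegree z u = d
  · obtain ⟨u, hu⟩ := h
    exact Or.inr ⟨u, hu, D.coef_mem_of_mem_piece (hu ▸ hw)⟩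
  · push Not at h
    exact Or.inl (D.coef_eq_zero_of_mem_piece hw h)

variable {D} in
theorem reesIdeal_one_eq (J : Ideal B) (z : ℕ × (Fin p → ℕ)) :
    reesIdeal H 0 J ((1, 0) + z) = reesIdeal H 1 J z := by
  simp only [reesIdeal, Prod.fst_add, Prod.snd_add, zero_add, add_zero, add_comm]

variable (hH : ∀ i, H i ≤ 𝒜 (Pi.single i 1))

include hH

theorem reesOne_le (t : Fin p → ℕ) : D.reesOne t ≤ D.reesPos t := by
  intro w hw z
  refine (?_ : reesIdeal H 1 (degreeIdeal 𝒜 t) z ≤ _) (hw z)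
  rw [reesIdeal, reesIdeal, pow_succ, add_zero]
  have : sumIdeal H ^ z.1 * sumIdeal H * powerIdeal H z.2 * degreeIdeal 𝒜 t =
    sumIdeal H ^ z.1 * powerIdeal H z.2 * (sumIdeal H * degreeIdeal 𝒜 t) := by ring
  rw [this]
  exact Ideal.mul_mono_right (Ideal.mul_mono_left (sumIdeal_le_positiveIdeal hH))

theorem reesZero_isHomogeneous (t : Fin p → ℕ) : (D.reesZero t).IsHomogeneous D.piece :=
  D.rees_isHomogeneous hH (isHomogeneous_degreeIdeal t)

theorem reesOne_isHomogeneous (t : Fin p → ℕ) : (D.reesOne t).IsHomogeneous D.piece :=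
  D.rees_isHomogeneous hH (isHomogeneous_degreeIdeal t)

theorem reesPos_isHomogeneous (t : Fin p → ℕ) : (D.reesPos t).IsHomogeneous D.piece :=
  D.rees_isHomogeneous hH (isHomogeneous_positiveIdeal.mul (isHomogeneous_degreeIdeal t))

theorem smul_mem_reesOne (t : Fin p → ℕ) {f : MvPolynomial D.Vars R} (hf : f ∈ D.annIdeal)
    {w : D.Ambient} (hw : w ∈ D.reesPos t) : f • w ∈ D.reesOne t :=
  D.smul_mem_of_mem_annIdeal hf (D.reesPos_le t hw)

/-- In these degrees `reesZero (t + e_i) ⊔ reesOne t` is therefore no larger than `reesZero (t +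
e_i)`. -/
theorem mem_reesZero_of_mem_reesOne {t : Fin p → ℕ} {i : Fin p} {d : Fin p ⊕ Fin p → ℤ}
    (hd : (t i : ℤ) < d (Sum.inl i)) {w : D.Ambient} (hwd : w ∈ D.piece d) (hw : w ∈ D.reesOne t) :
    w ∈ D.reesZero (t + Pi.single i 1) := by
  intro z
  rcases D.coef_eq_zero_or hwd z with h | ⟨u, rfl, hu⟩
  · rw [h]
    exact Ideal.zero_mem _
  · refine D.mem_reesIdeal_of_mem_one hH hu ?_ (hw z)
    simp only [bidegree, Sum.elim_inl] at hd
    omega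

/-- Division by `T` lowers `k` by one while `|t|` grows by one. The threshold `k + |n| + |t|`, which
expresses the factor `B_+`, is thus unchanged. -/
theorem lower_mem {t : Fin p → ℕ} {i : Fin p} {d : Fin p ⊕ Fin p → ℤ}
    (hd : (t i : ℤ) < d (Sum.inl i)) {w : D.Ambient} (hwd : w ∈ D.piece d) (hw : w ∈ D.reesPos t) :
    D.lower w ∈ D.reesPos (t + Pi.single i 1) ⊓ D.reesOne t := by
  have h1 : D.lower w ∈ D.reesOne t := fun z => by
    rw [coef_lower, ← reesIdeal_one_eq]
    exact D.reesPos_le t hw _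
  have h2 := D.mem_reesZero_of_mem_reesOne hH hd (D.lower_mem_piece hwd) h1
  refine ⟨fun z => ?_, h1⟩
  rw [coef_lower]
  rcases D.coef_eq_zero_or hwd ((1, 0) + z) with h | ⟨u, rfl, hu⟩
  · rw [h]
    exact Ideal.zero_mem _
  · by_cases hc : D.coef ((1, 0) + z) w = 0
    · rw [hc]
      exact Ideal.zero_mem _
    refine mem_reesIdeal_positiveIdeal hH hu ?_ (h2 z)
    by_contra hlt
    refine hc (eq_zero_of_mem_reesIdeal_positiveIdeal hH hu ?_ (hw _))
    rw [map_add, totalDeg_single] at hlt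
    simp only [Prod.fst_add, Prod.snd_add, zero_add]
    omega

/-- The constant term in `T`, which `lower` forgets, imposes no condition: in these degrees it lies
in `I^n ℋ_{t+e_i}` automatically. -/
theorem lower_mem_reesOne_iff {t : Fin p → ℕ} {i : Fin p} {d : Fin p ⊕ Fin p → ℤ}
    (hd : (t i : ℤ) < d (Sum.inl i)) {w : D.Ambient} (hwd : w ∈ D.piece d) (hw : w ∈ D.reesPos t) :
    D.lower w ∈ D.reesOne (t + Pi.single i 1) ↔
      w ∈ D.reesPos t ⊓ (D.reesZero (t + Pi.single i 1) ⊔ D.reesOne t) := by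
  constructor
  · intro h
    refine ⟨hw, Submodule.mem_sup_left ?_⟩
    rintro ⟨k, n⟩
    rcases k with _ | k
    · rcases D.coef_eq_zero_or hwd (0, n) with h0 | ⟨u, rfl, hu⟩
      · rw [h0]
        exact Ideal.zero_mem _
      · refine D.mem_reesIdeal_zero_of_mem hH hu ?_ (D.reesPos_le t hw _)
        simp only [bidegree, Sum.elim_inl] at hd
        omega
    · have hz : ((k + 1, n) : ℕ × (Fin p → ℕ)) = (1, 0) + (k, n) := by
        rw [Prod.mk_add_mk, zero_add, add_comm]
      rw [hz, reesIdeal_one_eq]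
      exact h (k, n)
  · rintro ⟨-, h⟩
    obtain ⟨a, ha, had, b, hb, hbd, rfl⟩ := exists_mem_piece_of_mem_sup
      (D.reesZero_isHomogeneous hH _) (D.reesOne_isHomogeneous hH _) hwd h
    have h1 := (D.reesZero _).add_mem ha (D.mem_reesZero_of_mem_reesOne hH hd hbd hb)
    intro z
    rw [coef_lower, ← reesIdeal_one_eq]
    exact h1 _

/-- Gives the surjectivity of division by `T`; the total-degree threshold is again the same on both
sides. -/
theorem raise_mem {t : Fin p → ℕ} {i : Fin p} {d : Fin p ⊕ Fin p → ℤ} {w : D.Ambient}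
    (hwd : w ∈ D.piece d) (hw : w ∈ D.reesPos (t + Pi.single i 1) ⊓ D.reesOne t) :
    D.raise w ∈ D.reesPos t := by
  rintro ⟨k, n⟩
  rcases k with _ | k
  · rw [coef_raise_zero]
    exact Ideal.zero_mem _
  · have hz : ((k + 1, n) : ℕ × (Fin p → ℕ)) = (1, 0) + (k, n) := by
      rw [Prod.mk_add_mk, zero_add, add_comm]
    rw [hz, coef_raise]
    rcases D.coef_eq_zero_or hwd (k, n) with h | ⟨u, rfl, hu⟩
    · rw [h]
      exact Ideal.zero_mem _
    · by_cases hc : D.coef (k, n) w = 0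
      · rw [hc]
        exact Ideal.zero_mem _
      refine mem_reesIdeal_positiveIdeal hH hu ?_ ?_
      · by_contra hlt
        refine hc (eq_zero_of_mem_reesIdeal_positiveIdeal hH hu ?_ (hw.1 _))
        rw [map_add, totalDeg_single]
        simp only [Prod.fst_add, Prod.snd_add, zero_add] at hlt
        dsimp only
        omega
      · rw [reesIdeal_one_eq]
        exact hw.2 _

variable [IsLocalRing R] [IsNoetherianRing R]

/-- The Hilbert function of the `𝔪`-torsion of `B_+ 𝔊` for the module `ℋ_t`. -/
noncomputable def sharpHilb (_ : ∀ i, H i ≤ 𝒜 (Pi.single i 1)) (t : Fin p → ℕ) :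
    (Fin p ⊕ Fin p → ℤ) → ℕ∞ :=
  torsionHilb D.piece (D.reesOne t) (D.reesPos t)

theorem evPoly_sharpHilb {r : ℕ} (hr : RelevantBound D.dir r D.annIdeal) (t : Fin p → ℕ) :
    EvPoly r (D.sharpHilb hH t) :=
  evPoly_torsionHilb D.isGradedAction_piece (D.reesOne_isHomogeneous hH t)
    (D.reesPos_isHomogeneous hH t) (D.reesOne_le hH t) (D.reesPos_fg t) hr
    fun _ hf _ hw => D.smul_mem_reesOne hH t hf hw

/-- The Hilbert functions for `t` and `t + e_i` differ by an eventually polynomial function with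
nonnegative leading coefficients, up to terms of lower degree. -/
theorem sharpHilb_single {r : ℕ} (hr : RelevantBound D.dir (r + 1) D.annIdeal) (t : Fin p → ℕ)
    (i : Fin p) : ∃ c c' e : (Fin p ⊕ Fin p → ℤ) → ℕ∞, EvPoly r c ∧ EvPoly r c' ∧ EvPoly (r + 1) e ∧
      ∃ N : ℤ, ∀ d, (∀ j, N ≤ d j) →
        D.sharpHilb hH t d + c d = D.sharpHilb hH (t + Pi.single i 1) d + c' d + e d := by
  set t' := t + Pi.single i 1 with ht'
  have htt' : t ≤ t' := le_self_add
  have hg := D.isGradedAction_piece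
  have h1 := D.reesOne_isHomogeneous hH t
  have h1' := D.reesOne_isHomogeneous hH t'
  have hP := D.reesPos_isHomogeneous hH t
  have hP' := D.reesPos_isHomogeneous hH t'
  have hZ' := D.reesZero_isHomogeneous hH t'
  have hle1 := D.reesOne_le hH t
  have hle1' := D.reesOne_le hH t'
  have hPP : D.reesPos t' ≤ D.reesPos t :=
    D.rees_mono le_rfl (Ideal.mul_mono_right (D.degreeIdeal_le htt'))
  have h11 : D.reesOne t' ≤ D.reesOne t := D.rees_mono le_rfl (D.degreeIdeal_le htt')
  -- The filtration `One t ⊆ A₁ ⊆ A₂ ⊆ Pos t`: its outer factors are those of `One t' ⊆ Pos t' ⊓ One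
  -- t ⊆ Pos t'`, and `A₂ / A₁` is the excess.
  set A₁ := D.reesPos t' ⊔ D.reesOne t with hA₁
  set A₂ := D.reesPos t ⊓ (D.reesZero t' ⊔ D.reesOne t) with hA₂
  have hA₁h : A₁.IsHomogeneous D.piece := sup_isHomogeneous hP' h1
  have hA₂h : A₂.IsHomogeneous D.piece := fun d w hw => ⟨hP d hw.1, sup_isHomogeneous hZ' h1 d hw.2⟩
  have hle2 : A₁ ≤ A₂ := le_inf (sup_le hPP hle1) (sup_le_sup_right (D.reesPos_le t') _)
  have hle3 : A₂ ≤ D.reesPos t := inf_le_left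
  have hinf : (D.reesPos t' ⊓ D.reesOne t).IsHomogeneous D.piece := fun d w hw => ⟨hP' d hw.1, h1 d hw.2⟩
  have hann := D.annIdeal_isHomogeneous hH
  obtain ⟨c₁, hc₁, hc₁'⟩ := torsionHilb_add hg h1 hA₁h hP le_sup_right (hle2.trans hle3)
    (D.reesPos_fg t) hann hr fun f hf w hw => D.smul_mem_reesOne hH t hf hw
  obtain ⟨c₂, hc₂, hc₂'⟩ := torsionHilb_add hg hA₁h hA₂h hP hle2 hle3
    (D.reesPos_fg t) hann hr fun f hf w hw =>
      (le_sup_right : _ ≤ A₁) (D.smul_mem_reesOne hH t hf hw)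
  obtain ⟨c₃, hc₃, hc₃'⟩ := torsionHilb_add hg h1' hinf hP' (le_inf hle1' h11) inf_le_left
    (D.reesPos_fg t') hann hr fun f hf w hw => D.smul_mem_reesOne hH t' hf hw
  have he : EvPoly (r + 1) (torsionHilb D.piece A₁ A₂) :=
    evPoly_torsionHilb hg hA₁h hA₂h hle2 (fg_of_le (D.reesPos_fg t) hle3) hr fun f hf w hw =>
      (le_sup_right : _ ≤ A₁) (D.smul_mem_reesOne hH t hf (hle3 hw))
  -- From `t i + 1` on, the component of `d` in direction `i` exceeds `t i`, as division by `T`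
  -- requires.
  refine ⟨_, c₃, _, hc₁.add hc₂, hc₃, he, t i + 1, fun d hd => ?_⟩
  have hd' : (t i : ℤ) < d (Sum.inl i) := by
    have := hd (Sum.inl i)
    omega
  -- Second isomorphism theorem.
  have hT1 : torsionHilb D.piece (D.reesPos t' ⊓ D.reesOne t) (D.reesPos t') d =
      torsionHilb D.piece (D.reesOne t) A₁ d := by
    refine relLength_torsion_eq_of_map LinearMap.id
      (fun y hy hyd => ⟨Submodule.mem_sup_left hy, hyd⟩)
      (fun y hy _ => ⟨fun h => ⟨hy, h⟩, fun h => h.2⟩) fun y' hy' hyd' => ?_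
    obtain ⟨a, ha, had, b, hb, hbd, rfl⟩ := exists_mem_piece_of_mem_sup hP' h1 hyd' hy'
    refine ⟨a, ha, had, ?_⟩
    rw [LinearMap.id_apply, sub_add_cancel_left]
    exact Submodule.neg_mem _ hb
  -- Division by `T`, with multiplication by `T` as a section.
  have hT3 : torsionHilb D.piece A₂ (D.reesPos t) d =
      torsionHilb D.piece (D.reesOne t') (D.reesPos t' ⊓ D.reesOne t) d := by
    refine relLength_torsion_eq_of_map D.lower
      (fun y hy hyd => ⟨D.lower_mem hH hd' hyd hy, D.lower_mem_piece hyd⟩)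
      (fun y hy hyd => D.lower_mem_reesOne_iff hH hd' hyd hy) fun y' hy' hyd' => ?_
    refine ⟨D.raise y', D.raise_mem hH hyd' hy', D.raise_mem_piece hyd', ?_⟩
    rw [lower_raise, sub_self]
    exact Submodule.zero_mem _
  calc D.sharpHilb hH t d + (c₁ d + c₂ d) = (D.sharpHilb hH t d + c₁ d) + c₂ d := (add_assoc _ _ _).symm
    _ = torsionHilb D.piece (D.reesOne t) A₁ d + (torsionHilb D.piece A₁ (D.reesPos t) d + c₂ d) := by
      rw [sharpHilb, ← hc₁', add_assoc]
    _ = torsionHilb D.piece (D.reesOne t') (D.reesPos t' ⊓ D.reesOne t) d +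
        torsionHilb D.piece (D.reesPos t' ⊓ D.reesOne t) (D.reesPos t') d +
        torsionHilb D.piece A₁ A₂ d := by
      rw [← hc₂', hT3, hT1]
      ring
    _ = _ := by rw [hc₃', sharpHilb]

theorem sharpHilb_le {r : ℕ} (hr : RelevantBound D.dir (r + 1) D.annIdeal) {t t' : Fin p → ℕ}
    (htt' : t ≤ t') : ∃ c c' e : (Fin p ⊕ Fin p → ℤ) → ℕ∞, EvPoly r c ∧ EvPoly r c' ∧
      EvPoly (r + 1) e ∧ ∃ N : ℤ, ∀ d, (∀ j, N ≤ d j) →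
        D.sharpHilb hH t d + c d = D.sharpHilb hH t' d + c' d + e d := by
  obtain ⟨v, rfl⟩ := le_iff_exists_add.1 htt'
  obtain ⟨M, hM⟩ : ∃ M, ∑ i, v i = M := ⟨_, rfl⟩
  induction M generalizing v with
  | zero =>
    have hv : v = 0 := by
      funext i
      exact (Finset.sum_eq_zero_iff.1 hM) i (Finset.mem_univ i)
    subst hv
    have h0 : EvPoly 0 (fun _ : Fin p ⊕ Fin p → ℤ => (0 : ℕ∞)) := evPoly_zero 0 fun _ _ => rfl
    exact ⟨_, _, _, h0.mono (Nat.zero_le _), h0.mono (Nat.zero_le _), h0.mono (Nat.zero_le _), 0,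
      fun d _ => by simp⟩
  | succ M ih =>
    obtain ⟨i, -, hi⟩ := Finset.exists_ne_zero_of_sum_ne_zero (hM.trans_ne M.succ_ne_zero)
    have hdec : v = (v - Pi.single i 1) + Pi.single i 1 := by
      rw [tsub_add_cancel_of_le]
      intro j
      rcases eq_or_ne j i with rfl | hj
      · rw [Pi.single_eq_same]
        exact Nat.one_le_iff_ne_zero.2 hi
      · rw [Pi.single_eq_of_ne hj]
        exact Nat.zero_le _
    generalize v - Pi.single i 1 = v' at hdec
    subst hdec
    have hM' : ∑ j, v' j = M := by
      simp only [Pi.add_apply, Finset.sum_add_distrib] at hM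
      rw [Finset.sum_pi_single'] at hM
      simp at hM
      omega
    obtain ⟨c, c', e, hc, hc', he, N, hN⟩ := ih v' le_self_add hM'
    obtain ⟨k, k', l, hk, hk', hl, N', hN'⟩ := D.sharpHilb_single hH hr (t + v') i
    refine ⟨_, _, _, hc.add hk, hc'.add hk', he.add hl, max N N', fun d hd => ?_⟩
    have e1 := hN d fun j => (le_max_left _ _).trans (hd j)
    have e2 := hN' d fun j => (le_max_right _ _).trans (hd j)
    rw [← add_assoc t]
    calc D.sharpHilb hH t d + (c d + k d) = (D.sharpHilb hH t d + c d) + k d := (add_assoc _ _ _).symm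
      _ = (D.sharpHilb hH (t + v') d + k d) + c' d + e d := by rw [e1]; ring
      _ = _ := by rw [e2]; ring

end Presentation

end Comparison

end JointBlowup

namespace JointBlowup

open MvPolynomial DirectSum

/-! ### Identification with the graded modules of the definition -/

section Identification

variable {p : ℕ} {R B : Type*} [CommRing R] [CommRing B] [Algebra R B]
  {𝒜 : (Fin p → ℕ) → Submodule R B} [GradedAlgebra 𝒜] {H : Fin p → Submodule R B}

theorem mem_of_forall_decompose_eq_zero {b : B} {u : Fin p → ℕ}
    (h : ∀ u', u' ≠ u → (decompose 𝒜 b u' : B) = 0) : b ∈ 𝒜 u := by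
  classical
  rw [← sum_support_decompose 𝒜 b]
  refine Submodule.sum_mem _ fun u' _ => ?_
  by_cases hu : u' = u
  · subst hu
    exact SetLike.coe_mem _
  · rw [h u' hu]
    exact Submodule.zero_mem _

theorem mem_intGrading_iff {b : B} {v : Fin p → ℤ} : b ∈ intGrading 𝒜 v ↔
    ∀ u : Fin p → ℕ, (fun i => (u i : ℤ)) ≠ v → (decompose 𝒜 b u : B) = 0 := by
  classical
  unfold intGrading
  split_ifs with hv
  · constructor
    · intro hb u hu
      refine decompose_of_mem_ne 𝒜 hb fun h => hu ?_
      funext i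
      rw [← h]
      exact Int.toNat_of_nonneg (hv i)
    · intro h
      refine mem_of_forall_decompose_eq_zero fun u hu => h u fun h' => hu ?_
      rw [← h']
      funext i
      simp
  · constructor
    · intro hb u _
      rw [(Submodule.mem_bot R).1 hb]
      simp
    · intro h
      rw [Submodule.mem_bot, ← sum_support_decompose 𝒜 b]
      refine Finset.sum_eq_zero fun u _ => h u ?_
      rintro rfl
      exact hv fun i => Int.natCast_nonneg _

theorem mem_reesModule {J : Ideal B} {u : ℕ × (Fin p → ℕ) →₀ J} :
    u ∈ reesModule H J ↔ ∀ z, (u z : B) ∈ reesIdeal H 0 J z := by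
  refine forall_congr' fun z => ?_
  rw [Submodule.mem_smul_top_iff, reesIdeal, add_zero]
  rfl

theorem single_mem_reesModule {J : Ideal B} {z : ℕ × (Fin p → ℕ)} {m : J}
    (hm : (m : B) ∈ reesIdeal H 0 J z) : Finsupp.single z m ∈ reesModule H J := by
  classical
  refine mem_reesModule.2 fun z' => ?_
  rw [Finsupp.single_apply]
  split_ifs with hz
  · exact hz ▸ hm
  · exact Ideal.zero_mem _

theorem mem_ambientPiece {M : Type*} [AddCommGroup M] [Module R M] {ℳ : (Fin p → ℤ) → Submodule R M}
    {v : Fin p → ℤ} {n : Fin p → ℕ} {u : ℕ × (Fin p → ℕ) →₀ M} :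
    u ∈ ambientPiece ℳ v n ↔
      ∀ z, u z ∈ if z.2 = n then ℳ (fun i => v i + (n i : ℤ)) else ⊥ := Iff.rfl

theorem mem_smul_reesModule_iff {J : Ideal B} (𝔟 : Ideal B) (u : reesModule H J) :
    u ∈ 𝔟 • (⊤ : Submodule B (reesModule H J)) ↔
      ∀ z, ((u : ℕ × (Fin p → ℕ) →₀ J) z : B) ∈ 𝔟 * reesIdeal H 0 J z := by
  constructor
  · intro hu z
    induction hu using Submodule.smul_induction_on' with
    | smul b hb u _ =>
      refine Ideal.mul_mem_mul hb ?_
      exact mem_reesModule.1 u.2 z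
    | add u _ v _ hu hv => exact Ideal.add_mem _ hu hv
  · intro h
    have h1 : ∀ z, ∃ w ∈ 𝔟 • (⊤ : Submodule B (reesModule H J)),
        (w : ℕ × (Fin p → ℕ) →₀ J) = Finsupp.single z ((u : ℕ × (Fin p → ℕ) →₀ J) z) := by
      intro z
      have h2 : ((u : ℕ × (Fin p → ℕ) →₀ J) z) ∈
          𝔟 • ((sumIdeal H ^ z.1 * powerIdeal H z.2) • (⊤ : Submodule B J)) := by
        rw [← Submodule.mul_smul, Submodule.mem_smul_top_iff]
        simpa [reesIdeal, mul_assoc] using h z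
      generalize (u : ℕ × (Fin p → ℕ) →₀ J) z = m at h2
      induction h2 using Submodule.smul_induction_on' with
      | smul b hb m hm =>
        have hm' : (m : B) ∈ reesIdeal H 0 J z := by
          rw [Submodule.mem_smul_top_iff] at hm
          rw [reesIdeal, add_zero]
          exact hm
        exact ⟨b • ⟨_, single_mem_reesModule hm'⟩, Submodule.smul_mem_smul hb trivial,
          Finsupp.smul_single b z m⟩
      | add m _ m' _ hm hm' =>
        obtain ⟨w, hw, hwm⟩ := hm
        obtain ⟨w', hw', hwm'⟩ := hm'
        exact ⟨w + w', Submodule.add_mem _ hw hw', by rw [Submodule.coe_add, hwm, hwm', Finsupp.single_add]⟩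
    choose w hw hwu using h1
    have h3 : u = ∑ z ∈ (u : ℕ × (Fin p → ℕ) →₀ J).support, w z := by
      apply Subtype.ext
      rw [AddSubmonoidClass.coe_finsetSum, Finset.sum_congr rfl fun z _ => hwu z]
      exact (Finsupp.sum_single _).symm
    rw [h3]
    exact Submodule.sum_mem _ fun z _ => hw z

namespace Presentation

variable (D : Presentation 𝒜 H)

/-- The inclusion of `J[T, T_1, …, T_p]` into `B[T, T_1, …, T_p]`. -/
noncomputable def incl (J : Ideal B) : (ℕ × (Fin p → ℕ) →₀ J) →ₗ[R] D.Ambient where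
  toFun u := AddMonoidAlgebra.ofCoeff (Finsupp.mapRange.linearMap (J.subtype.restrictScalars R) u)
  map_add' u v := by
    rw [map_add]
    rfl
  map_smul' a u := by
    rw [map_smul]
    rfl

theorem coef_incl {J : Ideal B} (u : ℕ × (Fin p → ℕ) →₀ J) (z : ℕ × (Fin p → ℕ)) :
    D.coef z (D.incl J u) = u z := rfl

theorem incl_injective (J : Ideal B) : Function.Injective (D.incl J) := by
  intro u v h
  ext z
  rw [← D.coef_incl, h, D.coef_incl]

theorem incl_mem_rees_iff {J : Ideal B} {u : ℕ × (Fin p → ℕ) →₀ J} :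
    D.incl J u ∈ D.rees 0 J ↔ u ∈ reesModule H J := by
  rw [mem_rees, mem_reesModule]
  rfl

theorem exists_incl_eq {J : Ideal B} {w : D.Ambient} (hw : w ∈ D.rees 0 J) :
    ∃ u : reesModule H J, D.incl J (u : ℕ × (Fin p → ℕ) →₀ J) = w := by
  have h1 : ∀ z, D.coef z w ∈ J := fun z => by
    have h := D.mem_rees.1 hw z
    rw [reesIdeal] at h
    exact Ideal.mul_le_right h
  have h2 : ∃ u : ℕ × (Fin p → ℕ) →₀ J, D.incl J u = w := by
    refine ⟨Finsupp.onFinset (AddMonoidAlgebra.coeff w).support (fun z => ⟨D.coef z w, h1 z⟩) ?_,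
      D.ext_coef fun z => rfl⟩
    intro z hz
    rw [Finsupp.mem_support_iff]
    intro h
    exact hz (Subtype.ext h)
  obtain ⟨u, rfl⟩ := h2
  exact ⟨⟨u, D.incl_mem_rees_iff.1 hw⟩, rfl⟩

/-- The Rees modules of the two constructions agree. -/
noncomputable def reesEquiv (J : Ideal B) :
    reesModule H J ≃ₗ[R] ((D.rees 0 J).restrictScalars R : Submodule R D.Ambient) :=
  LinearEquiv.ofBijective
    (((D.incl J).comp ((reesModule H J).subtype.restrictScalars R)).codRestrict _
      fun u => D.incl_mem_rees_iff.2 u.2)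
    ⟨fun _ _ h => Subtype.ext (D.incl_injective J (congrArg Subtype.val h)),
      fun w => (D.exists_incl_eq w.2).imp fun _ h => Subtype.ext h⟩

theorem coe_reesEquiv {J : Ideal B} (u : reesModule H J) : (D.reesEquiv J u : D.Ambient) = D.incl J u := rfl

theorem incl_mem_piece_iff {J : Ideal B} {u : ℕ × (Fin p → ℕ) →₀ J} {v : Fin p → ℤ} {n : Fin p → ℕ} :
    D.incl J u ∈ D.piece (Sum.elim v fun i => (n i : ℤ)) ↔ u ∈ ambientPiece (idealGrading 𝒜 J) v n := by
  classical
  have hb : ∀ (z : ℕ × (Fin p → ℕ)) (w : Fin p → ℕ), bidegree z w = Sum.elim v (fun i => (n i : ℤ)) ↔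
      z.2 = n ∧ (fun i => (w i : ℤ)) = fun i => v i + (n i : ℤ) := by
    intro z w
    constructor
    · intro h
      have h1 : z.2 = n := by
        funext i
        have := congrFun h (Sum.inr i)
        simpa [bidegree] using this
      refine ⟨h1, funext fun i => ?_⟩
      have := congrFun h (Sum.inl i)
      simp only [bidegree, Sum.elim_inl] at this
      rw [h1] at this
      omega
    · rintro ⟨rfl, h⟩
      funext i
      rcases i with i | i
      · have := congrFun h i
        simp only [bidegree, Sum.elim_inl]
        omega
      · rfl
  rw [mem_piece, mem_ambientPiece]
  refine forall_congr' fun z => ?_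
  rw [coef_incl]
  split_ifs with hz
  · rw [idealGrading, Submodule.mem_comap]
    change _ ↔ ((u z : J) : B) ∈ intGrading 𝒜 _
    rw [mem_intGrading_iff]
    refine forall_congr' fun w => ?_
    rw [Ne, hb z w, and_iff_right hz]
  · rw [Submodule.mem_bot]
    constructor
    · intro h
      apply Subtype.ext
      rw [← sum_support_decompose 𝒜 ((u z : J) : B)]
      exact Finset.sum_eq_zero fun w _ => h w fun h' => hz ((hb z w).1 h').1
    · intro h w _
      rw [h]
      simp

variable (hH : ∀ i, H i ≤ 𝒜 (Pi.single i 1)) [IsLocalRing R] [IsNoetherianRing R]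

theorem incl_mem_reesOne_iff {t : Fin p → ℕ} (u : reesModule H (degreeIdeal 𝒜 t)) :
    D.incl (degreeIdeal 𝒜 t) u ∈ D.reesOne t ↔
      u ∈ sumIdeal H • (⊤ : Submodule B (reesModule H (degreeIdeal 𝒜 t))) := by
  rw [mem_smul_reesModule_iff]
  refine forall_congr' fun z => ?_
  rw [coef_incl, reesIdeal, reesIdeal, add_zero, pow_succ', mul_assoc, mul_assoc, mul_assoc]

theorem incl_mem_reesPos_iff {t : Fin p → ℕ} (u : reesModule H (degreeIdeal 𝒜 t)) :
    D.incl (degreeIdeal 𝒜 t) u ∈ D.reesPos t ↔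
      u ∈ positiveIdeal 𝒜 • (⊤ : Submodule B (reesModule H (degreeIdeal 𝒜 t))) := by
  rw [mem_smul_reesModule_iff]
  refine forall_congr' fun z => ?_
  rw [coef_incl, reesIdeal, reesIdeal, mul_left_comm]

include hH in
-- Since `I ⊆ B_+`, changing the representative modulo `I` does not affect membership.
theorem mk_mem_positivePart_iff {t : Fin p → ℕ} (u : reesModule H (degreeIdeal 𝒜 t)) :
    (Submodule.Quotient.mk u : AssocGraded H (degreeIdeal 𝒜 t)) ∈
      positivePart H 𝒜 (degreeIdeal 𝒜 t) ↔ D.incl (degreeIdeal 𝒜 t) u ∈ D.reesPos t := by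
  rw [incl_mem_reesPos_iff, positivePart, Submodule.restrictScalars_mem]
  have h1 : (⊤ : Submodule B (AssocGraded H (degreeIdeal 𝒜 t))) =
      Submodule.map (Submodule.mkQ _) ⊤ := by rw [Submodule.map_top, Submodule.range_mkQ]
  rw [h1, ← Submodule.map_smul'']
  constructor
  · rintro ⟨u', hu', h⟩
    have h2 := (Submodule.Quotient.eq _).1 h
    have h3 := Submodule.smul_mono_left (N := (⊤ : Submodule B (reesModule H (degreeIdeal 𝒜 t))))
      (sumIdeal_le_positiveIdeal hH) h2
    have h4 := Submodule.sub_mem _ hu' h3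
    rwa [sub_sub_cancel] at h4
  · exact fun hu => ⟨u, hu, rfl⟩

theorem mk_mem_powerTorsion_iff {t : Fin p → ℕ} (u : reesModule H (degreeIdeal 𝒜 t)) :
    (Submodule.Quotient.mk u : AssocGraded H (degreeIdeal 𝒜 t)) ∈
      powerTorsion (IsLocalRing.maximalIdeal R) (AssocGraded H (degreeIdeal 𝒜 t)) ↔
    ∃ k : ℕ, ∀ a ∈ IsLocalRing.maximalIdeal R ^ k, a • D.incl (degreeIdeal 𝒜 t) u ∈ D.reesOne t := by
  refine exists_congr fun k => forall₂_congr fun a _ => ?_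
  rw [← Submodule.Quotient.mk_smul, Submodule.Quotient.mk_eq_zero, ← incl_mem_reesOne_iff, ← map_smul]
  rfl

/-- Transfers everything proved for submodules of `B[T, T_1, …, T_p]` to the invariant as it is
defined. -/
theorem jSharpHilbertFunction_eq (t : Fin p → ℕ) (v : Fin p → ℤ) (n : Fin p → ℕ) :
    jSharpHilbertFunction H 𝒜 (idealGrading 𝒜 (degreeIdeal 𝒜 t)) v n =
      D.sharpHilb hH t (Sum.elim v fun i => (n i : ℤ)) := by
  set d : Fin p ⊕ Fin p → ℤ := Sum.elim v fun i => (n i : ℤ) with hd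
  set J := degreeIdeal 𝒜 t with hJ
  set Y : Submodule R D.Ambient :=
    (torsionIn (D.reesOne t) (D.reesPos t)).restrictScalars R ⊓ D.piece d with hY
  have hY0 : Y ≤ (D.rees 0 J).restrictScalars R := fun w hw => D.reesPos_le t hw.1.1
  set E : Submodule R (AssocGraded H J) := positivePart H 𝒜 J ⊓
    powerTorsion (IsLocalRing.maximalIdeal R) (AssocGraded H J) ⊓
    gradedPiece H (idealGrading 𝒜 J) v n with hE
  let g : Y →ₗ[R] AssocGraded H J :=
    ((Submodule.mkQ _).restrictScalars R).comp
      ((D.reesEquiv J).symm.toLinearMap.comp (Submodule.inclusion hY0))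
  have hg : ∀ y : Y, ∃ u : reesModule H J, D.incl J u = y ∧ g y = Submodule.Quotient.mk u := fun y => by
    refine ⟨(D.reesEquiv J).symm (Submodule.inclusion hY0 y), ?_, rfl⟩
    rw [← coe_reesEquiv, LinearEquiv.apply_symm_apply]
    rfl
  have hgE : ∀ y : Y, g y ∈ E := by
    intro y
    obtain ⟨u, huy, hgu⟩ := hg y
    obtain ⟨⟨hy1, hy2⟩, hy3⟩ := y.2
    rw [← huy] at hy1 hy2 hy3
    rw [hgu]
    exact ⟨⟨(D.mk_mem_positivePart_iff hH u).2 hy1, (D.mk_mem_powerTorsion_iff u).2 hy2⟩,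
      u, D.incl_mem_piece_iff.1 hy3, rfl⟩
  refine (relLength_eq_length_of_surjective ((D.reesOne t).restrictScalars R ⊓ D.piece d) Y
    (g.codRestrict E hgE) ?_ ?_).symm
  · rintro ⟨q, hq⟩
    obtain ⟨⟨hq1, hq2⟩, u, hu, rfl⟩ := id hq
    have hy : D.incl J u ∈ Y := ⟨⟨(D.mk_mem_positivePart_iff hH u).1 hq1,
      (D.mk_mem_powerTorsion_iff u).1 hq2⟩, D.incl_mem_piece_iff.2 hu⟩
    refine ⟨⟨_, hy⟩, Subtype.ext ?_⟩
    obtain ⟨u', huy, hgu⟩ := hg ⟨_, hy⟩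
    have : u' = u := Subtype.ext (D.incl_injective J huy)
    subst this
    exact hgu
  · intro y
    obtain ⟨u, huy, hgu⟩ := hg y
    rw [← Subtype.val_inj, LinearMap.codRestrict_apply, hgu]
    change Submodule.Quotient.mk u = 0 ↔ _
    rw [Submodule.Quotient.mk_eq_zero, ← incl_mem_reesOne_iff, huy]
    exact ⟨fun h => ⟨h, y.2.2⟩, fun h => h.1⟩

end Presentation

end Identification

end JointBlowup

namespace JointBlowup

open MvPolynomial DirectSum

/-! ### Chains in the multiprojective spectrum -/

section MultiProjChains

variable {p : ℕ} {R B : Type*} [CommRing R] [CommRing B] [Algebra R B]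
  {𝒜 : (Fin p → ℕ) → Submodule R B} [GradedAlgebra 𝒜] {H : Fin p → Submodule R B}

variable (𝒜) in
-- Closures of points embed the opposite of the poset of primes into the poset of irreducible closed
-- sets.
theorem krullDim_multiProj_le : Order.krullDim ↥(MultiProj 𝒜) ≤ topologicalKrullDim ↥(MultiProj 𝒜) := by
  let f : (↥(MultiProj 𝒜))ᵒᵈ → TopologicalSpace.IrreducibleCloseds ↥(MultiProj 𝒜) := fun P =>
    ⟨closure {OrderDual.ofDual P}, isIrreducible_singleton.closure, isClosed_closure⟩
  have hle : ∀ P Q : (↥(MultiProj 𝒜))ᵒᵈ, f P ≤ f Q ↔ P ≤ Q := by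
    intro P Q
    change closure {OrderDual.ofDual P} ⊆ closure {OrderDual.ofDual Q} ↔ _
    rw [← specializes_iff_closure_subset, subtype_specializes_iff,
      ← PrimeSpectrum.le_iff_specializes]
    rfl
  rw [← Order.krullDim_orderDual]
  exact Order.krullDim_le_of_strictMono f (strictMono_of_le_iff_le fun P Q => (hle P Q).symm)

namespace Presentation

variable (D : Presentation 𝒜 H)

theorem decompose_toAlgebra (f : MvPolynomial (Fin D.m) R) (u : Fin p → ℕ) :
    (decompose 𝒜 (D.toAlgebra f) u : B) =
      D.toAlgebra (decompose (polyPiece (R := R) D.dx) f fun i => (u i : ℤ)) := by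
  classical
  induction f using MvPolynomial.induction_on' with
  | add f g hf hg =>
    rw [map_add, decompose_add, decompose_add, DFinsupp.add_apply, DFinsupp.add_apply,
      Submodule.coe_add, Submodule.coe_add, map_add, hf, hg]
  | monomial m a =>
    have h1 := D.toAlgebra_monomial_mem m a
    set w := Finsupp.weight (fun s => (Pi.single (D.dx s) 1 : Fin p → ℕ)) m with hw
    have h2 : monomial m a ∈ polyPiece (R := R) D.dx fun i => (w i : ℤ) := by
      refine isWeightedHomogeneous_monomial _ _ _ ?_
      funext i
      rw [hw, Finsupp.weight_apply, Finsupp.weight_apply, Finsupp.sum, Finsupp.sum, Finset.sum_apply,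
        Finset.sum_apply, Nat.cast_sum]
      refine Finset.sum_congr rfl fun s _ => ?_
      by_cases hs : i = D.dx s <;> simp [hs]
    by_cases hu : w = u
    · subst hu
      rw [decompose_of_mem_same 𝒜 h1, decompose_of_mem_same _ h2]
    · rw [decompose_of_mem_ne 𝒜 h1 hu, decompose_of_mem_ne _ h2, map_zero]
      exact fun h => hu (funext fun i => by exact_mod_cast congrFun h i)

theorem isHomogeneous_comap_toAlgebra {Q : Ideal B} (hQ : Q.IsHomogeneous 𝒜) :
    (Q.comap D.toAlgebra).IsHomogeneous (polyPiece (R := R) D.dx) := by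
  intro d f hf
  by_cases hd : ∀ i, 0 ≤ d i
  · have hd' : d = fun i => ((d i).toNat : ℤ) := funext fun i => (Int.toNat_of_nonneg (hd i)).symm
    rw [hd', Ideal.mem_comap, ← decompose_toAlgebra]
    exact hQ _ hf
  · push Not at hd
    obtain ⟨i, hi⟩ := hd
    rw [polyPiece_eq_zero D.dx (SetLike.coe_mem (decompose (polyPiece (R := R) D.dx) f d)) hi]
    exact Ideal.zero_mem _

theorem isHomogeneous_map_toAlgebra {P : Ideal (MvPolynomial (Fin D.m) R)}
    (hP : P.IsHomogeneous (polyPiece (R := R) D.dx)) : (P.map D.toAlgebra).IsHomogeneous 𝒜 := by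
  intro u b hb
  obtain ⟨f, hf, rfl⟩ := (Ideal.mem_map_iff_of_surjective D.toAlgebra D.toAlgebra_surjective).1 hb
  rw [decompose_toAlgebra]
  exact Ideal.mem_map_of_mem _ (hP _ hf)

theorem comap_map_toAlgebra {P : Ideal (MvPolynomial (Fin D.m) R)} (hP : RingHom.ker D.toAlgebra ≤ P) :
    (P.map D.toAlgebra).comap D.toAlgebra = P := by
  rw [Ideal.comap_map_of_surjective' _ D.toAlgebra_surjective, sup_of_le_left hP]

theorem exists_mem_multiProj {P : Ideal (MvPolynomial (Fin D.m) R)} (hPp : P.IsPrime)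
    (hP : P.IsHomogeneous (polyPiece (R := R) D.dx)) (hS : varSupport D.dx P = Set.univ)
    (hker : RingHom.ker D.toAlgebra ≤ P) :
    ∃ Q ∈ MultiProj 𝒜, Q.asIdeal.comap D.toAlgebra = P := by
  have hQ := Ideal.map_isPrime_of_surjective D.toAlgebra_surjective hker
  refine ⟨⟨_, hQ⟩, ⟨D.isHomogeneous_map_toAlgebra hP, fun hle => ?_⟩, D.comap_map_toAlgebra hker⟩
  have h1 : ∀ i, ∃ s, D.dx s = i ∧ X s ∉ P := fun i => by
    have : i ∈ varSupport D.dx P := hS ▸ Set.mem_univ i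
    exact this
  choose s hs hsP using h1
  -- A product of one variable per direction has degree at least `(1, …, 1)`, so it would lie in the
  -- prime if `B_{++}` did.
  have h2 : ∏ i, D.x (s i) ∈ P.map D.toAlgebra := by
    refine hle (Ideal.subset_span ⟨_, fun i => ?_, SetLike.prod_mem_graded 𝒜
      (fun i => Pi.single (D.dx (s i)) 1) _ fun i _ => D.x_mem (s i)⟩)
    rw [Finset.sum_apply]
    refine le_trans ?_ (Finset.single_le_sum (fun _ _ => Nat.zero_le _) (Finset.mem_univ i))
    rw [hs, Pi.single_eq_same]
  obtain ⟨i, -, hi⟩ := (hQ.prod_mem_iff).1 h2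
  refine hsP i ?_
  rw [← D.comap_map_toAlgebra hker, Ideal.mem_comap, toAlgebra, aeval_X]
  exact hi

theorem exists_ltSeries_of_hasChain {n : ℕ} {P : Ideal (MvPolynomial (Fin D.m) R)}
    (hker : RingHom.ker D.toAlgebra ≤ P) (h : HasChain D.dx Set.univ n P) :
    ∃ l : LTSeries ↥(MultiProj 𝒜), l.length = n ∧ l.head.1.asIdeal.comap D.toAlgebra = P := by
  induction n generalizing P with
  | zero =>
    obtain ⟨Q, hQ, hQP⟩ := D.exists_mem_multiProj h.1 h.2.1 h.2.2 hker
    exact ⟨RelSeries.singleton _ ⟨Q, hQ⟩, rfl, hQP⟩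
  | succ n ih =>
    obtain ⟨h1, P', hlt, h'⟩ := h
    obtain ⟨Q, hQ, hQP⟩ := D.exists_mem_multiProj h1.1 h1.2.1 h1.2.2 hker
    obtain ⟨l, hl, hlP⟩ := ih (hker.trans hlt.le) h'
    have hQl : Q.asIdeal < l.head.1.asIdeal := by
      rw [← hQP, ← hlP] at hlt
      refine lt_of_le_of_ne ((Ideal.comap_le_comap_iff_of_surjective D.toAlgebra
        D.toAlgebra_surjective _ _).1 hlt.le) fun he => hlt.ne (he ▸ rfl)
    refine ⟨l.cons ⟨Q, hQ⟩ hQl, ?_, ?_⟩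
    · rw [RelSeries.cons_length, hl]
    · rw [RelSeries.head_cons, hQP]

end Presentation

end MultiProjChains

end JointBlowup

namespace JointBlowup

open MvPolynomial DirectSum

/-! ### The dimension of the joint blow-up -/

section Dimension

theorem le_height_augmentationIdeal {A D V k : Type*} [CommRing A] [CommRing D] [CommRing V]
    [Algebra D V] [Field k] {φ : A →+* V} {χ : V →+* k} {K : Subalgebra D V} [IsNoetherianRing A]
    (hK : ∀ z, z ∈ K ↔ ∃ f, φ f = z) {d : ℕ}
    (h : ChainTo (RingHom.ker (χ.comp φ)) (RingHom.ker φ) d) :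
    (d : ℕ∞) ≤ (augmentationIdeal χ K).height := by
  let F : A →+* K := φ.codRestrict K fun f => (hK _).2 ⟨f, rfl⟩
  have hF : Function.Surjective F := fun z => by
    obtain ⟨f, hf⟩ := (hK z).1 z.2
    exact ⟨f, Subtype.ext hf⟩
  have hker : RingHom.ker F = RingHom.ker φ := Ideal.ext fun f => Subtype.ext_iff
  have hcomap : (augmentationIdeal χ K).comap F = RingHom.ker (χ.comp φ) := rfl
  rw [← hker, ← hcomap] at h
  exact h.le_height hF

variable {p : ℕ} {R B : Type*} [CommRing R] [CommRing B] [Algebra R B]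
  {𝒜 : (Fin p → ℕ) → Submodule R B} {H : Fin p → Submodule R B}

namespace Presentation

variable (D : Presentation 𝒜 H)

/-- The map from the polynomial ring of the presentation to the polynomial ring
`B[T, T_1, …, T_p]`. -/
noncomputable def toPoly : MvPolynomial D.Vars R →ₐ[R] MvPolynomial (Option (Fin p)) B :=
  aeval (Sum.elim (fun s => C (D.x s))
    (Sum.elim (fun s => C (D.y s) * X none) fun s => C (D.y s) * X (some (D.dy s))))

/-- The map from the polynomial ring of the presentation to the polynomial ring over a quotient
of `B`. -/
noncomputable def toQuot (𝔮 : Ideal B) :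
    MvPolynomial D.Vars R →+* MvPolynomial (Option (Fin p)) (B ⧸ 𝔮) :=
  (MvPolynomial.map (Ideal.Quotient.mk 𝔮)).comp (D.toPoly : MvPolynomial D.Vars R →+* MvPolynomial (Option (Fin p)) B)

theorem toPoly_rename_inl (f : MvPolynomial (Fin D.m) R) :
    D.toPoly (rename Sum.inl f) = C (D.toAlgebra f) := by
  rw [toPoly, aeval_rename, toAlgebra]
  induction f using MvPolynomial.induction_on with
  | C r =>
    change aeval _ (algebraMap R (MvPolynomial (Fin D.m) R) r) =
      C (aeval _ (algebraMap R (MvPolynomial (Fin D.m) R) r))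
    rw [AlgHom.commutes, AlgHom.commutes]
    rfl
  | add f g hf hg => rw [map_add, hf, hg, map_add, map_add]
  | mul_X f s hf =>
    rw [map_mul, hf, aeval_X, map_mul, aeval_X, map_mul]
    rfl

theorem toQuot_C (𝔮 : Ideal B) (r : R) :
    D.toQuot 𝔮 (C r) = C (Ideal.Quotient.mk 𝔮 (algebraMap R B r)) := by
  have : D.toPoly (C r) = C (algebraMap R B r) := D.toPoly.commutes r
  rw [toQuot, RingHom.comp_apply, RingHom.coe_coe, this, map_C]

theorem toQuot_rename_inl (𝔮 : Ideal B) (f : MvPolynomial (Fin D.m) R) :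
    D.toQuot 𝔮 (rename Sum.inl f) = C (Ideal.Quotient.mk 𝔮 (D.toAlgebra f)) := by
  rw [toQuot, RingHom.comp_apply, RingHom.coe_coe, toPoly_rename_inl, map_C]

theorem toQuot_X_inl (𝔮 : Ideal B) (s : Fin D.m) :
    D.toQuot 𝔮 (X (Sum.inl s)) = C (Ideal.Quotient.mk 𝔮 (D.x s)) := by
  rw [toQuot, RingHom.comp_apply, RingHom.coe_coe, toPoly, aeval_X, Sum.elim_inl, map_C]

theorem toQuot_X_inr_inl (𝔮 : Ideal B) (s : Fin D.n) :
    D.toQuot 𝔮 (X (Sum.inr (Sum.inl s))) = C (Ideal.Quotient.mk 𝔮 (D.y s)) * X none := by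
  rw [toQuot, RingHom.comp_apply, RingHom.coe_coe, toPoly, aeval_X, Sum.elim_inr, Sum.elim_inl,
    map_mul, map_C, map_X]

theorem toQuot_X_inr_inr (𝔮 : Ideal B) (s : Fin D.n) :
    D.toQuot 𝔮 (X (Sum.inr (Sum.inr s))) =
      C (Ideal.Quotient.mk 𝔮 (D.y s)) * X (some (D.dy s)) := by
  rw [toQuot, RingHom.comp_apply, RingHom.coe_coe, toPoly, aeval_X, Sum.elim_inr, Sum.elim_inr,
    map_mul, map_C, map_X]

/-- `B[T, T_1, …, T_p]` occurs both as a monoid algebra, which carries the Rees modules, and as a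
polynomial ring, whose primes are used below. The map `θ` compares the two. -/
theorem ker_toPoly_le : RingHom.ker (D.toPoly : MvPolynomial D.Vars R →+* MvPolynomial (Option (Fin p)) B) ≤
    D.annIdeal := by
  let c : B →+* D.Ambient := AddMonoidAlgebra.singleZeroRingHom
  have hc : ∀ b, c b = D.mono 0 b := fun _ => rfl
  let θ : MvPolynomial (Option (Fin p)) B →+* D.Ambient :=
    eval₂Hom c fun o => o.elim (D.mono (1, 0) 1) fun i => D.mono (0, Pi.single i 1) 1
  have hθC : ∀ b, θ (C b) = D.mono 0 b := fun b => eval₂Hom_C _ _ _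
  have hθX : ∀ o, θ (X o) = o.elim (D.mono (1, 0) 1) fun i => D.mono (0, Pi.single i 1) 1 :=
    fun o => eval₂Hom_X' _ _ _
  have h : ∀ f, θ (D.toPoly f) = D.toAmbient f := fun f => by
    induction f using MvPolynomial.induction_on with
    | C r =>
      rw [← algebraMap_eq, AlgHom.commutes, AlgHom.commutes]
      exact hθC _
    | add f g hf hg => rw [map_add, map_add, hf, hg, map_add]
    | mul_X f s hf =>
      rw [map_mul, map_mul, hf, map_mul]
      congr 1
      rw [toPoly, toAmbient, aeval_X, aeval_X]
      rcases s with s | s | s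
      · exact hθC _
      · rw [Sum.elim_inr, Sum.elim_inl, map_mul, hθC, hθX, Sum.elim_inr, Sum.elim_inl]
        refine (D.mono_mul_mono _ _ _ _).trans ?_
        rw [zero_add, mul_one]
      · rw [Sum.elim_inr, Sum.elim_inr, map_mul, hθC, hθX, Sum.elim_inr, Sum.elim_inr]
        refine (D.mono_mul_mono _ _ _ _).trans ?_
        rw [zero_add, mul_one]
  intro f hf
  have hf' : D.toPoly f = 0 := hf
  rw [annIdeal, mem_colonIdeal, smul_def, ← h, hf', map_zero, zero_mul]
  exact Submodule.zero_mem _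

theorem rename_inl_mem_annIdeal {f : MvPolynomial (Fin D.m) R} (hf : D.toAlgebra f ∈ sumIdeal H) :
    rename Sum.inl f ∈ D.annIdeal := by
  rw [annIdeal, mem_colonIdeal, rename_inl_smul, mul_one]
  refine D.mono_mem_rees ?_
  simpa [reesIdeal, powerIdeal_zero] using hf

/-- A minimal prime over the kernel of `toPoly`, below `Q`, is the contraction of a prime `P` of
`B[T, T_1, …, T_p]`. Take for `𝔮` the homogeneous core of `P ∩ B`: a polynomial with all
coefficients in `𝔮` lies in `P`. -/
theorem exists_homogeneous_prime [GradedAlgebra 𝒜] {Q : Ideal (MvPolynomial D.Vars R)} (hQ : Q.IsPrime)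
    (hle : D.annIdeal ≤ Q) :
    ∃ 𝔮 : Ideal B, 𝔮.IsPrime ∧ 𝔮.IsHomogeneous 𝒜 ∧ RingHom.ker (D.toQuot 𝔮) ≤ Q := by
  classical
  have hker : (⊥ : Ideal (MvPolynomial (Option (Fin p)) B)).comap
      (D.toPoly : MvPolynomial D.Vars R →+* MvPolynomial (Option (Fin p)) B) ≤ Q := by
    rw [← RingHom.ker_eq_comap_bot]
    exact D.ker_toPoly_le.trans hle
  obtain ⟨Q', hQ', hQQ'⟩ := Ideal.exists_minimalPrimes_le hker
  obtain ⟨P, hP, -, hPQ⟩ := Ideal.exists_comap_eq_of_mem_minimalPrimes _ _ hQ'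
  have hPC : (P.comap (C : B →+* MvPolynomial (Option (Fin p)) B)).IsPrime := Ideal.comap_isPrime _ _
  refine ⟨((P.comap C).homogeneousCore 𝒜).toIdeal,
    isPrime_homogeneousCore (fun (u : Fin p → ℕ) i => (u i : ℤ))
      (fun u v h => _root_.funext fun i => Int.ofNat_inj.1 (congrFun h i))
      (fun u v => _root_.funext fun i => by simp) 𝒜 hPC,
    ((P.comap C).homogeneousCore 𝒜).isHomogeneous, fun f hf => hQQ' ?_⟩
  rw [← hPQ, Ideal.mem_comap]
  have h1 : D.toPoly f ∈ (P.comap C).map C := by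
    refine Ideal.map_mono (Ideal.toIdeal_homogeneousCore_le 𝒜 (P.comap C)) ?_
    rw [mem_map_C_iff]
    intro m
    rw [RingHom.mem_ker, toQuot, RingHom.comp_apply] at hf
    rw [← Ideal.Quotient.eq_zero_iff_mem, ← coeff_map]
    exact (congrArg (coeff m) hf).trans (coeff_zero m)
  exact Ideal.map_comap_le h1

variable [IsLocalRing R] [IsNoetherianRing R]

/-- The quotient of `B` by a homogeneous prime maps to the residue field of `R`. -/
theorem exists_residue_map [GradedAlgebra 𝒜] {𝔮 : Ideal B} [h𝔮 : 𝔮.IsPrime] (h𝔮h : 𝔮.IsHomogeneous 𝒜) :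
    ∃ χ : B ⧸ 𝔮 →+* IsLocalRing.ResidueField R, ∀ f,
      χ (Ideal.Quotient.mk 𝔮 (D.toAlgebra f)) = IsLocalRing.residue R (constantCoeff f) := by
  let π : MvPolynomial (Fin D.m) R →+* B ⧸ 𝔮 :=
    (Ideal.Quotient.mk 𝔮).comp (D.toAlgebra : MvPolynomial (Fin D.m) R →+* B)
  have hπ : Function.Surjective π := Ideal.Quotient.mk_surjective.comp D.toAlgebra_surjective
  have hprime : (𝔮.comap D.toAlgebra).IsPrime := Ideal.comap_isPrime _ _
  let ρ : MvPolynomial (Fin D.m) R →+* IsLocalRing.ResidueField R :=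
    (IsLocalRing.residue R).comp constantCoeff
  have hker : RingHom.ker π ≤ RingHom.ker ρ := by
    intro f hf
    refine (IsLocalRing.residue_eq_zero_iff _).2
      (le_originIdeal hprime.ne_top (D.isHomogeneous_comap_toAlgebra h𝔮h) ?_)
    rw [Ideal.mem_comap, ← Ideal.Quotient.eq_zero_iff_mem]
    exact hf
  exact ⟨RingHom.liftOfSurjective π hπ ⟨ρ, hker⟩, fun f =>
    RingHom.liftOfRightInverse_comp_apply π _ _ ⟨ρ, hker⟩ f⟩

theorem residue_constantCoeff_toQuot {𝔮 : Ideal B} {χ : B ⧸ 𝔮 →+* IsLocalRing.ResidueField R}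
    (hχ : ∀ f, χ (Ideal.Quotient.mk 𝔮 (D.toAlgebra f)) = IsLocalRing.residue R (constantCoeff f))
    (f : MvPolynomial D.Vars R) :
    χ (constantCoeff (D.toQuot 𝔮 f)) = IsLocalRing.residue R (constantCoeff f) := by
  induction f using MvPolynomial.induction_on with
  | C r =>
    have h1 := hχ (C r)
    rw [← algebraMap_eq, AlgHom.commutes, algebraMap_eq, constantCoeff_C] at h1
    rw [toQuot_C, constantCoeff_C, constantCoeff_C, h1]
  | add f g hf hg => rw [map_add, map_add, map_add, hf, hg, map_add, map_add]
  | mul_X f j hf =>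
    rw [map_mul, map_mul, map_mul, map_mul, constantCoeff_X, mul_zero, map_zero]
    refine mul_eq_zero_of_right _ ?_
    rcases j with j | j | j
    · have h1 := hχ (X j)
      rw [toAlgebra, aeval_X, constantCoeff_X, map_zero] at h1
      rw [toQuot_X_inl, constantCoeff_C, h1]
    · rw [toQuot_X_inr_inl, map_mul, constantCoeff_X, mul_zero, map_zero]
    · rw [toQuot_X_inr_inr, map_mul, constantCoeff_X, mul_zero, map_zero]

/-- The generators `y T` and `y T_i` of the joint blow-up over a quotient of `B`. -/
noncomputable def quotGen (𝔮 : Ideal B) (j : Fin D.n ⊕ Fin D.n) :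
    MvPolynomial (Option (Fin p)) (B ⧸ 𝔮) := D.toQuot 𝔮 (X (Sum.inr j))

theorem mem_adjoin_quotGen_iff {𝔮 : Ideal B} {z : MvPolynomial (Option (Fin p)) (B ⧸ 𝔮)} :
    z ∈ Algebra.adjoin (B ⧸ 𝔮) (Set.range (D.quotGen 𝔮)) ↔ ∃ f, D.toQuot 𝔮 f = z := by
  constructor
  · intro hz
    induction hz using Algebra.adjoin_induction with
    | mem x hx =>
      obtain ⟨j, rfl⟩ := hx
      exact ⟨_, rfl⟩
    | algebraMap b =>
      obtain ⟨b, rfl⟩ := Ideal.Quotient.mk_surjective b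
      obtain ⟨f, rfl⟩ := D.toAlgebra_surjective b
      exact ⟨rename Sum.inl f, D.toQuot_rename_inl 𝔮 f⟩
    | add a b _ _ ha hb =>
      obtain ⟨f, rfl⟩ := ha
      obtain ⟨g, rfl⟩ := hb
      exact ⟨f + g, map_add _ _ _⟩
    | mul a b _ _ ha hb =>
      obtain ⟨f, rfl⟩ := ha
      obtain ⟨g, rfl⟩ := hb
      exact ⟨f * g, map_mul _ _ _⟩
  · rintro ⟨f, rfl⟩
    induction f using MvPolynomial.induction_on with
    | C r =>
      rw [toQuot_C]
      exact Subalgebra.algebraMap_mem _ _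
    | add f g hf hg =>
      rw [map_add]
      exact Subalgebra.add_mem _ hf hg
    | mul_X f j hf =>
      rw [map_mul]
      refine Subalgebra.mul_mem _ hf ?_
      rcases j with j | j
      · rw [toQuot_X_inl]
        exact Subalgebra.algebraMap_mem _ _
      · exact Algebra.subset_adjoin ⟨j, rfl⟩

/-- The generators of the joint blow-up satisfy linear equations over the algebra that is generated
by one of them for `T` and one for each `T_i`. -/
theorem exists_mul_quotGen_mem {𝔮 : Ideal B} (i₀ : Fin p) (σ : Fin p → Fin D.n)
    (hσ : ∀ i, D.dy (σ i) = i) (hσ𝔮 : ∀ i, D.y (σ i) ∉ 𝔮)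
    {K : Subalgebra (B ⧸ 𝔮) (MvPolynomial (Option (Fin p)) (B ⧸ 𝔮))}
    (hK₀ : D.quotGen 𝔮 (Sum.inl (σ i₀)) ∈ K) (hK : ∀ i, D.quotGen 𝔮 (Sum.inr (σ i)) ∈ K)
    (j : Fin D.n ⊕ Fin D.n) : ∃ a ∈ K, a ≠ 0 ∧ a * D.quotGen 𝔮 j ∈ K := by
  have hC : ∀ b : B ⧸ 𝔮, (C b : MvPolynomial (Option (Fin p)) (B ⧸ 𝔮)) ∈ K :=
    fun b => Subalgebra.algebraMap_mem _ b
  have hne : ∀ i, (C (Ideal.Quotient.mk 𝔮 (D.y (σ i))) : MvPolynomial (Option (Fin p)) (B ⧸ 𝔮)) ≠ 0 :=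
    fun i => by
      rw [Ne, C_eq_zero, Ideal.Quotient.eq_zero_iff_mem]
      exact hσ𝔮 i
  rcases j with j | j
  · refine ⟨_, hC _, hne i₀, ?_⟩
    have h2 := Subalgebra.mul_mem _ (hC (Ideal.Quotient.mk 𝔮 (D.y j))) hK₀
    rw [quotGen, toQuot_X_inr_inl] at h2
    rw [quotGen, toQuot_X_inr_inl, mul_left_comm]
    exact h2
  · refine ⟨_, hC _, hne (D.dy j), ?_⟩
    have h2 := Subalgebra.mul_mem _ (hC (Ideal.Quotient.mk 𝔮 (D.y j))) (hK (D.dy j))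
    rw [quotGen, toQuot_X_inr_inr, hσ] at h2
    rw [quotGen, toQuot_X_inr_inr, mul_left_comm]
    exact h2

/-- The image of `toQuot 𝔮` is a multi-Rees algebra over `B ⧸ 𝔮`, in which one `y T` and one `y T_i`
for each `i` determine the other generators up to linear equations. The dimension inequality bounds
its height at the origin by that of `B ⧸ 𝔮` plus `p + 1`. -/
theorem le_height_ker [GradedAlgebra 𝒜] {𝔮 : Ideal B} [h𝔮 : 𝔮.IsPrime]
    (i₀ : Fin p) (σ : Fin p → Fin D.n) (hσ : ∀ i, D.dy (σ i) = i)
    (hσ𝔮 : ∀ i, D.y (σ i) ∉ 𝔮) {χ₀ : B ⧸ 𝔮 →+* IsLocalRing.ResidueField R}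
    (hχ₀ : ∀ f, χ₀ (Ideal.Quotient.mk 𝔮 (D.toAlgebra f)) = IsLocalRing.residue R (constantCoeff f))
    {d : ℕ} (h : ChainTo (originIdeal D.Vars R) (RingHom.ker (D.toQuot 𝔮)) (d + (p + 1))) :
    (d : ℕ∞) ≤ (RingHom.ker χ₀).height := by
  have := D.isNoetherianRing
  let χ : MvPolynomial (Option (Fin p)) (B ⧸ 𝔮) →+* IsLocalRing.ResidueField R :=
    χ₀.comp constantCoeff
  have hχC : χ.comp (algebraMap (B ⧸ 𝔮) (MvPolynomial (Option (Fin p)) (B ⧸ 𝔮))) = χ₀ :=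
    RingHom.ext fun a => congrArg χ₀ (constantCoeff_C _ a)
  have hχ₀s : Function.Surjective χ₀ := by
    intro a
    obtain ⟨r, rfl⟩ := IsLocalRing.residue_surjective a
    exact ⟨_, (hχ₀ (C r)).trans (by rw [constantCoeff_C])⟩
  obtain ⟨s, hs₀, hs₁⟩ : ∃ s : Fin (p + 1) → MvPolynomial (Option (Fin p)) (B ⧸ 𝔮),
      s 0 = D.quotGen 𝔮 (Sum.inl (σ i₀)) ∧ ∀ i, s (Fin.succ i) = D.quotGen 𝔮 (Sum.inr (σ i)) :=
    ⟨Fin.cons (D.quotGen 𝔮 (Sum.inl (σ i₀))) fun i => D.quotGen 𝔮 (Sum.inr (σ i)), rfl, fun _ => rfl⟩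
  have hs : Set.range s ⊆ Set.range (D.quotGen 𝔮) := by
    rintro _ ⟨j, rfl⟩
    induction j using Fin.cases with
    | zero => exact ⟨_, hs₀.symm⟩
    | succ i => exact ⟨_, (hs₁ i).symm⟩
  have hst : ∀ y ∈ Set.range (D.quotGen 𝔮), ∃ a ∈ Algebra.adjoin (B ⧸ 𝔮) (Set.range s), a ≠ 0 ∧
      a * y ∈ Algebra.adjoin (B ⧸ 𝔮) (Set.range s) := by
    rintro _ ⟨j, rfl⟩
    exact D.exists_mul_quotGen_mem i₀ σ hσ hσ𝔮 (Algebra.subset_adjoin (Set.mem_range.2 ⟨0, hs₀⟩))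
      (fun i => Algebra.subset_adjoin (Set.mem_range.2 ⟨i.succ, hs₁ i⟩)) j
  have hsurj : Function.Surjective
      (χ.comp (algebraMap (B ⧸ 𝔮) (MvPolynomial (Option (Fin p)) (B ⧸ 𝔮)))) := hχC ▸ hχ₀s
  have hht := height_augmentationIdeal_adjoin_union hsurj s (Set.finite_range (D.quotGen 𝔮)) hst
  rw [Set.union_eq_self_of_subset_right hs, hχC] at hht
  have hker : originIdeal D.Vars R = RingHom.ker (χ.comp (D.toQuot 𝔮)) := by
    ext f
    rw [originIdeal, Ideal.mem_comap, ← IsLocalRing.residue_eq_zero_iff,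
      ← D.residue_constantCoeff_toQuot hχ₀]
    rfl
  rw [hker] at h
  have h1 := (le_height_augmentationIdeal (fun _ => D.mem_adjoin_quotGen_iff) h).trans hht
  rw [Nat.cast_add] at h1
  exact (ENat.add_le_add_iff_right (ENat.natCast_ne_top _)).1 h1

theorem chainTo_comap_toAlgebra [GradedAlgebra 𝒜] {𝔮 : Ideal B} [h𝔮 : 𝔮.IsPrime]
    (h𝔮h : 𝔮.IsHomogeneous 𝒜) (i₀ : Fin p) (σ : Fin p → Fin D.n) (hσ : ∀ i, D.dy (σ i) = i)
    (hσ𝔮 : ∀ i, D.y (σ i) ∉ 𝔮) {d : ℕ}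
    (h : ChainTo (originIdeal D.Vars R) (RingHom.ker (D.toQuot 𝔮)) (d + (p + 1))) :
    ChainTo (originIdeal (Fin D.m) R) (𝔮.comap D.toAlgebra) d := by
  have := D.isNoetherianRing
  have := D.isNoetherianRing
  obtain ⟨χ, hχ⟩ := D.exists_residue_map h𝔮h
  have := RingHom.ker_isPrime χ
  have h1 := (chainTo_of_le_height (D.le_height_ker i₀ σ hσ hσ𝔮 hχ h)).comap
    (f := (Ideal.Quotient.mk 𝔮).comp (D.toAlgebra : MvPolynomial (Fin D.m) R →+* B))
    (Ideal.Quotient.mk_surjective.comp D.toAlgebra_surjective)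
  convert h1 using 1
  · ext f
    rw [originIdeal, Ideal.mem_comap, ← IsLocalRing.residue_eq_zero_iff, ← hχ]
    rfl
  · ext f
    exact (Ideal.Quotient.eq_zero_iff_mem (I := 𝔮)).symm

/-- A chain of `r + 2` relevant primes over the annihilator would produce a chain of length `r + 1`
in `MultiProj`, by the count of steps `(r + 1) + 2p + 1 - (p + 1) - p = r + 1`. -/
theorem relevantBound_annIdeal [GradedAlgebra 𝒜] (hp : 1 ≤ p) {r : ℕ}
    (hdim : topologicalKrullDim ↥(MultiProj 𝒜) ≤ (r : WithBot ℕ∞)) :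
    RelevantBound D.dir (r + 1) D.annIdeal := by
  by_contra hcon
  obtain ⟨Q, hQ, hle, hchain⟩ := exists_chainTo_of_not_relevantBound hcon
  obtain ⟨𝔮, h𝔮, h𝔮h, h𝔮Q⟩ := D.exists_homogeneous_prime hQ.isPrime hle
  have h1 : ∀ i, ∃ s, D.dy s = i ∧ D.y s ∉ 𝔮 := by
    intro i
    obtain ⟨s, hs, hsQ⟩ := hQ.exists_notMem (Sum.inr i)
    rcases s with s | s | s
    · cases hs
    · cases hs
    · refine ⟨s, Sum.inr_injective hs, fun hy => hsQ (h𝔮Q ?_)⟩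
      rw [RingHom.mem_ker, toQuot_X_inr_inr, Ideal.Quotient.eq_zero_iff_mem.2 hy, map_zero, zero_mul]
  choose σ hσ hσ𝔮 using h1
  -- The annihilator contains the lifts of `I`, while some generator of `I` is outside `𝔮`. This
  -- strict inclusion is the extra step that compensates for the variable `T`.
  have hlt : RingHom.ker (D.toQuot 𝔮) < Q := by
    refine lt_of_le_of_ne h𝔮Q fun he => ?_
    let i₀ : Fin p := ⟨0, hp⟩
    obtain ⟨f, hf⟩ := D.toAlgebra_surjective (D.y (σ i₀))
    have h2 := hle (D.rename_inl_mem_annIdeal (f := f) (hf ▸ D.y_mem_sumIdeal _))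
    rw [← he, RingHom.mem_ker, toQuot_rename_inl, C_eq_zero, Ideal.Quotient.eq_zero_iff_mem, hf] at h2
    exact hσ𝔮 _ h2
  have : (RingHom.ker (D.toQuot 𝔮)).IsPrime := RingHom.ker_isPrime _
  have h2 := hchain.cons hlt
  rw [Fintype.card_sum, Fintype.card_fin] at h2
  -- The chain has `r + 2 + 2p` steps, of which `p + 1` are given up to `T, T_1, …, T_p`.
  have h3 := D.chainTo_comap_toAlgebra h𝔮h ⟨0, hp⟩ σ hσ hσ𝔮 (d := r + 1 + p)
    (by convert h2 using 1; omega)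
  -- If `𝔮` contained all generators of `B` of direction `i`, it would contain `[B]_{e_i}` and with
  -- it `y (σ i)`.
  have hS : varSupport D.dx (𝔮.comap D.toAlgebra) = Set.univ := by
    refine Set.eq_univ_of_forall fun i => ?_
    by_contra hi
    refine hσ𝔮 i ?_
    have hy := D.y_mem (σ i)
    rw [hσ, ← zero_add (Pi.single i 1 : Fin p → ℕ)] at hy
    refine D.mem_of_mem_add_single hy (M := 𝔮.restrictScalars R) fun s hs c _ => ?_
    refine 𝔮.mul_mem_right _ ?_
    by_contra hx
    refine hi ⟨s, hs, fun hX => hx ?_⟩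
    rw [Ideal.mem_comap, toAlgebra, aeval_X] at hX
    exact hX
  have h4 := hasChain_of_chainTo (dir := D.dx) _ (Ideal.comap_isPrime _ _)
    (D.isHomogeneous_comap_toAlgebra h𝔮h) _ h3
  rw [hS, Set.ncard_univ, Nat.card_eq_fintype_card, Fintype.card_fin, Nat.add_sub_cancel] at h4
  obtain ⟨l, hl, -⟩ := D.exists_ltSeries_of_hasChain (fun f hf => by
    rw [Ideal.mem_comap, (hf : D.toAlgebra f = 0)]
    exact 𝔮.zero_mem) h4
  have h5 := (Order.LTSeries.length_le_krullDim l).trans ((krullDim_multiProj_le 𝒜).trans hdim)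
  rw [hl] at h5
  have h6 : r + 1 ≤ r := by exact_mod_cast h5
  omega

end Presentation

end Dimension

end JointBlowup

namespace JointBlowup

open MvPolynomial DirectSum

/-! ### Hilbert polynomials of the joint blow-up -/

section HilbertPolynomial

variable {p : ℕ}

theorem IsHilbertPolynomial.unique {h : (Fin p → ℤ) → (Fin p → ℕ) → ℕ∞}
    {P Q : MvPolynomial (Fin p ⊕ Fin p) ℚ} (hP : IsHilbertPolynomial h P)
    (hQ : IsHilbertPolynomial h Q) : P = Q := by
  obtain ⟨v₀, n₀, hP⟩ := hP
  obtain ⟨v₁, n₁, hQ⟩ := hQ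
  -- The sum of all thresholds is a crude common bound for each of them.
  refine eq_of_eval_eq_of_le (∑ i, ((v₀ i : ℤ) + v₁ i + n₀ i + n₁ i)) fun d hd => ?_
  have h1 : ∀ (j : Fin p ⊕ Fin p) (i : Fin p), (v₀ i : ℤ) + v₁ i + n₀ i + n₁ i ≤ d j := fun j i =>
    (Finset.single_le_sum (f := fun i => (v₀ i : ℤ) + v₁ i + n₀ i + n₁ i)
      (fun _ _ => by positivity) (Finset.mem_univ i)).trans (hd j)
  have h2 : d = Sum.elim (fun i => (((d (Sum.inl i)).toNat : ℕ) : ℤ))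
      fun i => (((d (Sum.inr i)).toNat : ℕ) : ℤ) := by
    funext j
    rcases j with i | i
    · have := h1 (Sum.inl i) i
      rw [Sum.elim_inl]
      omega
    · have := h1 (Sum.inr i) i
      rw [Sum.elim_inr]
      omega
  have h3 : (fun j => (d j : ℚ)) = Sum.elim (fun i => (((d (Sum.inl i)).toNat : ℕ) : ℚ))
      fun i => (((d (Sum.inr i)).toNat : ℕ) : ℚ) := by
    funext j
    conv_lhs => rw [h2]
    rcases j with i | i <;> exact (Int.cast_natCast _)
  obtain ⟨c, hc, hcP⟩ := hP (fun i => (d (Sum.inl i)).toNat) (fun i => (d (Sum.inr i)).toNat)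
    (fun i => show v₀ i ≤ (d (Sum.inl i)).toNat by have := h1 (Sum.inl i) i; omega)
    (fun i => show n₀ i ≤ (d (Sum.inr i)).toNat by have := h1 (Sum.inr i) i; omega)
  obtain ⟨c', hc', hcQ⟩ := hQ (fun i => (d (Sum.inl i)).toNat) (fun i => (d (Sum.inr i)).toNat)
    (fun i => show v₁ i ≤ (d (Sum.inl i)).toNat by have := h1 (Sum.inl i) i; omega)
    (fun i => show n₁ i ≤ (d (Sum.inr i)).toNat by have := h1 (Sum.inr i) i; omega)
  rw [h3, hcP, hcQ]
  rw [hc] at hc'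
  exact_mod_cast hc'

theorem isHilbertPolynomial_of_forall_le {h : (Fin p ⊕ Fin p → ℤ) → ℕ∞}
    {P : MvPolynomial (Fin p ⊕ Fin p) ℚ} {N : ℤ}
    (hP : ∀ d, (∀ i, N ≤ d i) → ∃ c : ℕ, h d = c ∧ eval (fun i => (d i : ℚ)) P = c) :
    IsHilbertPolynomial (fun v n => h (Sum.elim v fun i => (n i : ℤ))) P := by
  refine ⟨fun _ => N.toNat, fun _ => N.toNat, fun v n hv hn => ?_⟩
  obtain ⟨c, hc, hcP⟩ := hP (Sum.elim (fun i => (v i : ℤ)) fun i => (n i : ℤ)) fun j => by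
    rcases j with i | i
    · have : N.toNat ≤ v i := hv i
      rw [Sum.elim_inl]
      omega
    · have : N.toNat ≤ n i := hn i
      rw [Sum.elim_inr]
      omega
  refine ⟨c, hc, ?_⟩
  rw [← hcP]
  refine congrArg (fun x => eval x P) (_root_.funext fun j => ?_)
  rcases j with i | i <;> simp

theorem mixedJMultiplicity_eq {R G : Type*} [CommRing R] [IsLocalRing R] [AddCommGroup G] [Module R G]
    {𝒢 : (Fin p → ℤ) → (Fin p → ℕ) → Submodule R G} {N : Submodule R G}
    {P : MvPolynomial (Fin p ⊕ Fin p) ℚ} (hP : IsHilbertPolynomial (jHilbertFunction 𝒢 N) P)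
    (α β : Fin p → ℕ) : mixedJMultiplicity 𝒢 N α β = normalizedCoeff P α β := by
  have h : ∃ P, IsHilbertPolynomial (jHilbertFunction 𝒢 N) P := ⟨P, hP⟩
  rw [mixedJMultiplicity, dif_pos h, h.choose_spec.unique hP]

theorem normalizedCoeff_mono {P Q : MvPolynomial (Fin p ⊕ Fin p) ℚ} {α β : Fin p → ℕ}
    (h : coeff (Finsupp.equivFunOnFinite.symm (Sum.elim α β)) P ≤
      coeff (Finsupp.equivFunOnFinite.symm (Sum.elim α β)) Q) :
    normalizedCoeff P α β ≤ normalizedCoeff Q α β :=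
  mul_le_mul_of_nonneg_left h (by positivity)

theorem DegLT.totalDegree_le {r : ℕ} {P : MvPolynomial (Fin p ⊕ Fin p) ℚ} (h : DegLT (r + 1) P) :
    P.totalDegree ≤ r := by
  refine Finset.sup_le fun m hm => ?_
  by_contra hlt
  refine mem_support_iff.1 hm (h m ?_)
  rw [Finsupp.degree_apply]
  exact Nat.succ_le_of_lt (not_le.1 hlt)

end HilbertPolynomial

/-! ### Existence of presentations -/

section Existence

variable {p : ℕ} {R B : Type*} [CommRing R] [CommRing B] [Algebra R B] [IsNoetherianRing R]
  {𝒜 : (Fin p → ℕ) → Submodule R B} {H : Fin p → Submodule R B}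

/-- `B` is Noetherian, so each `I_i` is generated by finitely many elements, which can be taken in
`H i` and are therefore of degree `e_i`. -/
theorem IsStandardGraded.exists_presentation (h𝒜 : IsStandardGraded 𝒜)
    (hH : ∀ i, H i ≤ 𝒜 (Pi.single i 1)) : Nonempty (Presentation 𝒜 H) := by
  classical
  obtain ⟨s, hs, hadj⟩ := h𝒜.generated
  have : Algebra.FiniteType R B := ⟨⟨s, hadj⟩⟩
  have : IsNoetherianRing B := Algebra.FiniteType.isNoetherianRing R B
  choose dx hdx using fun b : s => hs b b.2
  choose S hSH hS using fun i => (Submodule.fg_span_iff_fg_span_finset_subset _).1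
    (IsNoetherian.noetherian (Submodule.span B (H i : Set B)))
  let e := Fintype.equivFin (Σ i, S i)
  exact ⟨{
    m := s.card
    n := Fintype.card (Σ i, S i)
    x := fun j => s.equivFin.symm j
    dx := fun j => dx (s.equivFin.symm j)
    y := fun j => (e.symm j).2
    dy := fun j => (e.symm j).1
    x_mem := fun j => hdx _
    y_mem := fun j => hH _ (hSH _ (e.symm j).2.2)
    adjoin_x := by
      rw [← hadj]
      congr 1
      ext b
      constructor
      · rintro ⟨j, rfl⟩
        exact (s.equivFin.symm j).2
      · intro hb
        exact ⟨s.equivFin ⟨b, hb⟩, by simp⟩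
    span_y := fun i => by
      refine (hS i).trans (congrArg _ ?_)
      ext b
      constructor
      · intro hb
        exact ⟨e ⟨i, b, hb⟩, by simp,
          congrArg (fun q : Σ i, S i => (q.2 : B)) (e.symm_apply_apply ⟨i, b, hb⟩)⟩
      · rintro ⟨j, rfl, rfl⟩
        exact (e.symm j).2.2 }⟩

end Existence

end JointBlowup

/-! ### The monotonicity theorem -/

theorem mainTheorem8 {p : ℕ} (hp : 1 ≤ p) {R B : Type*} [CommRing R] [IsLocalRing R]
    [IsNoetherianRing R] [CommRing B] [Algebra R B]
    (𝒜 : (Fin p → ℕ) → Submodule R B) [GradedAlgebra 𝒜]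
    (h𝒜 : JointBlowup.IsStandardGraded 𝒜)
    (H : Fin p → Submodule R B)
    (hH : ∀ i, H i ≤ 𝒜 (Pi.single i 1)) (hH0 : ∀ i, H i ≠ ⊥)
    (t t' : Fin p → ℕ) (htt' : t ≤ t')
    (α β : Fin p → ℕ)
    (hdim : topologicalKrullDim ↥(JointBlowup.MultiProj 𝒜) ≤
      (((∑ i, α i) + (∑ i, β i) : ℕ) : WithBot ℕ∞)) :
    -- the invariants are well defined: Hilbert polynomials exist, of degree at most `|α| + |β|`
    (∀ s : Fin p → ℕ, ∃ P : MvPolynomial (Fin p ⊕ Fin p) ℚ,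
      JointBlowup.IsHilbertPolynomial
        (JointBlowup.jSharpHilbertFunction H 𝒜
          (JointBlowup.idealGrading 𝒜 (JointBlowup.degreeIdeal 𝒜 s))) P ∧
      P.totalDegree ≤ (∑ i, α i) + (∑ i, β i)) ∧
    -- the invariants are nonincreasing
    JointBlowup.jSharp H 𝒜
        (JointBlowup.idealGrading 𝒜 (JointBlowup.degreeIdeal 𝒜 t')) α β ≤
      JointBlowup.jSharp H 𝒜
        (JointBlowup.idealGrading 𝒜 (JointBlowup.degreeIdeal 𝒜 t)) α β := by
  obtain ⟨D⟩ := h𝒜.exists_presentation hH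
  have hr := D.relevantBound_annIdeal hp hdim
  choose P N hPN hPdeg hPpos using D.evPoly_sharpHilb hH hr
  have hP : ∀ s, JointBlowup.IsHilbertPolynomial (JointBlowup.jSharpHilbertFunction H 𝒜
      (JointBlowup.idealGrading 𝒜 (JointBlowup.degreeIdeal 𝒜 s))) (P s) := by
    intro s
    have h1 : JointBlowup.jSharpHilbertFunction H 𝒜
        (JointBlowup.idealGrading 𝒜 (JointBlowup.degreeIdeal 𝒜 s)) =
        fun v n => D.sharpHilb hH s (Sum.elim v fun i => (n i : ℤ)) :=
      funext fun v => funext fun n => D.jSharpHilbertFunction_eq hH s v n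
    rw [h1]
    exact JointBlowup.isHilbertPolynomial_of_forall_le (hPN s)
  refine ⟨fun s => ⟨P s, hP s, (hPdeg s).totalDegree_le⟩, ?_⟩
  rw [JointBlowup.jSharp, JointBlowup.jSharp, JointBlowup.mixedJMultiplicity_eq (hP t'),
    JointBlowup.mixedJMultiplicity_eq (hP t)]
  apply JointBlowup.normalizedCoeff_mono
  obtain ⟨c, c', e, ⟨C, NC, hC, hCdeg, -⟩, ⟨C', NC', hC', hCdeg', -⟩, ⟨E, NE, hE, -, hEpos⟩, N', hN'⟩ :=
    D.sharpHilb_le hH hr htt'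
  -- The eventual identity of Hilbert functions is an identity of polynomials, since polynomials
  -- agreeing on an orthant of lattice points are equal.
  have hpoly : P t + C = P t' + C' + E := by
    refine JointBlowup.eq_of_eval_eq_of_le (max (max (N t) (N t')) (max (max NC NC') (max NE N'))) fun d hd => ?_
    simp only [max_le_iff] at hd
    obtain ⟨a, ha, haP⟩ := hPN t d fun i => (hd i).1.1
    obtain ⟨a', ha', haP'⟩ := hPN t' d fun i => (hd i).1.2
    obtain ⟨b, hb, hbC⟩ := hC d fun i => (hd i).2.1.1
    obtain ⟨b', hb', hbC'⟩ := hC' d fun i => (hd i).2.1.2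
    obtain ⟨k, hk, hkE⟩ := hE d fun i => (hd i).2.2.1
    have h1 := hN' d fun i => (hd i).2.2.2
    rw [ha, ha', hb, hb', hk] at h1
    simp only [map_add, haP, haP', hbC, hbC', hkE]
    exact_mod_cast h1
  set m := Finsupp.equivFunOnFinite.symm (Sum.elim α β) with hm
  have hmdeg : m.degree = (∑ i, α i) + ∑ i, β i := by
    rw [Finsupp.degree_eq_sum, Fintype.sum_sum_type]
    rfl
  have h1 := congrArg (MvPolynomial.coeff m) hpoly
  -- The error terms `C` and `C'` have degree less than `|α| + |β|` and do not contribute; `E`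
  -- contributes a nonnegative coefficient.
  rw [MvPolynomial.coeff_add, MvPolynomial.coeff_add, MvPolynomial.coeff_add, hCdeg m hmdeg.ge,
    hCdeg' m hmdeg.ge] at h1
  have h2 := hEpos m (by rw [hmdeg])
  linarith
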